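/- Let $H:\mathbb R\times\mathbb R\to\mathbb R$ be a $C^2$ function such that 1. $H(x+1,x'+1)=H(x,x')$ for all $x,x'$; 2. there is $M>0$ with $|\partial_{ij}H(x,x')|<M$ for all $x,x'$ and $i,j\in\{1,2\}$; 3. there is $\varrho>0$ with $\partial_{12}H(x,x')<-\varrho$ for all $x,x'$. Let $F$ be the exact area-preserving twist map of $\mathbb R\times\mathbb R$ generated by $H$, that is, $F(x,r)=(x',r')$ if and only if $r=-\partial_1H(x,x')$ and $r'=\partial_2H(x,x')$; denote by $F$ also the induced map of the cylinder $\mathbb T\times\mathbb R$, $\mathbb T=\mathbb R/\mathbb Z$. An essential invariant curve is a simple closed curve in $\mathbb T\times\mathbb R$ that is invariant under $F$ and not homotopic to a point. Such a curve $\gamma$ carries the rigid rotation with rotation number $\rho\in\mathbb R$ if $F|_\gamma$ is topologically conjugate to $t\mapsto t+\rho$ on $\mathbb T$ and the lifted orbits of the points of $\gamma$ have rotation number $\rho$, i.e. $\lim_{n\to\infty}(\pi_1F^n(x,r)-x)/n=\rho$, where $\pi_1(x,r)=x$. Let $\rho_1<\rho_2$ be rational numbers and let $\gamma_1,\gamma_2$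 be essential invariant curves of $F$ carrying the rigid rotations with rotation numbers $\rho_1$ and $\rho_2$. Let $U$ be the closed region of $\mathbb T\times\mathbb R$ bounded by $\gamma_1$ and $\gamma_2$. Then the following are equivalent. (a) $F$ is rationally integrable on $[\rho_1,\rho_2]$: for every rational $\rho\in[\rho_1,\rho_2]$ there is an essential invariant curve of $F$ carrying the rigid rotation with rotation number $\rho$. (b) No orbit of $F$ in $U$ has conjugate points: for every orbit $(x_k,r_k)_{k\in\mathbb Z}$ (lifted to $\mathbb R\times\mathbb R$) that projects into $U$ and all integers $j<k$, $$\frac{\partial(\pi_1F^{k-j}(x,r))}{\partial r}\Big|_{(x_j,r_j)}\neq0 .$$ (c) $F$ is $C^0$-integrable on $U$: $U$ is foliated by (is the disjoint union of) $F$-invariant graphs over $\mathbb T$ of continuous functions $\mathbb T\to\mathbb R$. -/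

import Mathlib

open Set Filter Topology

namespace TwistMap

/-- Partial derivative in the first variable. -/
noncomputable def pd₁ (H : ℝ → ℝ → ℝ) : ℝ → ℝ → ℝ :=
  fun x x' => deriv (fun t => H t x') x

/-- Partial derivative in the second variable. -/
noncomputable def pd₂ (H : ℝ → ℝ → ℝ) : ℝ → ℝ → ℝ :=
  fun x x' => deriv (fun t => H x t) x'

/-- `C²` generating functions that are invariant under the diagonal integer translation, have
bounded second derivatives and a uniformly negative mixed derivative. -/
structure IsTwistGenerating (H : ℝ → ℝ → ℝ) : Prop where
  contDiff : ContDiff ℝ 2 (fun p : ℝ × ℝ => H p.1 p.2)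
  periodic : ∀ x x', H (x + 1) (x' + 1) = H x x'
  bounded : ∃ M : ℝ, 0 < M ∧ ∀ x x',
    |pd₁ (pd₁ H) x x'| < M ∧ |pd₁ (pd₂ H) x x'| < M ∧
    |pd₂ (pd₁ H) x x'| < M ∧ |pd₂ (pd₂ H) x x'| < M
  twist : ∃ ρ : ℝ, 0 < ρ ∧ ∀ x x', pd₁ (pd₂ H) x x' < -ρ

/-- The twist map on `ℝ × ℝ` generated by `H`: `F (x, r) = (x', r')`, where `x'` is the solution of
`r = -∂₁ H x x'` and `r' = ∂₂ H x x'`. The solution exists and is unique for every `H` as above,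
see `map_eq_iff`. -/
noncomputable def map (H : ℝ → ℝ → ℝ) (z : ℝ × ℝ) : ℝ × ℝ :=
  let x' : ℝ := Classical.epsilon (fun x' : ℝ => z.2 = -pd₁ H z.1 x')
  (x', pd₂ H z.1 x')

/-- The phase space `𝕋 × ℝ`. -/
abbrev Cylinder : Type := UnitAddCircle × ℝ

/-- The covering projection `ℝ × ℝ → 𝕋 × ℝ`. -/
def proj (z : ℝ × ℝ) : Cylinder := ((z.1 : UnitAddCircle), z.2)

/-- The twist map on `𝕋 × ℝ`: the map of `ℝ × ℝ` evaluated at the lift of the point to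
`[0, 1) × ℝ`, projected to `𝕋 × ℝ`. It does not depend on the lift, see `cylMap_proj`. -/
noncomputable def cylMap (H : ℝ → ℝ → ℝ) (w : Cylinder) : Cylinder :=
  proj (map H (((AddCircle.equivIco (1 : ℝ) 0 w.1 : Ico (0 : ℝ) (0 + 1)) : ℝ), w.2))

/-- A simple closed curve in the cylinder that is not homotopic to a point. -/
def IsEssentialCurve (Γ : Set Cylinder) : Prop :=
  ∃ γ : C(UnitAddCircle, Cylinder),
    Function.Injective γ ∧ ¬ γ.Nullhomotopic ∧ range γ = Γ

/-- Invariance of a subset of the cylinder. -/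
def IsInvariant (H : ℝ → ℝ → ℝ) (Γ : Set Cylinder) : Prop :=
  cylMap H '' Γ = Γ

/-- The dynamics on `Γ` is (topologically) conjugate to the rigid rotation `t ↦ t + ρ` of the
circle, and `ρ` is the rotation number, as a real number, of the orbits of the lifted map. -/
def IsConjToRotation (H : ℝ → ℝ → ℝ) (Γ : Set Cylinder) (ρ : ℝ) : Prop :=
  (∃ h : UnitAddCircle ≃ₜ Γ, ∀ t : UnitAddCircle,
    cylMap H (h t : Cylinder) = (h (t + (ρ : UnitAddCircle)) : Cylinder)) ∧
  ∀ z : ℝ × ℝ, proj z ∈ Γ →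
    Tendsto (fun n : ℕ => (((map H)^[n] z).1 - z.1) / (n : ℝ)) atTop (𝓝 ρ)

/-- `Γ` is an essential invariant curve carrying the rigid rotation by `ρ`. -/
structure IsRotationCurve (H : ℝ → ℝ → ℝ) (Γ : Set Cylinder) (ρ : ℝ) : Prop where
  essential : IsEssentialCurve Γ
  invariant : IsInvariant H Γ
  conj : IsConjToRotation H Γ ρ

/-- The closed region of the cylinder bounded by two curves: the curves, together with the bounded
connected components of the complement of their union. -/
def regionBetween (Γ₁ Γ₂ : Set Cylinder) : Set Cylinder :=
  {w | w ∈ Γ₁ ∪ Γ₂ ∨ Bornology.IsBounded (connectedComponentIn (Γ₁ ∪ Γ₂)ᶜ w)}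

/-- Rational integrability on `[ρ₁, ρ₂]`. -/
def RationallyIntegrableOn (H : ℝ → ℝ → ℝ) (ρ₁ ρ₂ : ℚ) : Prop :=
  ∀ ρ : ℚ, ρ₁ ≤ ρ → ρ ≤ ρ₂ → ∃ Γ : Set Cylinder, IsRotationCurve H Γ (ρ : ℝ)

/-- A full orbit of the lifted map. -/
def IsOrbit (H : ℝ → ℝ → ℝ) (z : ℤ → ℝ × ℝ) : Prop :=
  ∀ k : ℤ, z (k + 1) = map H (z k)

/-- The orbit `z = (x_k, r_k)` has no conjugate points: for all `j < k`, the derivative of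
`r ↦ π₁ F^{k-j} (x_j, r)` at `r = r_j` does not vanish. -/
def HasNoConjugatePoints (H : ℝ → ℝ → ℝ) (z : ℤ → ℝ × ℝ) : Prop :=
  ∀ j k : ℤ, j < k →
    deriv (fun r : ℝ => ((map H)^[(k - j).toNat] ((z j).1, r)).1) (z j).2 ≠ 0

/-- No orbit in the region `U` of the cylinder has conjugate points. -/
def NoConjugatePointsOn (H : ℝ → ℝ → ℝ) (U : Set Cylinder) : Prop :=
  ∀ z : ℤ → ℝ × ℝ, IsOrbit H z → (∀ k : ℤ, proj (z k) ∈ U) → HasNoConjugatePoints H z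

/-- The graph over `𝕋` of a function, as a subset of the cylinder. -/
def graph (g : C(UnitAddCircle, ℝ)) : Set Cylinder :=
  {w | w.2 = g w.1}

/-- `C⁰`-integrability on `U`: the set `U` is foliated by (is the disjoint union of) continuous
invariant graphs over `𝕋`. -/
def C0IntegrableOn (H : ℝ → ℝ → ℝ) (U : Set Cylinder) : Prop :=
  ∃ L : Set C(UnitAddCircle, ℝ),
    (∀ g ∈ L, IsInvariant H (graph g)) ∧
    L.PairwiseDisjoint graph ∧
    (⋃ g ∈ L, graph g) = U

/-! Well-definedness of the two maps. -/

lemma pd₁_eq {H : ℝ → ℝ → ℝ} (hH : IsTwistGenerating H) (x x' : ℝ) :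
    pd₁ H x x' = fderiv ℝ (fun p : ℝ × ℝ => H p.1 p.2) (x, x') (1, 0) := by
  have h1 : HasFDerivAt (fun p : ℝ × ℝ => H p.1 p.2)
      (fderiv ℝ (fun p : ℝ × ℝ => H p.1 p.2) (x, x')) (x, x') :=
    (hH.contDiff.differentiable (by norm_num) _).hasFDerivAt
  have h2 : HasDerivAt (fun t : ℝ => (t, x')) ((1 : ℝ), (0 : ℝ)) x :=
    (hasDerivAt_id x).prodMk (hasDerivAt_const x x')
  exact (h1.comp_hasDerivAt x h2).deriv

lemma pd₂_eq {H : ℝ → ℝ → ℝ} (hH : IsTwistGenerating H) (x x' : ℝ) :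
    pd₂ H x x' = fderiv ℝ (fun p : ℝ × ℝ => H p.1 p.2) (x, x') (0, 1) := by
  have h1 : HasFDerivAt (fun p : ℝ × ℝ => H p.1 p.2)
      (fderiv ℝ (fun p : ℝ × ℝ => H p.1 p.2) (x, x')) (x, x') :=
    (hH.contDiff.differentiable (by norm_num) _).hasFDerivAt
  have h2 : HasDerivAt (fun t : ℝ => (x, t)) ((0 : ℝ), (1 : ℝ)) x' :=
    (hasDerivAt_const x' x).prodMk (hasDerivAt_id x')
  exact (h1.comp_hasDerivAt x' h2).deriv

/-- The mixed second derivatives agree. -/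
lemma pd_comm {H : ℝ → ℝ → ℝ} (hH : IsTwistGenerating H) (x x' : ℝ) :
    pd₂ (pd₁ H) x x' = pd₁ (pd₂ H) x x' := by
  set f : ℝ × ℝ → ℝ := fun p => H p.1 p.2 with hf
  have hd : Differentiable ℝ (fderiv ℝ f) :=
    (hH.contDiff.fderiv_right (m := 1) (by norm_num)).differentiable (by norm_num)
  have hD : HasFDerivAt (fderiv ℝ f) (fderiv ℝ (fderiv ℝ f) (x, x')) (x, x') :=
    (hd _).hasFDerivAt
  have h1 : HasDerivAt (fun t : ℝ => (x, t)) ((0 : ℝ), (1 : ℝ)) x' :=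
    (hasDerivAt_const x' x).prodMk (hasDerivAt_id x')
  have h2 : HasDerivAt (fun t : ℝ => (t, x')) ((1 : ℝ), (0 : ℝ)) x :=
    (hasDerivAt_id x).prodMk (hasDerivAt_const x x')
  have e1 : pd₂ (pd₁ H) x x' = fderiv ℝ (fderiv ℝ f) (x, x') (0, 1) (1, 0) := by
    have h := ((ContinuousLinearMap.apply ℝ ℝ ((1 : ℝ), (0 : ℝ))).hasFDerivAt.comp_hasDerivAt x'
      (hD.comp_hasDerivAt x' h1))
    have e : (fun t => pd₁ H x t) = fun t => fderiv ℝ f (x, t) (1, 0) :=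
      funext fun t => pd₁_eq hH x t
    rw [pd₂, e]
    exact h.deriv
  have e2 : pd₁ (pd₂ H) x x' = fderiv ℝ (fderiv ℝ f) (x, x') (1, 0) (0, 1) := by
    have h := ((ContinuousLinearMap.apply ℝ ℝ ((0 : ℝ), (1 : ℝ))).hasFDerivAt.comp_hasDerivAt x
      (hD.comp_hasDerivAt x h2))
    have e : (fun t => pd₂ H t x') = fun t => fderiv ℝ f (t, x') (0, 1) :=
      funext fun t => pd₂_eq hH t x'
    rw [pd₁, e]
    exact h.deriv
  have hs : IsSymmSndFDerivAt ℝ f (x, x') :=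
    hH.contDiff.contDiffAt.isSymmSndFDerivAt (by simp)
  rw [e1, e2]
  exact hs.eq _ _

lemma existsUnique_next {H : ℝ → ℝ → ℝ} (hH : IsTwistGenerating H) (x r : ℝ) :
    ∃! x' : ℝ, r = -pd₁ H x x' := by
  obtain ⟨ρ, hρ, ht⟩ := hH.twist
  set g : ℝ → ℝ := fun x' => -pd₁ H x x' with hg
  have hd : Differentiable ℝ g := by
    have h0 : Differentiable ℝ (fderiv ℝ (fun p : ℝ × ℝ => H p.1 p.2)) :=
      (hH.contDiff.fderiv_right (m := 1) (by norm_num)).differentiable (by norm_num)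
    have e : g = fun t => -(fderiv ℝ (fun p : ℝ × ℝ => H p.1 p.2) (x, t) (1, 0)) :=
      funext fun t => by rw [hg]; simp only [pd₁_eq hH]
    rw [e]
    fun_prop
  have hder : ∀ y, ρ ≤ deriv g y := by
    intro y
    have : deriv g y = -pd₂ (pd₁ H) x y := by
      rw [hg]
      exact deriv.neg
    rw [this, pd_comm hH]
    linarith [ht x y]
  have key : ∀ a b, a ≤ b → ρ * (b - a) ≤ g b - g a := fun a b hab =>
    mul_sub_le_image_sub_of_le_deriv hd hder hab
  have hmono : StrictMono g := strictMono_of_deriv_pos fun y => lt_of_lt_of_le hρ (hder y)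
  have htop : Tendsto g atTop atTop := by
    have : Tendsto (fun y : ℝ => g 0 + ρ * y) atTop atTop :=
      tendsto_atTop_add_const_left _ _ (tendsto_id.const_mul_atTop hρ)
    refine tendsto_atTop_mono' _ ?_ this
    filter_upwards [eventually_ge_atTop (0 : ℝ)] with y hy
    have := key 0 y hy
    simp only [sub_zero] at this
    linarith
  have hbot : Tendsto g atBot atBot := by
    have : Tendsto (fun y : ℝ => g 0 + ρ * y) atBot atBot :=
      tendsto_atBot_add_const_left _ _ (tendsto_id.const_mul_atBot hρ)
    refine tendsto_atBot_mono' _ ?_ this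
    filter_upwards [eventually_le_atBot (0 : ℝ)] with y hy
    have := key y 0 hy
    linarith
  obtain ⟨y, hy⟩ := hd.continuous.surjective htop hbot r
  exact ⟨y, hy.symm, fun y' hy' => hmono.injective (hy'.symm.trans hy.symm)⟩

/-- The defining relation of the twist map generated by `H`. -/
theorem map_eq_iff {H : ℝ → ℝ → ℝ} (hH : IsTwistGenerating H) (x r x' r' : ℝ) :
    map H (x, r) = (x', r') ↔ r = -pd₁ H x x' ∧ r' = pd₂ H x x' := by
  obtain ⟨y, hy, huniq⟩ := existsUnique_next hH x r
  have hspec : r = -pd₁ H x (Classical.epsilon (fun x' : ℝ => r = -pd₁ H x x')) :=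
    Classical.epsilon_spec (p := fun x' : ℝ => r = -pd₁ H x x') ⟨y, hy⟩
  have heps := huniq _ hspec
  simp only [map, heps, Prod.mk.injEq]
  constructor
  · rintro ⟨rfl, rfl⟩
    exact ⟨hy, rfl⟩
  · rintro ⟨h1, rfl⟩
    rw [huniq x' h1]
    exact ⟨rfl, rfl⟩

lemma map_add_one {H : ℝ → ℝ → ℝ} (hH : IsTwistGenerating H) (x r : ℝ) :
    map H (x + 1, r) = ((map H (x, r)).1 + 1, (map H (x, r)).2) := by
  have p1 : ∀ a b, pd₁ H (a + 1) (b + 1) = pd₁ H a b := by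
    intro a b
    have h := deriv_comp_add_const (fun t => H t (b + 1)) 1 a
    simp only [hH.periodic] at h
    exact h.symm
  have p2 : ∀ a b, pd₂ H (a + 1) (b + 1) = pd₂ H a b := by
    intro a b
    have h := deriv_comp_add_const (fun t => H (a + 1) t) 1 b
    simp only [hH.periodic] at h
    exact h.symm
  rw [map_eq_iff hH, p1, p2]
  exact (map_eq_iff hH x r _ _).1 rfl

lemma map_add_int {H : ℝ → ℝ → ℝ} (hH : IsTwistGenerating H) (x r : ℝ) (n : ℤ) :
    map H (x + n, r) = ((map H (x, r)).1 + n, (map H (x, r)).2) := by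
  induction n using Int.induction_on with
  | zero => simp
  | succ n ih =>
    have := map_add_one hH (x + (n : ℤ)) r
    rw [ih] at this
    push_cast at this ⊢
    rw [← add_assoc, this, add_assoc]
  | pred n ih =>
    have := map_add_one hH (x + ((-n - 1 : ℤ) : ℝ)) r
    have e : x + ((-n - 1 : ℤ) : ℝ) + 1 = x + ((-n : ℤ) : ℝ) := by push_cast; ring
    rw [e, ih] at this
    have h1 := congrArg Prod.fst this
    have h2 := congrArg Prod.snd this
    simp only at h1 h2
    refine Prod.ext ?_ h2.symm
    simp only
    push_cast at h1 ⊢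
    linarith

/-- The map of the cylinder is covered by the map of the plane. -/
theorem cylMap_proj {H : ℝ → ℝ → ℝ} (hH : IsTwistGenerating H) (z : ℝ × ℝ) :
    cylMap H (proj z) = proj (map H z) := by
  obtain ⟨x, r⟩ := z
  set y : ℝ := ((AddCircle.equivIco (1 : ℝ) 0 (x : UnitAddCircle) : Ico (0 : ℝ) (0 + 1)) : ℝ)
    with hy
  have h : (y : UnitAddCircle) = (x : UnitAddCircle) :=
    (AddCircle.equivIco (1 : ℝ) 0).symm_apply_apply (x : UnitAddCircle)
  have h0 : ((y - x : ℝ) : UnitAddCircle) = 0 := by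
    rw [AddCircle.coe_sub, h, sub_self]
  obtain ⟨n, hn⟩ := (AddCircle.coe_eq_zero_iff (1 : ℝ)).1 h0
  have hyx : y = x + n := by
    simp only [zsmul_eq_mul, mul_one] at hn
    linarith
  change proj (map H (y, r)) = proj (map H (x, r))
  rw [hyx, map_add_int hH]
  refine Prod.ext ?_ rfl
  change (((map H (x, r)).1 + n : ℝ) : UnitAddCircle) = (((map H (x, r)).1 : ℝ) : UnitAddCircle)
  have hn0 : ((n : ℝ) : UnitAddCircle) = 0 :=
    (AddCircle.coe_eq_zero_iff (1 : ℝ)).2 ⟨n, by simp⟩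
  rw [AddCircle.coe_add, hn0, add_zero]

end TwistMap

namespace TwistMap

/-! ### Calculus of the generating function -/

/-! The proof runs (a) ⇒ (c) ⇒ (b) ⇒ (a), after a reduction from curves to graphs. On a curve
carrying the rotation p/q every point is periodic. Moving along such a curve towards any periodic
point of the same type gives a first contact between two ordered orbits, and by the discrete
Euler–Lagrange equation ordered orbits in contact coincide. So the orbits of this type are totally
ordered and the curve is a Lipschitz graph (`IsRotationCurve.exists_periodicGraph`). Conversely,
averaging over an orbit conjugates a graph of periodic points to a rigid rotation
(`IsPeriodicGraph.isRotationCurve`).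

(a) ⇒ (c). Periodic graphs are ordered by rotation number and are equi-Lipschitz. Hence for every ω
in the interval the supremum of those below ω and the infimum of those above are invariant graphs of
rotation number ω. The crux is that these two agree (`lowerGraph_eq_upperGraph`). An invariant graph
calibrates H: with u a primitive of its function, H(x, x') ≥ u(x') - u(x) + α, with equality exactly
along its dynamics. Subtracting the calibrations of two ordered graphs gives a nondecreasing
function D whose increment over a period is the enclosed area κ, and which gains at most κω per step
of the lower dynamics and at least κω per step of the upper one. For rational ω a periodic graph
lies between the two limits, and summing over a period turns the inequalities into equalities. For
irrational ω equality holds along a recurrent orbit. If κ > 0, then D maps the closed set where the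
graphs meet onto the line, although D' = 0 there, so that the image is null; hence κ = 0.

(c) ⇒ (b). Points above an invariant graph never fall behind it, so a Jacobi field that starts
vertically is nonnegative, and the Jacobi equation then makes it strictly positive
(`IsInvGraph.deriv_iterate_pos`).

(b) ⇒ (a). Without conjugate points, two abscissae are joined by at most one orbit segment of given
length in the region, and the action of these segments satisfies a triangle inequality
(`connectAction_add_le`). Comparing the orbit of a maximum of the periodic action with a detour that
winds many times around the orbit of a minimum shows that this action is constant
(`connectAction_const`). All its points are then critical, that is, through every abscissa passes a
periodic orbit of the given type, and these orbits fill an invariant graph. -/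

lemma hasFDerivAt_of_contDiff {K : ℝ → ℝ → ℝ} (hK : ContDiff ℝ 1 (fun p : ℝ × ℝ => K p.1 p.2))
    (x x' : ℝ) :
    HasFDerivAt (fun p : ℝ × ℝ => K p.1 p.2)
      (pd₁ K x x' • ContinuousLinearMap.fst ℝ ℝ ℝ + pd₂ K x x' • ContinuousLinearMap.snd ℝ ℝ ℝ)
      (x, x') := by
  have h0 : HasFDerivAt (fun p : ℝ × ℝ => K p.1 p.2)
      (fderiv ℝ (fun p : ℝ × ℝ => K p.1 p.2) (x, x')) (x, x') :=
    (hK.differentiable (by norm_num) _).hasFDerivAt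
  have h1 : HasDerivAt (fun t : ℝ => (t, x')) ((1 : ℝ), (0 : ℝ)) x :=
    (hasDerivAt_id x).prodMk (hasDerivAt_const x x')
  have h2 : HasDerivAt (fun t : ℝ => (x, t)) ((0 : ℝ), (1 : ℝ)) x' :=
    (hasDerivAt_const x' x).prodMk (hasDerivAt_id x')
  have e1 : pd₁ K x x' = fderiv ℝ (fun p : ℝ × ℝ => K p.1 p.2) (x, x') (1, 0) := by
    have h := h0.comp_hasDerivAt x h1
    exact h.deriv
  have e2 : pd₂ K x x' = fderiv ℝ (fun p : ℝ × ℝ => K p.1 p.2) (x, x') (0, 1) := by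
    have h := h0.comp_hasDerivAt x' h2
    exact h.deriv
  refine h0.congr_fderiv ?_
  ext <;> simp [e1, e2]

lemma hasDerivAt_pd₁ {K : ℝ → ℝ → ℝ} (hK : ContDiff ℝ 1 (fun p : ℝ × ℝ => K p.1 p.2))
    (x x' : ℝ) : HasDerivAt (fun t => K t x') (pd₁ K x x') x := by
  have h1 : HasDerivAt (fun t : ℝ => (t, x')) ((1 : ℝ), (0 : ℝ)) x :=
    (hasDerivAt_id x).prodMk (hasDerivAt_const x x')
  have := (hasFDerivAt_of_contDiff hK x x').comp_hasDerivAt x h1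
  exact this.congr_deriv (by simp)

lemma hasDerivAt_pd₂ {K : ℝ → ℝ → ℝ} (hK : ContDiff ℝ 1 (fun p : ℝ × ℝ => K p.1 p.2))
    (x x' : ℝ) : HasDerivAt (fun t => K x t) (pd₂ K x x') x' := by
  have h1 : HasDerivAt (fun t : ℝ => (x, t)) ((0 : ℝ), (1 : ℝ)) x' :=
    (hasDerivAt_const x' x).prodMk (hasDerivAt_id x')
  have := (hasFDerivAt_of_contDiff hK x x').comp_hasDerivAt x' h1
  exact this.congr_deriv (by simp)

namespace IsTwistGenerating

lemma contDiff_pd₁ {H : ℝ → ℝ → ℝ} (hH : IsTwistGenerating H) :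
    ContDiff ℝ 1 (fun p : ℝ × ℝ => pd₁ H p.1 p.2) := by
  have h0 := hH.contDiff.fderiv_right (m := 1) (by norm_num)
  simp only [pd₁_eq hH]
  exact h0.clm_apply contDiff_const

lemma contDiff_pd₂ {H : ℝ → ℝ → ℝ} (hH : IsTwistGenerating H) :
    ContDiff ℝ 1 (fun p : ℝ × ℝ => pd₂ H p.1 p.2) := by
  have h0 := hH.contDiff.fderiv_right (m := 1) (by norm_num)
  simp only [pd₂_eq hH]
  exact h0.clm_apply contDiff_const

lemma continuous_pd₁ {H : ℝ → ℝ → ℝ} (hH : IsTwistGenerating H) :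
    Continuous (fun p : ℝ × ℝ => pd₁ H p.1 p.2) := hH.contDiff_pd₁.continuous

lemma continuous_pd₂ {H : ℝ → ℝ → ℝ} (hH : IsTwistGenerating H) :
    Continuous (fun p : ℝ × ℝ => pd₂ H p.1 p.2) := hH.contDiff_pd₂.continuous

lemma add_int {H : ℝ → ℝ → ℝ} (hH : IsTwistGenerating H) (x x' : ℝ) (n : ℤ) :
    H (x + n) (x' + n) = H x x' := by
  induction n using Int.induction_on with
  | zero => simp
  | succ n ih =>
    push_cast at ih ⊢
    rw [← ih, ← hH.periodic (x + n) (x' + n), add_assoc, add_assoc]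
  | pred n ih =>
    push_cast at ih ⊢
    rw [← ih, ← hH.periodic (x + (-n - 1)) (x' + (-n - 1))]
    congr 1 <;> ring

/-- This is the twist condition integrated in each variable; it yields both solvability with respect
to either endpoint and quantitative bounds. -/
lemma exists_twist {H : ℝ → ℝ → ℝ} (hH : IsTwistGenerating H) : ∃ c : ℝ, 0 < c ∧
    (∀ x a b, a ≤ b → c * (b - a) ≤ pd₁ H x a - pd₁ H x b) ∧
    (∀ x' a b, a ≤ b → c * (b - a) ≤ pd₂ H a x' - pd₂ H b x') := by
  obtain ⟨c, hc, ht⟩ := hH.twist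
  refine ⟨c, hc, fun x a b hab => ?_, fun x' a b hab => ?_⟩
  · have hd : ∀ y, HasDerivAt (fun t => -pd₁ H x t) (-pd₁ (pd₂ H) x y) y := fun y => by
      rw [← pd_comm hH]
      exact (hasDerivAt_pd₂ hH.contDiff_pd₁ x y).neg
    have := mul_sub_le_image_sub_of_le_deriv (C := c) (fun y => (hd y).differentiableAt)
      (fun y => by rw [(hd y).deriv]; linarith [ht x y]) hab
    linarith
  · have hd : ∀ y, HasDerivAt (fun t => -pd₂ H t x') (-pd₁ (pd₂ H) y x') y := fun y =>
      (hasDerivAt_pd₁ hH.contDiff_pd₂ y x').neg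
    have := mul_sub_le_image_sub_of_le_deriv (C := c) (fun y => (hd y).differentiableAt)
      (fun y => by rw [(hd y).deriv]; linarith [ht y x']) hab
    linarith

lemma exists_lipschitz {H : ℝ → ℝ → ℝ} (hH : IsTwistGenerating H) : ∃ M : ℝ, 0 < M ∧
    (∀ x' a b, |pd₁ H a x' - pd₁ H b x'| ≤ M * |a - b|) ∧
    (∀ x a b, |pd₂ H x a - pd₂ H x b| ≤ M * |a - b|) := by
  obtain ⟨M, hM, hb⟩ := hH.bounded
  refine ⟨M, hM, fun x' a b => ?_, fun x a b => ?_⟩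
  · exact Convex.norm_image_sub_le_of_norm_hasDerivWithin_le (s := univ) (C := M)
      (fun y _ => (hasDerivAt_pd₁ hH.contDiff_pd₁ y x').hasDerivWithinAt)
      (fun y _ => (hb y x').1.le) convex_univ (mem_univ _) (mem_univ _)
  · exact Convex.norm_image_sub_le_of_norm_hasDerivWithin_le (s := univ) (C := M)
      (fun y _ => (hasDerivAt_pd₂ hH.contDiff_pd₂ x y).hasDerivWithinAt)
      (fun y _ => (hb x y).2.2.2.le) convex_univ (mem_univ _) (mem_univ _)

lemma pd₁_strictAnti {H : ℝ → ℝ → ℝ} (hH : IsTwistGenerating H) (x : ℝ) :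
    StrictAnti (pd₁ H x) := fun a b hab => by
  obtain ⟨c, hc, h, -⟩ := hH.exists_twist
  have := h x a b hab.le
  have := mul_pos hc (sub_pos.2 hab)
  linarith

lemma pd₂_strictAnti {H : ℝ → ℝ → ℝ} (hH : IsTwistGenerating H) (x' : ℝ) :
    StrictAnti (fun x => pd₂ H x x') := fun a b hab => by
  obtain ⟨c, hc, -, h⟩ := hH.exists_twist
  have := h x' a b hab.le
  have := mul_pos hc (sub_pos.2 hab)
  simp only
  linarith

lemma exists_prev {H : ℝ → ℝ → ℝ} (hH : IsTwistGenerating H) (x' r' : ℝ) :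
    ∃ x : ℝ, r' = pd₂ H x x' := by
  obtain ⟨c, hc, -, h⟩ := hH.exists_twist
  have hcont : Continuous (fun x => pd₂ H x x') :=
    hH.continuous_pd₂.comp (Continuous.prodMk continuous_id continuous_const)
  have hbot : Tendsto (fun x => pd₂ H x x') atTop atBot := by
    have : Tendsto (fun y : ℝ => pd₂ H 0 x' + -(c * y)) atTop atBot :=
      tendsto_atBot_add_const_left _ _ (tendsto_neg_atTop_atBot.comp (tendsto_id.const_mul_atTop hc))
    refine tendsto_atBot_mono' _ ?_ this
    filter_upwards [eventually_ge_atTop (0 : ℝ)] with y hy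
    have := h x' 0 y hy
    simp only [sub_zero] at this
    linarith
  have htop : Tendsto (fun x => pd₂ H x x') atBot atTop := by
    have : Tendsto (fun y : ℝ => pd₂ H 0 x' + -(c * y)) atBot atTop :=
      tendsto_atTop_add_const_left _ _ (tendsto_neg_atBot_atTop.comp (tendsto_id.const_mul_atBot hc))
    refine tendsto_atTop_mono' _ ?_ this
    filter_upwards [eventually_le_atBot (0 : ℝ)] with y hy
    have := h x' y 0 hy
    linarith
  obtain ⟨x, hx⟩ := hcont.surjective' htop hbot r'
  exact ⟨x, hx.symm⟩

/-! ### The twist map -/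

lemma map_spec {H : ℝ → ℝ → ℝ} (hH : IsTwistGenerating H) (z : ℝ × ℝ) :
    z.2 = -pd₁ H z.1 (map H z).1 ∧ (map H z).2 = pd₂ H z.1 (map H z).1 :=
  (map_eq_iff hH z.1 z.2 _ _).1 rfl

lemma map_injective {H : ℝ → ℝ → ℝ} (hH : IsTwistGenerating H) :
    Function.Injective (map H) := fun z w h => by
  have h1 := hH.map_spec z
  have h2 := hH.map_spec w
  rw [h] at h1
  have e : z.1 = w.1 := (hH.pd₂_strictAnti _).injective (h1.2.symm.trans h2.2)
  refine Prod.ext e ?_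
  rw [h1.1, h2.1, e]

lemma map_surjective {H : ℝ → ℝ → ℝ} (hH : IsTwistGenerating H) :
    Function.Surjective (map H) := fun w => by
  obtain ⟨x, hx⟩ := hH.exists_prev w.1 w.2
  exact ⟨(x, -pd₁ H x w.1), (map_eq_iff hH _ _ _ _).2 ⟨rfl, hx⟩⟩

lemma map_fst_lt {H : ℝ → ℝ → ℝ} (hH : IsTwistGenerating H) {x r s : ℝ} (h : r < s) :
    (map H (x, r)).1 < (map H (x, s)).1 := by
  have h1 := (hH.map_spec (x, r)).1
  have h2 := (hH.map_spec (x, s)).1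
  simp only at h1 h2
  by_contra hcon
  have := (hH.pd₁_strictAnti x).antitone (not_lt.1 hcon)
  linarith

lemma continuous_map_fst {H : ℝ → ℝ → ℝ} (hH : IsTwistGenerating H) :
    Continuous (fun z => (map H z).1) := by
  obtain ⟨c, hc, h, -⟩ := hH.exists_twist
  have habs : ∀ x a b, c * |b - a| ≤ |pd₁ H x a - pd₁ H x b| := fun x a b => by
    rcases le_total a b with hab | hab
    · rw [abs_of_nonneg (sub_nonneg.2 hab)]
      exact (h x a b hab).trans (le_abs_self _)
    · rw [abs_sub_comm, abs_of_nonneg (sub_nonneg.2 hab), abs_sub_comm]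
      exact (h x b a hab).trans (le_abs_self _)
  rw [continuous_iff_continuousAt]
  intro z₀
  -- The integrated twist condition bounds the distance of images by the defect in the defining
  -- equation when the old image is kept, and this defect is continuous and vanishes at `z₀`.
  have key : ∀ z, |(map H z).1 - (map H z₀).1| ≤ |z.2 + pd₁ H z.1 (map H z₀).1| / c := fun z => by
    rw [le_div_iff₀ hc, mul_comm]
    refine (habs z.1 _ _).trans_eq ?_
    rw [(hH.map_spec z).1]
    congr 1
    ring
  have hlim : Tendsto (fun z : ℝ × ℝ => |z.2 + pd₁ H z.1 (map H z₀).1| / c) (𝓝 z₀) (𝓝 0) := by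
    have hc : Continuous (fun z : ℝ × ℝ => |z.2 + pd₁ H z.1 (map H z₀).1| / c) :=
      ((continuous_snd.add (hH.continuous_pd₁.comp
        (continuous_fst.prodMk continuous_const))).abs).div_const c
    have := hc.tendsto z₀
    rwa [(hH.map_spec z₀).1, neg_add_cancel, abs_zero, zero_div] at this
  exact tendsto_iff_dist_tendsto_zero.2 (squeeze_zero (fun _ => dist_nonneg) key hlim)

lemma continuous_map {H : ℝ → ℝ → ℝ} (hH : IsTwistGenerating H) : Continuous (map H) := by
  have : map H = fun z => ((map H z).1, pd₂ H z.1 (map H z).1) := rfl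
  rw [this]
  exact hH.continuous_map_fst.prodMk
    (hH.continuous_pd₂.comp (continuous_fst.prodMk hH.continuous_map_fst))

lemma iterate_add_int {H : ℝ → ℝ → ℝ} (hH : IsTwistGenerating H) (n : ℕ) (x r : ℝ) (k : ℤ) :
    (map H)^[n] (x + k, r) = (((map H)^[n] (x, r)).1 + k, ((map H)^[n] (x, r)).2) := by
  induction n with
  | zero => rfl
  | succ n ih => rw [Function.iterate_succ_apply', Function.iterate_succ_apply', ih, map_add_int hH]

end IsTwistGenerating

/-! ### Differentiability of the map and its iterates -/

/-- Implicit differentiation of a function of two variables with respect to the second one. -/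
lemma hasFDerivAt_implicit {f R : ℝ × ℝ → ℝ} {a b : ℝ} {p : ℝ × ℝ}
    (hR : ContinuousAt R p)
    (hf : HasFDerivAt f
      (a • ContinuousLinearMap.fst ℝ ℝ ℝ + b • ContinuousLinearMap.snd ℝ ℝ ℝ) (p.1, R p))
    (hb : b ≠ 0) (hfR : ∀ᶠ w in 𝓝 p, f (w.1, R w) = w.2) :
    HasFDerivAt R ((-a / b) • ContinuousLinearMap.fst ℝ ℝ ℝ +
      (1 / b) • ContinuousLinearMap.snd ℝ ℝ ℝ) p := by
  -- `A` is the triangular derivative of `w ↦ (w.1, f w)` and `B` its inverse. Since `w ↦ (w.1, R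
  -- w)` is a continuous local section of that map, the inverse function rule applies.
  set A : ℝ × ℝ →L[ℝ] ℝ × ℝ := (ContinuousLinearMap.fst ℝ ℝ ℝ).prod
    (a • ContinuousLinearMap.fst ℝ ℝ ℝ + b • ContinuousLinearMap.snd ℝ ℝ ℝ)
  set B : ℝ × ℝ →L[ℝ] ℝ × ℝ := (ContinuousLinearMap.fst ℝ ℝ ℝ).prod
    ((-a / b) • ContinuousLinearMap.fst ℝ ℝ ℝ + (1 / b) • ContinuousLinearMap.snd ℝ ℝ ℝ)
  let e : (ℝ × ℝ) ≃L[ℝ] (ℝ × ℝ) := ContinuousLinearEquiv.equivOfInverse A B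
    (fun v => by ext <;> simp [A, B]; field_simp; ring)
    (fun v => by ext <;> simp [A, B]; field_simp; ring)
  have hg : ContinuousAt (fun w : ℝ × ℝ => (w.1, R w)) p := continuousAt_fst.prodMk hR
  have hF : HasFDerivAt (fun w : ℝ × ℝ => (w.1, f w)) (e : ℝ × ℝ →L[ℝ] ℝ × ℝ) (p.1, R p) :=
    hasFDerivAt_fst.prodMk hf
  have := HasFDerivAt.of_local_left_inverse (f := fun w : ℝ × ℝ => (w.1, f w))
    (g := fun w : ℝ × ℝ => (w.1, R w)) hg hF (hfR.mono fun w hw => Prod.ext rfl hw)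
  exact this.snd

lemma IsTwistGenerating.hasFDerivAt_map_fst {H : ℝ → ℝ → ℝ} (hH : IsTwistGenerating H)
    (z : ℝ × ℝ) : ∃ a b : ℝ, 0 < b ∧ HasFDerivAt (fun z => (map H z).1)
      (a • ContinuousLinearMap.fst ℝ ℝ ℝ + b • ContinuousLinearMap.snd ℝ ℝ ℝ) z := by
  obtain ⟨c, hc, ht⟩ := hH.twist
  have h := (hasFDerivAt_of_contDiff hH.contDiff_pd₁ z.1 (map H z).1).neg
  have hpos : 0 < -pd₂ (pd₁ H) z.1 (map H z).1 := by
    rw [pd_comm hH]; linarith [ht z.1 (map H z).1]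
  have h' := hasFDerivAt_implicit (f := fun p => -pd₁ H p.1 p.2) (R := fun z => (map H z).1)
    (a := -pd₁ (pd₁ H) z.1 (map H z).1) (b := -pd₂ (pd₁ H) z.1 (map H z).1)
    (p := z) hH.continuous_map_fst.continuousAt
    (h.congr_fderiv (by ext <;> simp)) hpos.ne'
    (Eventually.of_forall fun w => ((hH.map_spec w).1).symm)
  exact ⟨_, _, by positivity, h'⟩

lemma IsTwistGenerating.differentiable_map_fst {H : ℝ → ℝ → ℝ} (hH : IsTwistGenerating H) :
    Differentiable ℝ (fun z => (map H z).1) := fun z => by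
  obtain ⟨a, b, -, h⟩ := hH.hasFDerivAt_map_fst z
  exact h.differentiableAt

lemma IsTwistGenerating.differentiable_map {H : ℝ → ℝ → ℝ} (hH : IsTwistGenerating H) :
    Differentiable ℝ (map H) := by
  have : map H = fun z => ((map H z).1, pd₂ H z.1 (map H z).1) := rfl
  rw [this]
  have h2 : Differentiable ℝ (fun p : ℝ × ℝ => pd₂ H p.1 p.2) :=
    hH.contDiff_pd₂.differentiable (by norm_num)
  exact hH.differentiable_map_fst.prodMk
    (h2.comp (differentiable_fst.prodMk hH.differentiable_map_fst))

lemma IsTwistGenerating.differentiable_iterate {H : ℝ → ℝ → ℝ} (hH : IsTwistGenerating H)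
    (n : ℕ) : Differentiable ℝ ((map H)^[n]) := hH.differentiable_map.iterate n

end TwistMap

namespace TwistMap

/-! ### Lifts of orientation preserving circle homeomorphisms -/

/-- Continuous strictly increasing maps of the line commuting with the unit translation. -/
structure IsCircleLift (f : ℝ → ℝ) : Prop where
  cont : Continuous f
  mono : StrictMono f
  add_one : ∀ x, f (x + 1) = f x + 1

/-- The displacement of the iterates of `f` is compatible with the rotation number `ω`. -/
def HasRot (f : ℝ → ℝ) (ω : ℝ) : Prop :=
  ∀ (n : ℕ) (m : ℤ), ((m : ℝ) < n * ω → ∀ y, y + m < f^[n] y) ∧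
    ((n : ℝ) * ω < m → ∀ y, f^[n] y < y + m)

lemma add_int_of_add_one {f : ℝ → ℝ} {c : ℝ} (h : ∀ x, f (x + 1) = f x + c) (x : ℝ) (k : ℤ) :
    f (x + k) = f x + k * c := by
  induction k using Int.induction_on with
  | zero => simp
  | succ n ih =>
    push_cast at ih ⊢
    rw [← add_assoc, h, ih]
    ring
  | pred n ih =>
    have := h (x + ((-n - 1 : ℤ) : ℝ))
    have e : x + ((-n - 1 : ℤ) : ℝ) + 1 = x + ((-n : ℤ) : ℝ) := by push_cast; ring
    rw [e, ih] at this
    push_cast at this ⊢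
    linarith

namespace IsCircleLift

lemma add_int {f : ℝ → ℝ} (hf : IsCircleLift f) (x : ℝ) (k : ℤ) : f (x + k) = f x + k := by
  simpa using add_int_of_add_one hf.add_one x k

lemma iterate {f : ℝ → ℝ} (hf : IsCircleLift f) (n : ℕ) : IsCircleLift f^[n] where
  cont := hf.cont.iterate n
  mono := hf.mono.iterate n
  add_one x := by
    induction n with
    | zero => rfl
    | succ n ih => rw [Function.iterate_succ_apply', Function.iterate_succ_apply', ih, hf.add_one]

lemma surjective {f : ℝ → ℝ} (hf : IsCircleLift f) : Function.Surjective f := fun y => by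
  have h0 : f (⌊y - f 0⌋ : ℝ) = f 0 + ⌊y - f 0⌋ := by simpa using hf.add_int 0 ⌊y - f 0⌋
  have h1 := hf.add_one (⌊y - f 0⌋ : ℝ)
  obtain ⟨x, -, hx⟩ := intermediate_value_Icc (a := (⌊y - f 0⌋ : ℝ)) (b := (⌊y - f 0⌋ : ℝ) + 1)
    (by linarith) hf.cont.continuousOn (show y ∈ _ from
      ⟨by rw [h0]; linarith [Int.floor_le (y - f 0)],
       by rw [h1, h0]; linarith [Int.lt_floor_add_one (y - f 0)]⟩)
  exact ⟨x, hx⟩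

/-- A displacement bound at one point for `f^[n]` propagates to the iterates of `f^[n]`. -/
lemma iterate_mul_le {f : ℝ → ℝ} (hf : IsCircleLift f) {n : ℕ} {m : ℤ} {y : ℝ}
    (h : f^[n] y ≤ y + m) (k : ℕ) : f^[n * k] y ≤ y + k * m := by
  induction k with
  | zero => simp
  | succ k ih =>
    have h1 := (hf.iterate n).mono.monotone ih
    rw [Nat.mul_succ, Nat.add_comm (n * k), Function.iterate_add_apply]
    have h2 := (hf.iterate n).add_int y (k * m)
    push_cast at h2 ⊢
    linarith

lemma le_iterate_mul {f : ℝ → ℝ} (hf : IsCircleLift f) {n : ℕ} {m : ℤ} {y : ℝ}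
    (h : y + m ≤ f^[n] y) (k : ℕ) : y + k * m ≤ f^[n * k] y := by
  induction k with
  | zero => simp
  | succ k ih =>
    have h1 := (hf.iterate n).mono.monotone ih
    rw [Nat.mul_succ, Nat.add_comm (n * k), Function.iterate_add_apply]
    have h2 := (hf.iterate n).add_int y (k * m)
    push_cast at h2 ⊢
    linarith

/-- If the `n`-th iterate violated one of the bounds at a single point, iterating `q` times would
contradict the exact displacement `n * p` of the iterate of order `n * q`. -/
lemma hasRot_of_iterate_eq {f : ℝ → ℝ} (hf : IsCircleLift f) {q : ℕ} (hq : 0 < q) {p : ℤ}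
    (h : ∀ y, f^[q] y = y + p) : HasRot f ((p : ℝ) / q) := by
  have hq' : (0 : ℝ) < q := by exact_mod_cast hq
  have key : ∀ (n : ℕ) y, f^[n * q] y = y + n * p := fun n y => by
    rw [mul_comm]
    exact le_antisymm (hf.iterate_mul_le (h y).le n) (hf.le_iterate_mul (h y).ge n)
  intro n m
  constructor
  · intro hm y
    by_contra hcon
    have h1 := hf.iterate_mul_le (not_lt.1 hcon) q
    rw [key] at h1
    rw [mul_div_assoc', lt_div_iff₀ hq'] at hm
    nlinarith
  · intro hm y
    by_contra hcon
    have h1 := hf.le_iterate_mul (not_lt.1 hcon) q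
    rw [key] at h1
    rw [mul_div_assoc', div_lt_iff₀ hq'] at hm
    nlinarith

/-- Each bound in `HasRot` is a strict inequality between `m` and `n * ω`, so a comparison map with
a nearby rotation number suffices; it may depend on `n` and `m`. -/
lemma hasRot_of_between {f : ℝ → ℝ} (hf : IsCircleLift f) {ω : ℝ}
    (hl : ∀ (n : ℕ) (m : ℤ), (m : ℝ) < n * ω →
      ∃ f' ω', Monotone f' ∧ HasRot f' ω' ∧ (∀ x, f' x ≤ f x) ∧ (m : ℝ) < n * ω')
    (hu : ∀ (n : ℕ) (m : ℤ), (n : ℝ) * ω < m →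
      ∃ f' ω', HasRot f' ω' ∧ (∀ x, f x ≤ f' x) ∧ (n : ℝ) * ω' < m) :
    HasRot f ω := by
  intro n m
  constructor
  · intro h y
    obtain ⟨f', ω', hm, hr, hle, hlt⟩ := hl n m h
    exact ((hr n m).1 hlt y).trans_le (hm.iterate_le_of_le hle n y)
  · intro h y
    obtain ⟨f', ω', hr, hle, hlt⟩ := hu n m h
    exact (hf.mono.monotone.iterate_le_of_le hle n y).trans_lt ((hr n m).2 hlt y)

end IsCircleLift

namespace HasRot

lemma abs_sub_le {f : ℝ → ℝ} {ω : ℝ} (h : HasRot f ω) (n : ℕ) (y : ℝ) :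
    |f^[n] y - y - n * ω| ≤ 1 := by
  -- `HasRot` speaks only of integers strictly on one side of `n * ω`. The nearest ones are the
  -- ceiling minus one and the floor plus one, also when `n * ω` is an integer.
  have h1 := (h n (⌈(n : ℝ) * ω⌉ - 1)).1 (by push_cast; linarith [Int.ceil_lt_add_one ((n : ℝ) * ω)]) y
  have h2 := (h n (⌊(n : ℝ) * ω⌋ + 1)).2 (by push_cast; linarith [Int.lt_floor_add_one ((n : ℝ) * ω)]) y
  push_cast at h1 h2
  rw [abs_le]
  constructor <;> linarith [Int.floor_le ((n : ℝ) * ω), Int.le_ceil ((n : ℝ) * ω)]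

lemma tendsto {f : ℝ → ℝ} {ω : ℝ} (h : HasRot f ω) (y : ℝ) :
    Tendsto (fun n : ℕ => (f^[n] y - y) / (n : ℝ)) atTop (𝓝 ω) := by
  rw [tendsto_iff_dist_tendsto_zero]
  refine squeeze_zero' (Eventually.of_forall fun _ => dist_nonneg) ?_
    tendsto_one_div_atTop_nhds_zero_nat
  filter_upwards [eventually_gt_atTop 0] with n hn
  have hn' : (0 : ℝ) < n := by exact_mod_cast hn
  rw [Real.dist_eq, le_div_iff₀ hn']
  have e : (f^[n] y - y) / n - ω = (f^[n] y - y - n * ω) / n := by field_simp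
  rw [e, abs_div, abs_of_pos hn', div_mul_cancel₀ _ hn'.ne']
  exact h.abs_sub_le n y

lemma unique_le {f f' : ℝ → ℝ} {ω ω' : ℝ} (h : HasRot f ω) (h' : HasRot f' ω') {y : ℝ}
    (hle : ∀ n : ℕ, f^[n] y ≤ f'^[n] y) : ω ≤ ω' :=
  le_of_tendsto_of_tendsto' (h.tendsto y) (h'.tendsto y) fun n =>
    div_le_div_of_nonneg_right (sub_le_sub_right (hle n) y) n.cast_nonneg

end HasRot

/-! ### Invariant graphs -/

/-- `g` is a continuous periodic function whose graph is mapped into itself. -/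
structure IsInvGraph (H : ℝ → ℝ → ℝ) (g : ℝ → ℝ) : Prop where
  cont : Continuous g
  per : ∀ x, g (x + 1) = g x
  inv : ∀ x, (map H (x, g x)).2 = g (map H (x, g x)).1

/-- The dynamics on the graph of `g`, read on the first coordinate. -/
noncomputable def graphMap (H : ℝ → ℝ → ℝ) (g : ℝ → ℝ) (x : ℝ) : ℝ := (map H (x, g x)).1

namespace IsInvGraph

lemma add_int {H : ℝ → ℝ → ℝ} {g : ℝ → ℝ} (hg : IsInvGraph H g) (x : ℝ) (k : ℤ) :
    g (x + k) = g x := by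
  simpa using add_int_of_add_one (c := 0) (fun x => by simpa using hg.per x) x k

lemma map_eq {H : ℝ → ℝ → ℝ} {g : ℝ → ℝ} (hg : IsInvGraph H g) (x : ℝ) :
    map H (x, g x) = (graphMap H g x, g (graphMap H g x)) := Prod.ext rfl (hg.inv x)

lemma iterate_eq {H : ℝ → ℝ → ℝ} {g : ℝ → ℝ} (hg : IsInvGraph H g) (n : ℕ) (x : ℝ) :
    (map H)^[n] (x, g x) = ((graphMap H g)^[n] x, g ((graphMap H g)^[n] x)) := by
  induction n with
  | zero => rfl
  | succ n ih => rw [Function.iterate_succ_apply', ih, hg.map_eq, Function.iterate_succ_apply']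

variable {H : ℝ → ℝ → ℝ} {g : ℝ → ℝ}

lemma isCircleLift (hg : IsInvGraph H g) (hH : IsTwistGenerating H) :
    IsCircleLift (graphMap H g) := by
  have hc : Continuous (graphMap H g) :=
    hH.continuous_map_fst.comp (continuous_id.prodMk hg.cont)
  have h1 : ∀ x, graphMap H g (x + 1) = graphMap H g x + 1 := fun x => by
    rw [graphMap, hg.per, map_add_one hH]; rfl
  have hinj : Function.Injective (graphMap H g) := fun x y h => by
    have : (x, g x) = (y, g y) := hH.map_injective (by rw [hg.map_eq, hg.map_eq, h])
    exact congrArg Prod.fst this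
  -- A continuous injection of the line is strictly monotone one way or the other; commuting with
  -- the unit translation excludes the decreasing case.
  refine ⟨hc, (hc.strictMono_of_inj hinj).resolve_right fun h => ?_, h1⟩
  have := h (show (0 : ℝ) < 0 + 1 by norm_num)
  linarith [h1 0]

lemma eq_pd₁ (_ : IsInvGraph H g) (hH : IsTwistGenerating H) (x : ℝ) :
    g x = -pd₁ H x (graphMap H g x) := (hH.map_spec (x, g x)).1

lemma eq_pd₂ (hg : IsInvGraph H g) (hH : IsTwistGenerating H) (x : ℝ) :
    g (graphMap H g x) = pd₂ H x (graphMap H g x) := by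
  exact (hg.inv x).symm.trans (hH.map_spec (x, g x)).2

/-- Points above an invariant graph stay above it. -/
lemma lt_map (hg : IsInvGraph H g) (hH : IsTwistGenerating H) {z : ℝ × ℝ} (h : g z.1 < z.2) :
    graphMap H g z.1 < (map H z).1 ∧ g (map H z).1 < (map H z).2 := by
  have h1 : graphMap H g z.1 < (map H z).1 := hH.map_fst_lt (x := z.1) h
  refine ⟨h1, ?_⟩
  obtain ⟨y, hy⟩ := (hg.isCircleLift hH).surjective (map H z).1
  rw [(hH.map_spec z).2, ← hy, hg.eq_pd₂ hH, hy]
  apply hH.pd₂_strictAnti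
  rw [← hy] at h1
  exact (hg.isCircleLift hH).mono.lt_iff_lt.1 h1

lemma map_lt (hg : IsInvGraph H g) (hH : IsTwistGenerating H) {z : ℝ × ℝ} (h : z.2 < g z.1) :
    (map H z).1 < graphMap H g z.1 ∧ (map H z).2 < g (map H z).1 := by
  have h1 : (map H z).1 < graphMap H g z.1 := hH.map_fst_lt (x := z.1) h
  refine ⟨h1, ?_⟩
  obtain ⟨y, hy⟩ := (hg.isCircleLift hH).surjective (map H z).1
  rw [(hH.map_spec z).2, ← hy, hg.eq_pd₂ hH, hy]
  apply hH.pd₂_strictAnti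
  rw [← hy] at h1
  exact (hg.isCircleLift hH).mono.lt_iff_lt.1 h1

lemma map_snd_eq (hg : IsInvGraph H g) {z : ℝ × ℝ} (h : z.2 = g z.1) :
    (map H z).2 = g (map H z).1 := by
  have : z = (z.1, g z.1) := Prod.ext rfl h
  rw [this]
  exact hg.inv _

lemma le_map_iff (hg : IsInvGraph H g) (hH : IsTwistGenerating H) (z : ℝ × ℝ) :
    g (map H z).1 ≤ (map H z).2 ↔ g z.1 ≤ z.2 := by
  constructor
  · intro h
    by_contra hcon
    exact absurd (hg.map_lt hH (not_le.1 hcon)).2 (not_lt.2 h)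
  · intro h
    rcases h.eq_or_lt with h | h
    · exact (hg.map_snd_eq h.symm).ge
    · exact (hg.lt_map hH h).2.le

lemma map_le_iff (hg : IsInvGraph H g) (hH : IsTwistGenerating H) (z : ℝ × ℝ) :
    (map H z).2 ≤ g (map H z).1 ↔ z.2 ≤ g z.1 := by
  constructor
  · intro h
    by_contra hcon
    exact absurd (hg.lt_map hH (not_le.1 hcon)).2 (not_lt.2 h)
  · intro h
    rcases h.eq_or_lt with h | h
    · exact (hg.map_snd_eq h).le
    · exact (hg.map_lt hH h).2.le

/-- Each step puts the point strictly ahead of the graph dynamics, and the graph dynamics preserves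
order, so the lead is never lost. It is strict only from time one on, since at time zero the
abscissae agree. -/
lemma iterate_gt (hg : IsInvGraph H g) (hH : IsTwistGenerating H) {z : ℝ × ℝ} (h : g z.1 < z.2)
    (n : ℕ) : (graphMap H g)^[n] z.1 ≤ ((map H)^[n] z).1 ∧
      g ((map H)^[n] z).1 < ((map H)^[n] z).2 ∧
      (0 < n → (graphMap H g)^[n] z.1 < ((map H)^[n] z).1) := by
  induction n with
  | zero => exact ⟨le_rfl, h, fun h => absurd h (lt_irrefl 0)⟩
  | succ n ih =>
    rw [Function.iterate_succ_apply', Function.iterate_succ_apply']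
    have h1 := hg.lt_map hH ih.2.1
    have h2 := ((hg.isCircleLift hH).mono.monotone ih.1).trans_lt h1.1
    exact ⟨h2.le, h1.2, fun _ => h2⟩

lemma iterate_lt (hg : IsInvGraph H g) (hH : IsTwistGenerating H) {z : ℝ × ℝ} (h : z.2 < g z.1)
    (n : ℕ) : ((map H)^[n] z).1 ≤ (graphMap H g)^[n] z.1 ∧
      ((map H)^[n] z).2 < g ((map H)^[n] z).1 ∧
      (0 < n → ((map H)^[n] z).1 < (graphMap H g)^[n] z.1) := by
  induction n with
  | zero => exact ⟨le_rfl, h, fun h => absurd h (lt_irrefl 0)⟩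
  | succ n ih =>
    rw [Function.iterate_succ_apply', Function.iterate_succ_apply']
    have h1 := hg.map_lt hH ih.2.1
    have h2 := h1.1.trans_le ((hg.isCircleLift hH).mono.monotone ih.1)
    exact ⟨h2.le, h1.2, fun _ => h2⟩

end IsInvGraph

lemma graphMap_le {H : ℝ → ℝ → ℝ} (hH : IsTwistGenerating H) {g₁ g₂ : ℝ → ℝ} {x : ℝ}
    (h : g₁ x ≤ g₂ x) : graphMap H g₁ x ≤ graphMap H g₂ x := by
  rcases h.eq_or_lt with h | h
  · rw [graphMap, h]; rfl
  · exact (hH.map_fst_lt h).le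

lemma eq_of_graphMap_eq {H : ℝ → ℝ → ℝ} (hH : IsTwistGenerating H) {g₁ g₂ : ℝ → ℝ} {x : ℝ}
    (h : graphMap H g₁ x = graphMap H g₂ x) : g₁ x = g₂ x := by
  rcases lt_trichotomy (g₁ x) (g₂ x) with h' | h' | h'
  · exact absurd h (hH.map_fst_lt h').ne
  · exact h'
  · exact absurd h (hH.map_fst_lt h').ne'

/-! ### Lipschitz bounds and calibrations -/

/-- Invariant graphs are equi-Lipschitz. -/
lemma IsTwistGenerating.exists_lipschitz_graph {H : ℝ → ℝ → ℝ} (hH : IsTwistGenerating H) :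
    ∃ M : ℝ, 0 < M ∧ ∀ g, IsInvGraph H g → ∀ x y, |g x - g y| ≤ M * |x - y| := by
  obtain ⟨M, hM, h1, h2⟩ := hH.exists_lipschitz
  refine ⟨M, hM, fun g hg => ?_⟩
  have hf := hg.isCircleLift hH
  have key : ∀ x y, x < y → |g x - g y| ≤ M * |x - y| := by
    intro x y hxy
    obtain ⟨x₀, rfl⟩ := hf.surjective x
    obtain ⟨y₀, rfl⟩ := hf.surjective y
    have hxy₀ := hf.mono.lt_iff_lt.1 hxy
    set x := graphMap H g x₀
    set y := graphMap H g y₀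
    -- One bound comes from expressing `g` through the preimages and `∂₂H`, the other through the
    -- images and `∂₁H`. In each, order preservation and twist give the mixed term a favourable
    -- sign, so the constant does not depend on `g`.
    rw [abs_le]
    constructor
    · have := h2 y₀ x y
      have e1 : g y = pd₂ H y₀ y := hg.eq_pd₂ hH y₀
      have e2 : g x = pd₂ H x₀ x := hg.eq_pd₂ hH x₀
      have e3 := hH.pd₂_strictAnti x hxy₀
      simp only at e3
      have := (abs_le.1 this).1
      linarith
    · have := h1 (graphMap H g x) x y
      have e3 := hH.pd₁_strictAnti y (hf.mono hxy)
      have := (abs_le.1 this).1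
      linarith [hg.eq_pd₁ hH x, hg.eq_pd₁ hH y]
  intro x y
  rcases lt_trichotomy x y with h | h | h
  · exact key x y h
  · simp [h]
  · rw [abs_sub_comm, abs_sub_comm x]
    exact key y x h

/-- The twist condition converts variation of the momentum into variation of the image. The bound
makes up for the missing differentiability of the graph in `IsInvGraph.exists_calibration`. -/
lemma IsInvGraph.exists_lipschitz_graphMap {H : ℝ → ℝ → ℝ} (hH : IsTwistGenerating H) {g : ℝ → ℝ}
    (hg : IsInvGraph H g) :
    ∃ C : ℝ, ∀ x y, |graphMap H g x - graphMap H g y| ≤ C * |x - y| := by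
  obtain ⟨M, hM, h1, -⟩ := hH.exists_lipschitz
  obtain ⟨M', -, h2⟩ := hH.exists_lipschitz_graph
  obtain ⟨c, hc, h3, -⟩ := hH.exists_twist
  have hf := hg.isCircleLift hH
  have key : ∀ x y, x ≤ y → |graphMap H g x - graphMap H g y| ≤ (M + M') / c * |x - y| := by
    intro x y hxy
    have hfxy := hf.mono.monotone hxy
    rw [abs_sub_comm, abs_of_nonneg (sub_nonneg.2 hfxy), div_mul_eq_mul_div, le_div_iff₀ hc]
    have a1 := h3 y _ _ hfxy
    have a2 := (abs_le.1 (h1 (graphMap H g x) x y)).1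
    have a3 := (abs_le.1 (h2 g hg x y)).1
    have e1 := hg.eq_pd₁ hH x
    have e2 := hg.eq_pd₁ hH y
    linarith
  refine ⟨(M + M') / c, fun x y => ?_⟩
  rcases le_total x y with h | h
  · exact key x y h
  · rw [abs_sub_comm, abs_sub_comm x]
    exact key y x h

/-- The primitive of the function `g`. -/
noncomputable def prim (g : ℝ → ℝ) (x : ℝ) : ℝ := ∫ t in (0 : ℝ)..x, g t

lemma hasDerivAt_prim {g : ℝ → ℝ} (hg : Continuous g) (x : ℝ) : HasDerivAt (prim g) (g x) x :=
  hg.integral_hasStrictDerivAt 0 x |>.hasDerivAt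

/-- An invariant graph calibrates the generating function. -/
lemma IsInvGraph.exists_calibration {H : ℝ → ℝ → ℝ} (hH : IsTwistGenerating H) {g : ℝ → ℝ}
    (hg : IsInvGraph H g) : ∃ α : ℝ,
      (∀ x x', prim g x' - prim g x + α ≤ H x x') ∧
      (∀ x, H x (graphMap H g x) = prim g (graphMap H g x) - prim g x + α) ∧
      ∀ x x', H x x' = prim g x' - prim g x + α → x' = graphMap H g x := by
  have hf := hg.isCircleLift hH
  set f := graphMap H g
  set E : ℝ × ℝ → ℝ := fun p => prim g p.2 - prim g p.1 - H p.1 p.2 with hE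
  -- The defining equations of the map say precisely that the gradient of `E` vanishes at the points
  -- `(x, f x)`.
  have hH1 : ContDiff ℝ 1 (fun p : ℝ × ℝ => H p.1 p.2) := hH.contDiff.of_le (by norm_num)
  have hEd : ∀ x, HasFDerivAt E (0 : ℝ × ℝ →L[ℝ] ℝ) (x, f x) := fun x => by
    have h1 : HasFDerivAt (fun p : ℝ × ℝ => prim g p.2)
        (g (f x) • ContinuousLinearMap.snd ℝ ℝ ℝ) (x, f x) :=
      HasDerivAt.comp_hasFDerivAt (f := Prod.snd) (x, f x) (hasDerivAt_prim hg.cont (f x))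
        hasFDerivAt_snd
    have h2 : HasFDerivAt (fun p : ℝ × ℝ => prim g p.1)
        (g x • ContinuousLinearMap.fst ℝ ℝ ℝ) (x, f x) :=
      HasDerivAt.comp_hasFDerivAt (f := Prod.fst) (x, f x) (hasDerivAt_prim hg.cont x)
        hasFDerivAt_fst
    refine ((h1.sub h2).sub (hasFDerivAt_of_contDiff hH1 x (f x))).congr_fderiv ?_
    have e1 := hg.eq_pd₁ hH x
    have e2 := hg.eq_pd₂ hH x
    ext
    · simp [e1, f]
    · simp [e2, f]
  obtain ⟨C, hC⟩ := hg.exists_lipschitz_graphMap hH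
  -- The curve `y ↦ (y, f y)` is merely Lipschitz, which is enough: at a critical point the
  -- increment of `E` is `o` of the increment of the curve, hence `o(y - x)`.
  have hed : ∀ x, HasDerivAt (fun y => E (y, f y)) 0 x := fun x => by
    have h1 := (hEd x).isLittleO
    have ht : Tendsto (fun y => (y, f y)) (𝓝 x) (𝓝 (x, f x)) :=
      (continuous_id.prodMk hf.cont).tendsto x
    have h2 := h1.comp_tendsto ht
    have h3 : (fun y => ((y, f y) : ℝ × ℝ) - (x, f x)) =O[𝓝 x] fun y => y - x := by
      refine Asymptotics.IsBigO.of_bound (max 1 C) (Eventually.of_forall fun y => ?_)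
      rw [Prod.mk_sub_mk, Prod.norm_mk, Real.norm_eq_abs, Real.norm_eq_abs]
      refine max_le ?_ ?_
      · exact (one_mul _).symm.le.trans
          (mul_le_mul_of_nonneg_right (le_max_left _ _) (abs_nonneg _))
      · exact (hC y x).trans (mul_le_mul_of_nonneg_right (le_max_right _ _) (abs_nonneg _))
    have h4 := h2.trans_isBigO h3
    rw [hasDerivAt_iff_isLittleO]
    refine h4.congr_left fun y => ?_
    simp
  have hconst : ∀ x, E (x, f x) = E (0, f 0) := fun x =>
    is_const_of_deriv_eq_zero (fun y => (hed y).differentiableAt) (fun y => (hed y).deriv) x 0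
  -- With the second variable fixed at `f s`, the twist condition makes `E` increase strictly up to
  -- `s` and decrease strictly after it, so `s` is the unique maximum.
  have hlt : ∀ x x', x' ≠ f x → E (x, x') < E (0, f 0) := by
    intro x x' hne
    obtain ⟨s, rfl⟩ := hf.surjective x'
    have hd : ∀ t, HasDerivAt (fun t => E (t, f s)) (pd₁ H t (f t) - pd₁ H t (f s)) t := fun t => by
      have := ((hasDerivAt_prim hg.cont t).const_sub (prim g (f s))).sub
        (hasDerivAt_pd₁ hH1 t (f s))
      refine this.congr_deriv ?_
      rw [hg.eq_pd₁ hH t, neg_neg]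
    have hcont : Continuous (fun t => E (t, f s)) :=
      continuous_iff_continuousAt.2 fun t => (hd t).continuousAt
    rw [← hconst s]
    rcases lt_trichotomy x s with h | h | h
    · refine strictMonoOn_of_deriv_pos (convex_Iic s) hcont.continuousOn (fun t ht => ?_)
        (mem_Iic.2 h.le) (mem_Iic.2 le_rfl) h
      rw [interior_Iic] at ht
      rw [(hd t).deriv]
      linarith [hH.pd₁_strictAnti t (hf.mono (mem_Iio.1 ht))]
    · exact absurd (by rw [h]) hne
    · refine strictAntiOn_of_deriv_neg (convex_Ici s) hcont.continuousOn (fun t ht => ?_)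
        (mem_Ici.2 le_rfl) (mem_Ici.2 h.le) h
      rw [interior_Ici] at ht
      rw [(hd t).deriv]
      linarith [hH.pd₁_strictAnti t (hf.mono (mem_Ioi.1 ht))]
  refine ⟨-E (0, f 0), fun x x' => ?_, fun x => ?_, fun x x' h => ?_⟩
  · by_cases h : x' = f x
    · have := hconst x
      simp only [hE, h] at this ⊢
      linarith
    · have := hlt x x' h
      simp only [hE] at this ⊢
      linarith
  · have := hconst x
    simp only [hE] at this ⊢
    linarith
  · by_contra hne
    have := hlt x x' hne
    simp only [hE] at this h
    linarith

end TwistMap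

namespace TwistMap

/-! ### Comparison of two ordered invariant graphs with the same rotation number -/

lemma nonpos_of_forall_nat_mul_le {a b : ℝ} (h : ∀ n : ℕ, n * a ≤ b) : a ≤ 0 := by
  by_contra hcon
  obtain ⟨n, hn⟩ := exists_nat_gt (b / a)
  rw [div_lt_iff₀ (not_le.1 hcon)] at hn
  linarith [h n]

lemma prim_add_one {g : ℝ → ℝ} (hg : Continuous g) (hp : ∀ x, g (x + 1) = g x) (x : ℝ) :
    prim g (x + 1) = prim g x + prim g 1 := by
  have hd : ∀ y, HasDerivAt (fun y => prim g (y + 1) - prim g y) 0 y := fun y => by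
    have := ((hasDerivAt_prim hg (y + 1)).comp_add_const y 1).sub (hasDerivAt_prim hg y)
    rwa [hp, sub_self] at this
  have := is_const_of_deriv_eq_zero (fun y => (hd y).differentiableAt) (fun y => (hd y).deriv) x 0
  simp only [zero_add] at this
  have h0 : prim g 0 = 0 := intervalIntegral.integral_same
  linarith

/-- A nondecreasing function comparing the dynamics on two ordered invariant graphs. -/
structure IsComparison (f₁ f₂ g₁ g₂ : ℝ → ℝ) (ω : ℝ) (D : ℝ → ℝ) (κ : ℝ) : Prop where
  deriv : ∀ x, HasDerivAt D (g₂ x - g₁ x) x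
  mono : Monotone D
  nonneg : 0 ≤ κ
  add_one : ∀ x, D (x + 1) = D x + κ
  le_lower : ∀ x, D (f₁ x) ≤ D x + κ * ω
  le_upper : ∀ x, D x + κ * ω ≤ D (f₂ x)
  eq_lower : ∀ x, D (f₁ x) = D x + κ * ω → g₁ x = g₂ x
  eq_upper : ∀ x, D (f₂ x) = D x + κ * ω → g₁ x = g₂ x

/-- The difference of `D` and `κ * x` is periodic, and on a unit interval starting at an integer
each of the two grows by at most `κ`. -/
lemma abs_sub_mul_le_of_monotone {D : ℝ → ℝ} {κ : ℝ} (hm : Monotone D)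
    (h1 : ∀ x, D (x + 1) = D x + κ) (x : ℝ) : |D x - D 0 - κ * x| ≤ κ := by
  have hκ : 0 ≤ κ := by
    have := hm (show (0 : ℝ) ≤ 0 + 1 by norm_num)
    linarith [h1 0]
  have e0 := add_int_of_add_one h1 0 ⌊x⌋
  rw [zero_add] at e0
  have e1 := hm (Int.floor_le x)
  have e2 := hm (Int.lt_floor_add_one x).le
  rw [h1] at e2
  have e3 := mul_le_mul_of_nonneg_left (Int.floor_le x) hκ
  have e4 := mul_le_mul_of_nonneg_left (Int.lt_floor_add_one x).le hκ
  rw [abs_le]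
  constructor <;> linarith

/-- `D` is the difference of the primitives and `κ` the area between the graphs over one period.
Inserting the orbits of one graph in the calibration inequality of the other bounds the gain of `D`
per step, and the common rotation number identifies the difference of the two calibration constants.
Equality forces both graphs to have the same next abscissa, hence the same momentum. -/
lemma exists_comparison {H : ℝ → ℝ → ℝ} (hH : IsTwistGenerating H) {g₁ g₂ : ℝ → ℝ}
    (hg₁ : IsInvGraph H g₁) (hg₂ : IsInvGraph H g₂) (hle : ∀ x, g₁ x ≤ g₂ x) {ω : ℝ}
    (hr₁ : HasRot (graphMap H g₁) ω) (hr₂ : HasRot (graphMap H g₂) ω) :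
    ∃ D κ, IsComparison (graphMap H g₁) (graphMap H g₂) g₁ g₂ ω D κ := by
  obtain ⟨α₁, i₁, e₁, u₁⟩ := hg₁.exists_calibration hH
  obtain ⟨α₂, i₂, e₂, u₂⟩ := hg₂.exists_calibration hH
  set f₁ := graphMap H g₁
  set f₂ := graphMap H g₂
  set D : ℝ → ℝ := fun x => prim g₂ x - prim g₁ x with hD
  set κ : ℝ := prim g₂ 1 - prim g₁ 1 with hκ
  have hd : ∀ x, HasDerivAt D (g₂ x - g₁ x) x := fun x =>
    (hasDerivAt_prim hg₂.cont x).sub (hasDerivAt_prim hg₁.cont x)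
  have hm : Monotone D := monotone_of_deriv_nonneg (fun x => (hd x).differentiableAt)
    fun x => by rw [(hd x).deriv]; linarith [hle x]
  have h1 : ∀ x, D (x + 1) = D x + κ := fun x => by
    simp only [hD, hκ, prim_add_one hg₁.cont hg₁.per, prim_add_one hg₂.cont hg₂.per]
    ring
  have hκ0 : 0 ≤ κ := by
    have := hm (show (0 : ℝ) ≤ 0 + 1 by norm_num)
    linarith [h1 0]
  have hl : ∀ x, D (f₁ x) ≤ D x + (α₁ - α₂) := fun x => by
    have := i₂ x (f₁ x)
    simp only [hD]
    linarith [e₁ x]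
  have hu : ∀ x, D x + (α₁ - α₂) ≤ D (f₂ x) := fun x => by
    have := i₁ x (f₂ x)
    simp only [hD]
    linarith [e₂ x]
  have hln : ∀ n : ℕ, D (f₁^[n] 0) ≤ D 0 + n * (α₁ - α₂) := fun n => by
    induction n with
    | zero => simp
    | succ n ih =>
      rw [Function.iterate_succ_apply']
      push_cast
      linarith [hl (f₁^[n] 0)]
  have hun : ∀ n : ℕ, D 0 + n * (α₁ - α₂) ≤ D (f₂^[n] 0) := fun n => by
    induction n with
    | zero => simp
    | succ n ih =>
      rw [Function.iterate_succ_apply']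
      push_cast
      linarith [hu (f₂^[n] 0)]
  have hδ : α₁ - α₂ = κ * ω := by
    apply le_antisymm
    · rw [← sub_nonpos]
      -- One `κ` is the deviation of `D` from linear growth, the other is the deviation of the orbit
      -- from the rotation, multiplied by `κ`.
      refine nonpos_of_forall_nat_mul_le (b := 2 * κ) fun n => ?_
      have a1 := (abs_le.1 (abs_sub_mul_le_of_monotone hm h1 (f₂^[n] 0))).2
      have a2 := (abs_le.1 (hr₂.abs_sub_le n 0)).2
      have a3 := mul_le_mul_of_nonneg_left a2 hκ0
      linarith [hun n]
    · rw [← sub_nonpos]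
      refine nonpos_of_forall_nat_mul_le (b := 2 * κ) fun n => ?_
      have a1 := (abs_le.1 (abs_sub_mul_le_of_monotone hm h1 (f₁^[n] 0))).1
      have a2 := (abs_le.1 (hr₁.abs_sub_le n 0)).1
      have a3 := mul_le_mul_of_nonneg_left a2 hκ0
      linarith [hln n]
  refine ⟨D, κ, hd, hm, hκ0, h1, by rwa [hδ] at hl, by rwa [hδ] at hu, fun x hx => ?_,
    fun x hx => ?_⟩
  · refine eq_of_graphMap_eq hH (u₂ x (f₁ x) ?_)
    simp only [hD] at hx
    linarith [e₁ x]
  · refine (eq_of_graphMap_eq hH (u₁ x (f₂ x) ?_)).symm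
    simp only [hD] at hx
    linarith [e₂ x]

namespace IsComparison

variable {f₁ f₂ g₁ g₂ : ℝ → ℝ} {ω : ℝ} {D : ℝ → ℝ} {κ : ℝ}

lemma continuous (h : IsComparison f₁ f₂ g₁ g₂ ω D κ) : Continuous D :=
  continuous_iff_continuousAt.2 fun x => (h.deriv x).continuousAt

lemma iterate_lower (h : IsComparison f₁ f₂ g₁ g₂ ω D κ) (n : ℕ) (x : ℝ) :
    D (f₁^[n] x) ≤ D x + n * (κ * ω) := by
  induction n with
  | zero => simp
  | succ n ih =>
    rw [Function.iterate_succ_apply']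
    push_cast
    linarith [h.le_lower (f₁^[n] x)]

lemma iterate_upper (h : IsComparison f₁ f₂ g₁ g₂ ω D κ) (n : ℕ) (x : ℝ) :
    D x + n * (κ * ω) ≤ D (f₂^[n] x) := by
  induction n with
  | zero => simp
  | succ n ih =>
    rw [Function.iterate_succ_apply']
    push_cast
    linarith [h.le_upper (f₂^[n] x)]

/-- Over a full period the orbit advances by `p`, so `D` gains exactly `p * κ`, the sum of the upper
bounds for the `q` steps. Every single step is therefore an equality, in particular the first. -/
lemma eq_of_periodic_lower {q : ℕ} (hq : 0 < q) {p : ℤ} (hω : ω = (p : ℝ) / q)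
    (h : IsComparison f₁ f₂ g₁ g₂ ω D κ) (hf : ∀ y, f₁^[q] y = y + p) (x : ℝ) :
    g₁ x = g₂ x := by
  subst hω
  obtain ⟨n, rfl⟩ : ∃ n, q = n + 1 := ⟨q - 1, by omega⟩
  refine h.eq_lower x (le_antisymm (h.le_lower x) ?_)
  have h1 := h.iterate_lower n (f₁ x)
  rw [← Function.iterate_succ_apply, hf, add_int_of_add_one h.add_one] at h1
  have e : ((n + 1 : ℕ) : ℝ) * (κ * (p / (n + 1 : ℕ))) = p * κ := by field_simp
  push_cast at e h1 ⊢
  linarith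

lemma eq_of_periodic_upper {q : ℕ} (hq : 0 < q) {p : ℤ} (hω : ω = (p : ℝ) / q)
    (h : IsComparison f₁ f₂ g₁ g₂ ω D κ) (hf : ∀ y, f₂^[q] y = y + p) (x : ℝ) :
    g₁ x = g₂ x := by
  subst hω
  obtain ⟨n, rfl⟩ : ∃ n, q = n + 1 := ⟨q - 1, by omega⟩
  refine h.eq_upper x (le_antisymm ?_ (h.le_upper x))
  have h1 := h.iterate_upper n (f₂ x)
  rw [← Function.iterate_succ_apply, hf, add_int_of_add_one h.add_one] at h1
  have e : ((n + 1 : ℕ) : ℝ) * (κ * (p / (n + 1 : ℕ))) = p * κ := by field_simp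
  push_cast at e h1 ⊢
  linarith

end IsComparison

/-! ### Irrational rotation numbers -/

/-- One-sided density of the numbers `n ω - m`. -/
lemma exists_nat_int_mem_Ioo {ω : ℝ} (hω : Irrational ω) (t : ℝ) {ε : ℝ} (hε : 0 < ε) :
    ∃ (n : ℕ) (m : ℤ), 0 < n ∧ t < n * ω - m ∧ n * ω - m < t + ε := by
  obtain ⟨N, hN⟩ := exists_nat_gt (1 / ε)
  have hN0 : 0 < N := by
    rcases Nat.eq_zero_or_pos N with rfl | h
    · have : 0 < 1 / ε := by positivity
      rw [Nat.cast_zero] at hN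
      linarith
    · exact h
  -- Dirichlet approximation gives a step `δ = a * ω - b` smaller than `ε`, nonzero by
  -- irrationality. Repeating it cannot jump over an interval of length `ε`.
  obtain ⟨b, a, ha, -, hab⟩ := Real.exists_int_int_abs_mul_sub_le ω hN0
  obtain ⟨a, rfl⟩ := Int.eq_ofNat_of_zero_le ha.le
  have ha' : 0 < a := by exact_mod_cast ha
  set δ : ℝ := a * ω - b with hδ
  have hδε : |δ| < ε := by
    have h1 : |δ| ≤ 1 / ((N : ℝ) + 1) := by simpa [hδ] using hab
    refine h1.trans_lt ?_
    rw [div_lt_iff₀ (by positivity)]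
    rw [div_lt_iff₀ hε] at hN
    nlinarith
  have hδ0 : δ ≠ 0 := by
    intro h0
    have : (a : ℝ) * ω = b := by linarith
    have h2 := hω.natCast_mul ha'.ne'
    rw [this] at h2
    exact h2 ⟨b, by simp⟩
  rw [abs_lt] at hδε
  rcases hδ0.lt_or_gt with hneg | hpos
  · obtain ⟨m₀, hm₀⟩ : ∃ m₀ : ℤ, (m₀ : ℝ) < ω - (t + ε) := exists_int_lt _
    set v := ω - m₀ with hv
    have hx : 0 ≤ (v - (t + ε)) / (-δ) := by
      apply div_nonneg <;> linarith
    set k := ⌊(v - (t + ε)) / (-δ)⌋₊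
    have k1 := Nat.floor_le hx
    have k2 := Nat.lt_floor_add_one ((v - (t + ε)) / (-δ))
    rw [le_div_iff₀ (by linarith)] at k1
    rw [div_lt_iff₀ (by linarith)] at k2
    refine ⟨1 + (k + 1) * a, m₀ + (k + 1) * b, by positivity, ?_, ?_⟩
    · push_cast
      have : (1 + ((k : ℝ) + 1) * a) * ω - (m₀ + (k + 1) * b) = v + (k + 1) * δ := by
        rw [hv, hδ]; ring
      rw [this]
      change (k : ℝ) * -δ ≤ _ at k1
      linarith
    · push_cast
      have : (1 + ((k : ℝ) + 1) * a) * ω - (m₀ + (k + 1) * b) = v + (k + 1) * δ := by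
        rw [hv, hδ]; ring
      rw [this]
      change _ < ((k : ℝ) + 1) * -δ at k2
      linarith
  · obtain ⟨m₀, hm₀⟩ : ∃ m₀ : ℤ, ω - t < (m₀ : ℝ) := exists_int_gt _
    set v := ω - m₀ with hv
    have hx : 0 ≤ (t - v) / δ := by
      apply div_nonneg <;> linarith
    set k := ⌊(t - v) / δ⌋₊
    have k1 := Nat.floor_le hx
    have k2 := Nat.lt_floor_add_one ((t - v) / δ)
    rw [le_div_iff₀ hpos] at k1
    rw [div_lt_iff₀ hpos] at k2
    refine ⟨1 + (k + 1) * a, m₀ + (k + 1) * b, by positivity, ?_, ?_⟩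
    · push_cast
      have : (1 + ((k : ℝ) + 1) * a) * ω - (m₀ + (k + 1) * b) = v + (k + 1) * δ := by
        rw [hv, hδ]; ring
      rw [this]
      change _ < ((k : ℝ) + 1) * δ at k2
      linarith
    · push_cast
      have : (1 + ((k : ℝ) + 1) * a) * ω - (m₀ + (k + 1) * b) = v + (k + 1) * δ := by
        rw [hv, hδ]; ring
      rw [this]
      change (k : ℝ) * δ ≤ _ at k1
      linarith

lemma exists_nat_int_mem_Ioo_of_le {ω : ℝ} (hω : Irrational ω) (t : ℝ) {ε : ℝ} (hε : 0 < ε)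
    (N : ℕ) : ∃ (n : ℕ) (m : ℤ), N ≤ n ∧ t < n * ω - m ∧ n * ω - m < t + ε := by
  obtain ⟨n, m, -, h1, h2⟩ := exists_nat_int_mem_Ioo hω (t - N * ω) hε
  exact ⟨n + N, m, by omega, by push_cast; linarith, by push_cast; linarith⟩

/-- The orbits of a circle homeomorphism are ordered like those of the rotation. -/
lemma IsCircleLift.iterate_sub_lt {f : ℝ → ℝ} {ω : ℝ} (hr : HasRot f ω)
    {k n : ℕ} {l m : ℤ} (h : k * ω - l < n * ω - m) (y : ℝ) : f^[k] y - l < f^[n] y - m := by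
  rcases le_total n k with hnk | hnk
  · obtain ⟨d, rfl⟩ := Nat.exists_eq_add_of_le' hnk
    have := (hr d (l - m)).2 (by push_cast at h ⊢; linarith) (f^[n] y)
    rw [← Function.iterate_add_apply] at this
    push_cast at this
    linarith
  · obtain ⟨d, rfl⟩ := Nat.exists_eq_add_of_le' hnk
    have := (hr d (m - l)).1 (by push_cast at h ⊢; linarith) (f^[k] y)
    rw [← Function.iterate_add_apply] at this
    push_cast at this
    linarith

/-- A circle homeomorphism with irrational rotation number has a recurrent point. -/
lemma IsCircleLift.exists_recurrent {f : ℝ → ℝ} {ω : ℝ} (hf : IsCircleLift f) (hr : HasRot f ω)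
    (hω : Irrational ω) : ∃ x : ℝ, ∀ ε > 0, ∀ N : ℕ, ∃ (a : ℕ) (b : ℤ), N ≤ a ∧
      0 < a * ω - b ∧ a * ω - b < ε ∧ x < f^[a] x - b ∧ f^[a] x - b < x + ε := by
  -- `S` consists of the translates of the forward orbit of 0 whose position under the rotation is
  -- positive. Its infimum is approached by such points from the right and serves as the recurrent
  -- point.
  set S : Set ℝ := {s | ∃ (n : ℕ) (m : ℤ), 0 < n * ω - m ∧ s = f^[n] 0 - m} with hS
  have hne : S.Nonempty := by
    obtain ⟨n, m, -, h1, -⟩ := exists_nat_int_mem_Ioo hω 0 one_pos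
    exact ⟨_, n, m, h1, rfl⟩
  have hbdd : BddBelow S := by
    refine ⟨0, ?_⟩
    rintro s ⟨n, m, h, rfl⟩
    have := (hr n m).1 (by linarith) 0
    linarith
  refine ⟨sInf S, fun ε hε N => ?_⟩
  obtain ⟨s, ⟨n, m, h1, rfl⟩, hs⟩ := exists_lt_of_csInf_lt hne
    (show sInf S < sInf S + ε by linarith)
  obtain ⟨a, b, haN, ha1, ha2⟩ := exists_nat_int_mem_Ioo_of_le hω 0
    (lt_min hε h1) N
  rw [zero_add, lt_min_iff] at ha2
  refine ⟨a, b, haN, ha1, ha2.1, ?_, ?_⟩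
  · have := (hr a b).1 (by linarith) (sInf S)
    linarith
  -- A point of `S` with small rotational position lies above the infimum, and after the return `(a,
  -- b)` it is still ordered before the chosen point `f^[n] 0 - m`. Monotonicity transfers the upper
  -- bound to the infimum.
  · obtain ⟨n', m', -, h1', h2'⟩ := exists_nat_int_mem_Ioo hω 0
      (show 0 < (n * ω - m) - (a * ω - b) by linarith)
    have hle : sInf S ≤ f^[n'] 0 - m' := csInf_le hbdd ⟨n', m', h1', rfl⟩
    have h3 := (hf.iterate a).mono.monotone hle
    have h4 := (hf.iterate a).add_int (f^[n'] 0) (-m')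
    push_cast at h4
    rw [← sub_eq_add_neg, ← sub_eq_add_neg] at h4
    rw [h4, ← Function.iterate_add_apply] at h3
    have h5 := IsCircleLift.iterate_sub_lt hr (k := a + n') (l := m' + b) (n := n) (m := m)
      (by push_cast; linarith) 0
    push_cast at h5
    linarith

namespace IsComparison

variable {f₁ f₂ g₁ g₂ : ℝ → ℝ} {ω : ℝ} {D : ℝ → ℝ} {κ : ℝ}

/-- Along the orbit of a recurrent point the two graphs agree. -/
lemma orbit_eq_of_recurrent (h : IsComparison f₁ f₂ g₁ g₂ ω D κ) {x : ℝ}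
    (hx : ∀ ε > 0, ∀ N : ℕ, ∃ (a : ℕ) (b : ℤ), N ≤ a ∧
      0 < a * ω - b ∧ a * ω - b < ε ∧ x < f₁^[a] x - b ∧ f₁^[a] x - b < x + ε) (n : ℕ) :
    D (f₁^[n] x) = D x + n * (κ * ω) := by
  refine le_antisymm (h.iterate_lower n x) (le_of_forall_pos_le_add fun ε hε => ?_)
  have hκ := h.nonneg
  -- The total deficit of the step inequalities up to a return time `a ≥ n` is at most `κ * (a * ω -
  -- b) < ε`, and it bounds the deficit of the first `n` steps. The denominator `κ + 1` covers `κ =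
  -- 0`.
  obtain ⟨a, b, hna, hab0, hab1, hx1, hx2⟩ := hx (ε / (κ + 1)) (by positivity) n
  rw [lt_div_iff₀ (by positivity)] at hab1
  obtain ⟨d, rfl⟩ := Nat.exists_eq_add_of_le' hna
  have h1 := h.mono hx1.le
  have h2 := h.iterate_lower d (f₁^[n] x)
  rw [← Function.iterate_add_apply] at h2
  have h3 := add_int_of_add_one h.add_one (f₁^[d + n] x) (-b)
  push_cast at h3 hab1 hab0
  rw [← sub_eq_add_neg] at h3
  nlinarith

/-- Two ordered invariant graphs with the same irrational rotation number enclose no area. -/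
lemma kappa_eq_zero_of_irrational (h : IsComparison f₁ f₂ g₁ g₂ ω D κ) (hf : IsCircleLift f₁)
    (hr : HasRot f₁ ω) (hω : Irrational ω) (hg₁ : Continuous g₁) (hg₂ : Continuous g₂)
    (hp₁ : ∀ x, g₁ (x + 1) = g₁ x) (hp₂ : ∀ x, g₂ (x + 1) = g₂ x) :
    κ = 0 := by
  obtain ⟨x, hx⟩ := hf.exists_recurrent hr hω
  have horb := h.orbit_eq_of_recurrent hx
  by_contra hκ0
  have hκ : 0 < κ := lt_of_le_of_ne h.nonneg (Ne.symm hκ0)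
  -- `K` contains the translated orbit of the recurrent point, on which `D` takes the dense set of
  -- values `D x + κ * (n * ω - m)`. As `K` is closed and, for `κ > 0`, bounded values of `D` come
  -- from bounded arguments, `D` maps `K` onto the line.
  set K : Set ℝ := {y | g₁ y = g₂ y} with hK
  have hKc : IsClosed K := isClosed_eq hg₁ hg₂
  have hmem : ∀ (n : ℕ) (m : ℤ), f₁^[n] x - m ∈ K := fun n m => by
    have e1 := add_int_of_add_one (c := 0) (fun x => by simpa using hp₁ x) (f₁^[n] x) (-m)
    have e2 := add_int_of_add_one (c := 0) (fun x => by simpa using hp₂ x) (f₁^[n] x) (-m)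
    push_cast at e1 e2
    rw [← sub_eq_add_neg] at e1 e2
    change g₁ _ = g₂ _
    rw [e1, e2, h.eq_lower (f₁^[n] x)]
    have := horb (n + 1)
    rw [Function.iterate_succ_apply'] at this
    push_cast at this
    linarith [horb n]
  have himage : D '' K = univ := by
    refine eq_univ_of_forall fun t => ?_
    have hseq : ∀ j : ℕ, ∃ y ∈ K, |D y - t| ≤ 1 / ((j : ℝ) + 1) := fun j => by
      obtain ⟨n, m, -, h1, h2⟩ := exists_nat_int_mem_Ioo hω ((t - D x) / κ)
        (show 0 < 1 / ((j : ℝ) + 1) / κ by positivity)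
      refine ⟨_, hmem n m, ?_⟩
      have e := add_int_of_add_one h.add_one (f₁^[n] x) (-m)
      push_cast at e
      rw [← sub_eq_add_neg] at e
      rw [e, horb]
      rw [div_lt_iff₀ hκ] at h1
      rw [← add_div, lt_div_iff₀ hκ] at h2
      rw [abs_le]
      constructor <;> nlinarith
    choose y hyK hy using hseq
    have hbdd : ∀ j, y j ∈ Icc ((t - 1 - D 0 - κ) / κ) ((t + 1 - D 0 + κ) / κ) := fun j => by
      have b1 := abs_le.1 (abs_sub_mul_le_of_monotone h.mono h.add_one (y j))
      have b2 := abs_le.1 ((hy j).trans (div_le_one_of_le₀ (by linarith [j.cast_nonneg (α := ℝ)])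
        (by positivity)))
      rw [mem_Icc, div_le_iff₀ hκ, le_div_iff₀ hκ]
      constructor <;> linarith [b1.1, b1.2, b2.1, b2.2]
    obtain ⟨y₀, -, φ, hφ, hlim⟩ := isCompact_Icc.tendsto_subseq hbdd
    refine ⟨y₀, hKc.mem_of_tendsto hlim (Eventually.of_forall fun j => hyK _), ?_⟩
    refine tendsto_nhds_unique ((h.continuous.tendsto y₀).comp hlim) ?_
    have h0 : Tendsto (fun j => D (y j)) atTop (𝓝 t) :=
      tendsto_iff_dist_tendsto_zero.2 (squeeze_zero (fun _ => dist_nonneg) hy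
        tendsto_one_div_add_atTop_nhds_zero_nat)
    exact h0.comp hφ.tendsto_atTop
  -- The derivative of `D` is `g₂ - g₁`, which vanishes on `K`; this is the easy case of Sard's
  -- theorem.
  have hnull : MeasureTheory.volume (D '' K) = 0 := by
    refine MeasureTheory.addHaar_image_eq_zero_of_det_fderivWithin_eq_zero MeasureTheory.volume
      (f' := fun _ => 0) (fun y hy => ?_) (fun y _ => by simp)
    have := h.deriv y
    rw [show g₂ y - g₁ y = 0 from sub_eq_zero.2 (Eq.symm hy)] at this
    have h2 := this.hasFDerivAt.hasFDerivWithinAt (s := K)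
    simpa using h2
  rw [himage, Real.volume_univ] at hnull
  exact ENNReal.top_ne_zero hnull

lemma eq_of_kappa_zero (h : IsComparison f₁ f₂ g₁ g₂ ω D κ) (hκ : κ = 0) (x : ℝ) :
    g₁ x = g₂ x := by
  have hconst : ∀ y, D y = D 0 := fun y => by
    have := abs_sub_mul_le_of_monotone h.mono h.add_one y
    rw [hκ, zero_mul, sub_zero] at this
    linarith [abs_nonpos_iff.1 this]
  have h1 := h.deriv x
  have h2 : D = fun _ => D 0 := funext hconst
  rw [h2] at h1
  linarith [h1.unique (hasDerivAt_const x (D 0))]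

end IsComparison

end TwistMap

namespace TwistMap

/-! ### Foliations by limits of periodic graphs -/

/-- An invariant graph all of whose points are periodic with rotation number `ρ`. -/
structure IsPeriodicGraph (H : ℝ → ℝ → ℝ) (g : ℝ → ℝ) (ρ : ℚ) : Prop where
  inv : IsInvGraph H g
  per : ∀ x, (graphMap H g)^[ρ.den] x = x + ρ.num

lemma IsPeriodicGraph.hasRot {H : ℝ → ℝ → ℝ} (hH : IsTwistGenerating H) {g : ℝ → ℝ} {ρ : ℚ}
    (h : IsPeriodicGraph H g ρ) : HasRot (graphMap H g) ρ := by
  rw [Rat.cast_def]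
  exact (h.inv.isCircleLift hH).hasRot_of_iterate_eq ρ.den_pos h.per

/-- If the graph with the larger rotation number were at or below the other one at some abscissa,
its orbit from there would never overtake the other orbit, reversing the order of the rotation
numbers. -/
lemma IsInvGraph.lt_of_rot_lt {H : ℝ → ℝ → ℝ} (hH : IsTwistGenerating H) {g g' : ℝ → ℝ}
    (hg : IsInvGraph H g) (hg' : IsInvGraph H g') {ω ω' : ℝ} (hr : HasRot (graphMap H g) ω)
    (hr' : HasRot (graphMap H g') ω') (h : ω < ω') (x : ℝ) : g x < g' x := by
  by_contra hcon
  refine absurd (hr'.unique_le hr (y := x) fun n => ?_) (not_le.2 h)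
  have e' := hg'.iterate_eq n x
  rcases (not_lt.1 hcon).eq_or_lt with heq | hlt
  · have e := hg.iterate_eq n x
    rw [← heq] at e
    exact (congrArg Prod.fst (e'.symm.trans e)).le
  · have := (hg.iterate_lt hH (z := (x, g' x)) hlt n).1
    rwa [e'] at this

lemma IsInvGraph.of_tendsto {H : ℝ → ℝ → ℝ} (hH : IsTwistGenerating H) {ι : Type*} {l : Filter ι}
    [l.NeBot] {G : ι → ℝ → ℝ} {g : ℝ → ℝ} (hG : ∀ i, IsInvGraph H (G i))
    (hlim : ∀ x, Tendsto (fun i => G i x) l (𝓝 (g x))) : IsInvGraph H g := by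
  obtain ⟨M, hM, hlip⟩ := hH.exists_lipschitz_graph
  refine ⟨?_, fun x => ?_, fun x => ?_⟩
  · have : LipschitzWith M.toNNReal g := LipschitzWith.of_dist_le_mul fun x y => by
      rw [Real.dist_eq, Real.dist_eq, Real.coe_toNNReal _ hM.le]
      exact le_of_tendsto ((hlim x).sub (hlim y)).abs
        (Eventually.of_forall fun i => hlip _ (hG i) x y)
    exact this.continuous
  · refine tendsto_nhds_unique (hlim (x + 1)) ?_
    simpa only [(hG _).per] using hlim x
  · have h1 : Tendsto (fun i => map H (x, G i x)) l (𝓝 (map H (x, g x))) :=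
      (hH.continuous_map.tendsto _).comp (tendsto_const_nhds.prodMk_nhds (hlim x))
    have h2 := (continuous_fst.tendsto _).comp h1
    have h3 := (continuous_snd.tendsto _).comp h1
    refine tendsto_nhds_unique h3 ?_
    -- The common Lipschitz constant allows the moving argument of `G i` to be replaced by its
    -- limit, so pointwise convergence suffices.
    have h4 : Tendsto (fun i => G i (map H (x, G i x)).1 - G i (map H (x, g x)).1) l (𝓝 0) := by
      refine squeeze_zero_norm (fun i => hlip _ (hG i) _ _) ?_
      have := ((h2.sub_const (map H (x, g x)).1).abs).const_mul M
      simpa using this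
    have h5 := h4.add (hlim (map H (x, g x)).1)
    simp only [sub_add_cancel, zero_add] at h5
    refine h5.congr fun i => ?_
    exact ((hG i).inv x).symm

/-- The rational numbers of `[ρ₁, ρ₂]` below `ω`. -/
def RatBelow (ρ₁ ρ₂ : ℚ) (ω : ℝ) : Type :=
  {ρ : ℚ // (ρ₁ ≤ ρ ∧ ρ ≤ ρ₂) ∧ (ρ = ρ₁ ∨ (ρ : ℝ) < ω)}

/-- The rational numbers of `[ρ₁, ρ₂]` above `ω`. -/
def RatAbove (ρ₁ ρ₂ : ℚ) (ω : ℝ) : Type :=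
  {ρ : ℚ // (ρ₁ ≤ ρ ∧ ρ ≤ ρ₂) ∧ (ρ = ρ₂ ∨ ω < (ρ : ℝ))}

noncomputable instance (ρ₁ ρ₂ : ℚ) (ω : ℝ) : LinearOrder (RatBelow ρ₁ ρ₂ ω) :=
  inferInstanceAs (LinearOrder {ρ : ℚ // (ρ₁ ≤ ρ ∧ ρ ≤ ρ₂) ∧ (ρ = ρ₁ ∨ (ρ : ℝ) < ω)})

noncomputable instance (ρ₁ ρ₂ : ℚ) (ω : ℝ) : LinearOrder (RatAbove ρ₁ ρ₂ ω) :=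
  inferInstanceAs (LinearOrder {ρ : ℚ // (ρ₁ ≤ ρ ∧ ρ ≤ ρ₂) ∧ (ρ = ρ₂ ∨ ω < (ρ : ℝ))})

lemma ratBelow_le_ratAbove {ρ₁ ρ₂ : ℚ} {ω : ℝ} (a : RatBelow ρ₁ ρ₂ ω) (b : RatAbove ρ₁ ρ₂ ω) :
    a.1 ≤ b.1 := by
  obtain ⟨a, ⟨ha1, ha2⟩, ha⟩ := a
  obtain ⟨b, ⟨hb1, hb2⟩, hb⟩ := b
  rcases ha with rfl | ha
  · exact hb1
  · rcases hb with rfl | hb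
    · exact ha2
    · exact_mod_cast (ha.trans hb).le

/-- The supremum of the graphs with rotation number below `ω`. -/
noncomputable def lowerGraph (γ : ℚ → ℝ → ℝ) (ρ₁ ρ₂ : ℚ) (ω : ℝ) (x : ℝ) : ℝ :=
  ⨆ ρ : RatBelow ρ₁ ρ₂ ω, γ ρ.1 x

/-- The infimum of the graphs with rotation number above `ω`. -/
noncomputable def upperGraph (γ : ℚ → ℝ → ℝ) (ρ₁ ρ₂ : ℚ) (ω : ℝ) (x : ℝ) : ℝ :=
  ⨅ ρ : RatAbove ρ₁ ρ₂ ω, γ ρ.1 x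

section Foliation

variable {H : ℝ → ℝ → ℝ} (hH : IsTwistGenerating H) {ρ₁ ρ₂ : ℚ} (hρ : ρ₁ ≤ ρ₂) {γ : ℚ → ℝ → ℝ}
  (hγ : ∀ ρ, ρ₁ ≤ ρ ∧ ρ ≤ ρ₂ → IsPeriodicGraph H (γ ρ) ρ)

include hH hγ in
lemma periodicGraph_mono {ρ ρ' : ℚ} (h : ρ₁ ≤ ρ ∧ ρ ≤ ρ₂) (h' : ρ₁ ≤ ρ' ∧ ρ' ≤ ρ₂) (hle : ρ ≤ ρ')
    (x : ℝ) : γ ρ x ≤ γ ρ' x := by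
  rcases hle.eq_or_lt with rfl | hlt
  · exact le_rfl
  · exact ((hγ ρ h).inv.lt_of_rot_lt hH (hγ ρ' h').inv ((hγ ρ h).hasRot hH) ((hγ ρ' h').hasRot hH)
      (by exact_mod_cast hlt) x).le

include hH hγ in
lemma le_lowerGraph {ω : ℝ} (a : RatBelow ρ₁ ρ₂ ω) (x : ℝ) : γ a.1 x ≤ lowerGraph γ ρ₁ ρ₂ ω x :=
  le_ciSup (f := fun ρ : RatBelow ρ₁ ρ₂ ω => γ ρ.1 x) ⟨γ ρ₂ x, by
    rintro _ ⟨b, rfl⟩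
    exact periodicGraph_mono hH hγ b.2.1 ⟨b.2.1.1.trans b.2.1.2, le_rfl⟩ b.2.1.2 x⟩ a

include hH hγ in
lemma upperGraph_le {ω : ℝ} (a : RatAbove ρ₁ ρ₂ ω) (x : ℝ) : upperGraph γ ρ₁ ρ₂ ω x ≤ γ a.1 x :=
  ciInf_le (f := fun ρ : RatAbove ρ₁ ρ₂ ω => γ ρ.1 x) ⟨γ ρ₁ x, by
    rintro _ ⟨b, rfl⟩
    exact periodicGraph_mono hH hγ ⟨le_rfl, b.2.1.1.trans b.2.1.2⟩ b.2.1 b.2.1.1 x⟩ a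

include hρ in
-- The endpoint is admitted unconditionally in `RatBelow` so that the supremum remains meaningful at
-- `ω = ρ₁`, where no rational number of the interval lies strictly below.
lemma nonempty_ratBelow (ω : ℝ) : Nonempty (RatBelow ρ₁ ρ₂ ω) := ⟨⟨ρ₁, ⟨le_rfl, hρ⟩, Or.inl rfl⟩⟩

include hρ in
lemma nonempty_ratAbove (ω : ℝ) : Nonempty (RatAbove ρ₁ ρ₂ ω) := ⟨⟨ρ₂, ⟨hρ, le_rfl⟩, Or.inl rfl⟩⟩

include hH hρ hγ in
lemma isInvGraph_lowerGraph (ω : ℝ) : IsInvGraph H (lowerGraph γ ρ₁ ρ₂ ω) := by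
  have := nonempty_ratBelow hρ ω
  refine IsInvGraph.of_tendsto hH (l := atTop) (G := fun a : RatBelow ρ₁ ρ₂ ω => γ a.1)
    (fun a => (hγ a.1 a.2.1).inv) fun x => ?_
  refine tendsto_atTop_ciSup (fun a b hab => periodicGraph_mono hH hγ a.2.1 b.2.1 hab x)
    ⟨lowerGraph γ ρ₁ ρ₂ ω x, ?_⟩
  rintro _ ⟨b, rfl⟩
  exact le_lowerGraph hH hγ b x

include hH hρ hγ in
lemma isInvGraph_upperGraph (ω : ℝ) : IsInvGraph H (upperGraph γ ρ₁ ρ₂ ω) := by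
  have := nonempty_ratAbove hρ ω
  refine IsInvGraph.of_tendsto hH (l := atBot) (G := fun a : RatAbove ρ₁ ρ₂ ω => γ a.1)
    (fun a => (hγ a.1 a.2.1).inv) fun x => ?_
  refine tendsto_atBot_ciInf (fun a b hab => periodicGraph_mono hH hγ a.2.1 b.2.1 hab x)
    ⟨upperGraph γ ρ₁ ρ₂ ω x, ?_⟩
  rintro _ ⟨b, rfl⟩
  exact upperGraph_le hH hγ b x

include hH hρ hγ in
/-- An invariant graph enclosed by the periodic ones has the expected rotation number. -/
lemma hasRot_of_enclosed {ω : ℝ} (hω : ω ∈ Icc (ρ₁ : ℝ) ρ₂) {g : ℝ → ℝ} (hg : IsInvGraph H g)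
    (hl : ∀ (a : RatBelow ρ₁ ρ₂ ω) x, γ a.1 x ≤ g x)
    (hu : ∀ (a : RatAbove ρ₁ ρ₂ ω) x, g x ≤ γ a.1 x) : HasRot (graphMap H g) ω := by
  refine (hg.isCircleLift hH).hasRot_of_between (fun n m hnm => ?_) (fun n m hnm => ?_)
  · obtain ⟨a, ha⟩ : ∃ a : RatBelow ρ₁ ρ₂ ω, (m : ℝ) < n * (a.1 : ℝ) := by
      -- Either the endpoint already witnesses the inequality, which covers `n = 0`, or `m / n` lies
      -- in `[ρ₁, ω)` and a rational number strictly between `m / n` and `ω` works.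
      by_cases h : (m : ℝ) < n * (ρ₁ : ℝ)
      · exact ⟨⟨ρ₁, ⟨le_rfl, hρ⟩, Or.inl rfl⟩, h⟩
      · have hn : (0 : ℝ) < n := by
          rcases Nat.eq_zero_or_pos n with rfl | hn
          · simp at hnm h; linarith
          · exact_mod_cast hn
        obtain ⟨s, hs1, hs2⟩ := exists_rat_btwn (show (m : ℝ) / n < ω by
          rw [div_lt_iff₀ hn]; linarith)
        have h1 : (ρ₁ : ℝ) ≤ m / n := by rw [le_div_iff₀ hn]; linarith
        refine ⟨⟨s, ⟨?_, ?_⟩, Or.inr hs2⟩, ?_⟩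
        · exact_mod_cast (h1.trans_lt hs1).le
        · exact_mod_cast (hs2.trans_le hω.2).le
        · rw [div_lt_iff₀ hn] at hs1; linarith
    exact ⟨_, _, ((hγ a.1 a.2.1).inv.isCircleLift hH).mono.monotone, (hγ a.1 a.2.1).hasRot hH,
      fun x => graphMap_le hH (hl a x), ha⟩
  · obtain ⟨a, ha⟩ : ∃ a : RatAbove ρ₁ ρ₂ ω, n * (a.1 : ℝ) < (m : ℝ) := by
      by_cases h : n * (ρ₂ : ℝ) < (m : ℝ)
      · exact ⟨⟨ρ₂, ⟨hρ, le_rfl⟩, Or.inl rfl⟩, h⟩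
      · have hn : (0 : ℝ) < n := by
          rcases Nat.eq_zero_or_pos n with rfl | hn
          · simp at hnm h; linarith
          · exact_mod_cast hn
        obtain ⟨s, hs1, hs2⟩ := exists_rat_btwn (show ω < (m : ℝ) / n by
          rw [lt_div_iff₀ hn]; linarith)
        have h1 : (m : ℝ) / n ≤ ρ₂ := by rw [div_le_iff₀ hn]; linarith
        refine ⟨⟨s, ⟨?_, ?_⟩, Or.inr hs1⟩, ?_⟩
        · exact_mod_cast (hω.1.trans_lt hs1).le
        · exact_mod_cast (hs2.trans_le h1).le
        · rw [lt_div_iff₀ hn] at hs2; linarith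
    exact ⟨_, _, (hγ a.1 a.2.1).hasRot hH, fun x => graphMap_le hH (hu a x), ha⟩

include hH hρ hγ in
lemma lowerGraph_le_upperGraph (ω x : ℝ) :
    lowerGraph γ ρ₁ ρ₂ ω x ≤ upperGraph γ ρ₁ ρ₂ ω x := by
  have := nonempty_ratBelow hρ ω
  have := nonempty_ratAbove hρ ω
  exact ciSup_le fun a => le_ciInf fun b =>
    periodicGraph_mono hH hγ a.2.1 b.2.1 (ratBelow_le_ratAbove a b) x

include hH hρ hγ in
lemma hasRot_lowerGraph {ω : ℝ} (hω : ω ∈ Icc (ρ₁ : ℝ) ρ₂) :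
    HasRot (graphMap H (lowerGraph γ ρ₁ ρ₂ ω)) ω :=
  hasRot_of_enclosed hH hρ hγ hω (isInvGraph_lowerGraph hH hρ hγ ω) (le_lowerGraph hH hγ)
    fun a x => (lowerGraph_le_upperGraph hH hρ hγ ω x).trans (upperGraph_le hH hγ a x)

include hH hρ hγ in
lemma hasRot_upperGraph {ω : ℝ} (hω : ω ∈ Icc (ρ₁ : ℝ) ρ₂) :
    HasRot (graphMap H (upperGraph γ ρ₁ ρ₂ ω)) ω :=
  hasRot_of_enclosed hH hρ hγ hω (isInvGraph_upperGraph hH hρ hγ ω)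
    (fun a x => (le_lowerGraph hH hγ a x).trans (lowerGraph_le_upperGraph hH hρ hγ ω x))
    (upperGraph_le hH hγ)

include hH hρ hγ in
/-- There is no gap between the graphs from below and from above. -/
lemma lowerGraph_eq_upperGraph {ω : ℝ} (hω : ω ∈ Icc (ρ₁ : ℝ) ρ₂) (x : ℝ) :
    lowerGraph γ ρ₁ ρ₂ ω x = upperGraph γ ρ₁ ρ₂ ω x := by
  have hl := isInvGraph_lowerGraph hH hρ hγ ω
  have hu := isInvGraph_upperGraph hH hρ hγ ω
  have hrl := hasRot_lowerGraph hH hρ hγ hω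
  have hru := hasRot_upperGraph hH hρ hγ hω
  by_cases hirr : Irrational ω
  · obtain ⟨D, κ, hc⟩ := exists_comparison hH hl hu (lowerGraph_le_upperGraph hH hρ hγ ω) hrl hru
    exact hc.eq_of_kappa_zero (hc.kappa_eq_zero_of_irrational (hl.isCircleLift hH) hrl hirr
      hl.cont hu.cont hl.per hu.per) x
  · obtain ⟨s, rfl⟩ : ∃ s : ℚ, (s : ℝ) = ω := by simpa [Irrational] using hirr
    have hs : ρ₁ ≤ s ∧ s ≤ ρ₂ := ⟨by exact_mod_cast hω.1, by exact_mod_cast hω.2⟩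
    have hγs := hγ s hs
    have := nonempty_ratBelow hρ (s : ℝ)
    have := nonempty_ratAbove hρ (s : ℝ)
    -- At a rational number the periodic graph lies between the two limits. It is the upper graph of
    -- one comparison and the lower graph of the other, and its periodicity closes both gaps.
    have h1 : ∀ x, lowerGraph γ ρ₁ ρ₂ s x ≤ γ s x := fun x => ciSup_le fun a =>
      periodicGraph_mono hH hγ a.2.1 hs (by
        rcases a.2.2 with h | h
        · rw [h]; exact hs.1
        · exact_mod_cast h.le) x
    have h2 : ∀ x, γ s x ≤ upperGraph γ ρ₁ ρ₂ s x := fun x => le_ciInf fun a =>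
      periodicGraph_mono hH hγ hs a.2.1 (by
        rcases a.2.2 with h | h
        · rw [h]; exact hs.2
        · exact_mod_cast h.le) x
    obtain ⟨D, κ, hc⟩ := exists_comparison hH hl hγs.inv h1 hrl (hγs.hasRot hH)
    obtain ⟨D', κ', hc'⟩ := exists_comparison hH hγs.inv hu h2 (hγs.hasRot hH) hru
    exact (hc.eq_of_periodic_upper s.den_pos (Rat.cast_def s) hγs.per x).trans
      (hc'.eq_of_periodic_lower s.den_pos (Rat.cast_def s) hγs.per x)

include hH hρ hγ in
/-- A region swept by periodic graphs of all rational rotation numbers is foliated. -/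
theorem exists_foliation : ∃ L : Set (ℝ → ℝ), (∀ g ∈ L, IsInvGraph H g) ∧
    (∀ g ∈ L, ∀ g' ∈ L, ∀ x, g x = g' x → g = g') ∧
    (∀ g ∈ L, ∀ x, γ ρ₁ x ≤ g x ∧ g x ≤ γ ρ₂ x) ∧
    ∀ x r, γ ρ₁ x ≤ r → r ≤ γ ρ₂ x → ∃ g ∈ L, g x = r := by
  have h11 : ρ₁ ≤ ρ₁ ∧ ρ₁ ≤ ρ₂ := ⟨le_rfl, hρ⟩
  have h22 : ρ₁ ≤ ρ₂ ∧ ρ₂ ≤ ρ₂ := ⟨hρ, le_rfl⟩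
  refine ⟨lowerGraph γ ρ₁ ρ₂ '' Icc (ρ₁ : ℝ) ρ₂, ?_, ?_, ?_, ?_⟩
  · rintro _ ⟨ω, -, rfl⟩
    exact isInvGraph_lowerGraph hH hρ hγ ω
  · rintro _ ⟨ω, hω, rfl⟩ _ ⟨ω', hω', rfl⟩ x hx
    have hi := isInvGraph_lowerGraph hH hρ hγ
    rcases lt_trichotomy ω ω' with h | rfl | h
    · exact absurd hx ((hi ω).lt_of_rot_lt hH (hi ω') (hasRot_lowerGraph hH hρ hγ hω)
        (hasRot_lowerGraph hH hρ hγ hω') h x).ne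
    · rfl
    · exact absurd hx ((hi ω').lt_of_rot_lt hH (hi ω) (hasRot_lowerGraph hH hρ hγ hω')
        (hasRot_lowerGraph hH hρ hγ hω) h x).ne'
  · rintro _ ⟨ω, hω, rfl⟩ x
    have := nonempty_ratBelow hρ ω
    exact ⟨le_lowerGraph hH hγ ⟨ρ₁, h11, Or.inl rfl⟩ x, ciSup_le fun a =>
      periodicGraph_mono hH hγ a.2.1 h22 a.2.1.2 x⟩
  · intro x r h1 h2
    -- The leaf through `(x, r)` has as rotation number the supremum of the rational numbers whose
    -- graph is at or below `r` over `x`: graphs below it are at or below `r`, graphs above it are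
    -- above `r` or the top one, and the two limits coincide.
    set S : Set ℝ := {t | ∃ ρ : ℚ, (ρ₁ ≤ ρ ∧ ρ ≤ ρ₂) ∧ γ ρ x ≤ r ∧ t = ρ} with hS
    have hmem : (ρ₁ : ℝ) ∈ S := ⟨ρ₁, h11, h1, rfl⟩
    have hub : ∀ t ∈ S, t ≤ (ρ₂ : ℝ) := by
      rintro _ ⟨ρ, h, -, rfl⟩
      exact_mod_cast h.2
    have hbdd : BddAbove S := ⟨ρ₂, hub⟩
    have hω : sSup S ∈ Icc (ρ₁ : ℝ) ρ₂ := ⟨le_csSup hbdd hmem, csSup_le ⟨_, hmem⟩ hub⟩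
    have := nonempty_ratBelow hρ (sSup S)
    have := nonempty_ratAbove hρ (sSup S)
    refine ⟨_, ⟨sSup S, hω, rfl⟩, le_antisymm (ciSup_le fun a => ?_) ?_⟩
    · rcases a.2.2 with h | h
      · rw [h]; exact h1
      · obtain ⟨_, ⟨ρ, hρ', hr, rfl⟩, hlt⟩ := exists_lt_of_lt_csSup ⟨_, hmem⟩ h
        exact (periodicGraph_mono hH hγ a.2.1 hρ' (by exact_mod_cast hlt.le) x).trans hr
    · rw [lowerGraph_eq_upperGraph hH hρ hγ hω]
      refine le_ciInf fun b => ?_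
      rcases b.2.2 with h | h
      · rw [h]; exact h2
      · by_contra hcon
        exact absurd (le_csSup hbdd ⟨b.1, b.2.1, (not_le.1 hcon).le, rfl⟩) (not_le.2 h)

end Foliation

end TwistMap

namespace TwistMap

/-! ### Absence of conjugate points on invariant graphs -/

lemma hasDerivAt_comp₂ {K : ℝ → ℝ → ℝ} (hK : ContDiff ℝ 1 (fun p : ℝ × ℝ => K p.1 p.2))
    {u v : ℝ → ℝ} {u' v' t : ℝ} (hu : HasDerivAt u u' t) (hv : HasDerivAt v v' t) :
    HasDerivAt (fun t => K (u t) (v t))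
      (pd₁ K (u t) (v t) * u' + pd₂ K (u t) (v t) * v') t := by
  have := (hasFDerivAt_of_contDiff hK (u t) (v t)).comp_hasDerivAt t (hu.prodMk hv)
  exact this.congr_deriv (by simp)

lemma IsTwistGenerating.differentiable_iterate_fst {H : ℝ → ℝ → ℝ} (hH : IsTwistGenerating H)
    (n : ℕ) : Differentiable ℝ (fun z => ((map H)^[n] z).1) :=
  (hH.differentiable_iterate n).fst

lemma IsTwistGenerating.differentiable_iterate_fst_snd {H : ℝ → ℝ → ℝ} (hH : IsTwistGenerating H)
    (n : ℕ) (x : ℝ) : Differentiable ℝ (fun r => ((map H)^[n] (x, r)).1) :=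
  (hH.differentiable_iterate_fst n).comp ((differentiable_const x).prodMk differentiable_id)

/-- The discrete Euler–Lagrange equation. -/
lemma IsTwistGenerating.euler_lagrange {H : ℝ → ℝ → ℝ} (hH : IsTwistGenerating H) (z : ℝ × ℝ) :
    pd₂ H z.1 (map H z).1 + pd₁ H (map H z).1 (map H (map H z)).1 = 0 := by
  rw [← (hH.map_spec z).2, (hH.map_spec (map H z)).1]
  ring

/-- Points above the graph stay ahead of the graph dynamics, so the difference quotients from the
right are nonnegative. -/
lemma IsInvGraph.deriv_iterate_nonneg {H : ℝ → ℝ → ℝ} (hH : IsTwistGenerating H) {g : ℝ → ℝ}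
    (hg : IsInvGraph H g) (n : ℕ) (x : ℝ) :
    0 ≤ deriv (fun r => ((map H)^[n] (x, r)).1) (g x) := by
  have h1 := ((hH.differentiable_iterate_fst_snd n x (g x)).hasDerivAt).hasDerivWithinAt
    (s := Ioi (g x))
  rw [hasDerivWithinAt_iff_tendsto_slope' (by simp)] at h1
  refine ge_of_tendsto h1 ?_
  filter_upwards [self_mem_nhdsWithin] with r hr
  rw [slope_def_field]
  have h2 := (hg.iterate_gt hH (z := (x, r)) hr n).1
  have h3 := congrArg Prod.fst (hg.iterate_eq n x)
  simp only at h2 h3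
  rw [h3]
  exact div_nonneg (sub_nonneg.2 h2) (sub_nonneg.2 (mem_Ioi.1 hr).le)

/-- Jacobi fields starting from the vertical are positive along an invariant graph. -/
lemma IsInvGraph.deriv_iterate_pos {H : ℝ → ℝ → ℝ} (hH : IsTwistGenerating H) {g : ℝ → ℝ}
    (hg : IsInvGraph H g) (n : ℕ) (x : ℝ) :
    0 < deriv (fun r => ((map H)^[n + 1] (x, r)).1) (g x) := by
  obtain ⟨c, hc, ht⟩ := hH.twist
  have hd : ∀ n, HasDerivAt (fun r => ((map H)^[n] (x, r)).1)
      (deriv (fun r => ((map H)^[n] (x, r)).1) (g x)) (g x) := fun n =>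
    (hH.differentiable_iterate_fst_snd n x (g x)).hasDerivAt
  have hnn : ∀ n, 0 ≤ deriv (fun r => ((map H)^[n] (x, r)).1) (g x) := fun n =>
    hg.deriv_iterate_nonneg hH n x
  set ξ : ℕ → ℝ := fun n => deriv (fun r => ((map H)^[n] (x, r)).1) (g x) with hξ
  induction n with
  | zero =>
    -- Differentiating `r = -∂₁H(x, x')` with respect to `r` gives `-∂₁₂H * ξ 1 = 1`.
    have h1 := (hasDerivAt_comp₂ hH.contDiff_pd₁ (hasDerivAt_const (g x) x) (hd 1)).neg
    have h2 : (-fun r => pd₁ H x ((map H)^[1] (x, r)).1) = fun r => r :=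
      funext fun r => ((hH.map_spec (x, r)).1).symm
    rw [h2] at h1
    have h3 := h1.unique (hasDerivAt_id' _)
    have h4 : ξ 1 ≠ 0 := fun h0 => by
      change -(_ * 0 + _ * ξ 1) = 1 at h3
      rw [h0] at h3
      norm_num at h3
    exact lt_of_le_of_ne (hnn 1) h4.symm
  | succ n ih =>
    refine lt_of_le_of_ne (hnn (n + 2)) fun h0 => ?_
    -- This is the Jacobi equation. If `ξ (n + 2)` vanished, only the two mixed terms would remain;
    -- both coefficients are negative, while `ξ (n + 1) > 0` and `ξ (n + 3) ≥ 0`, so their sum could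
    -- not be zero.
    have h1 := (hasDerivAt_comp₂ hH.contDiff_pd₂ (hd (n + 1)) (hd (n + 2))).add
      (hasDerivAt_comp₂ hH.contDiff_pd₁ (hd (n + 2)) (hd (n + 3)))
    have h2 : ((fun r => pd₂ H ((map H)^[n + 1] (x, r)).1 ((map H)^[n + 2] (x, r)).1) +
        fun r => pd₁ H ((map H)^[n + 2] (x, r)).1 ((map H)^[n + 3] (x, r)).1) = fun _ => 0 := by
      funext r
      have := hH.euler_lagrange ((map H)^[n + 1] (x, r))
      rwa [← Function.iterate_succ_apply' (map H) (n + 1),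
        ← Function.iterate_succ_apply' (map H) (n + 2)] at this
    rw [h2] at h1
    have h3 := h1.unique (hasDerivAt_const _ _)
    rw [← h0, pd_comm hH] at h3
    have a1 := mul_pos_of_neg_of_neg
      ((ht ((map H)^[n + 1] (x, g x)).1 ((map H)^[n + 2] (x, g x)).1).trans (neg_lt_zero.2 hc))
      (neg_lt_zero.2 ih)
    have a2 := mul_nonneg_of_nonpos_of_nonpos
      ((ht ((map H)^[n + 2] (x, g x)).1 ((map H)^[n + 3] (x, g x)).1).trans (neg_lt_zero.2 hc)).le
      (neg_nonpos.2 (hnn (n + 3)))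
    change _ < _ * -ξ (n + 1) at a1
    change _ ≤ _ * -ξ (n + 3) at a2
    change _ * ξ (n + 1) + _ * 0 + (_ * 0 + _ * ξ (n + 3)) = 0 at h3
    linarith

/-! ### The action -/

/-- The action of the first `n` steps of the orbit of `z`. -/
noncomputable def action (H : ℝ → ℝ → ℝ) (n : ℕ) (z : ℝ × ℝ) : ℝ :=
  ∑ i ∈ Finset.range n, H ((map H)^[i] z).1 ((map H)^[i + 1] z).1

lemma action_add (H : ℝ → ℝ → ℝ) (n m : ℕ) (z : ℝ × ℝ) :
    action H (n + m) z = action H n z + action H m ((map H)^[n] z) := by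
  rw [action, Finset.sum_range_add]
  congr 1
  refine Finset.sum_congr rfl fun i _ => ?_
  rw [← Function.iterate_add_apply, ← Function.iterate_add_apply, add_comm n i,
    show i + 1 + n = i + n + 1 by omega]

lemma action_add_int {H : ℝ → ℝ → ℝ} (hH : IsTwistGenerating H) (n : ℕ) (x r : ℝ) (k : ℤ) :
    action H n (x + k, r) = action H n (x, r) := by
  refine Finset.sum_congr rfl fun i _ => ?_
  rw [hH.iterate_add_int, hH.iterate_add_int, hH.add_int]

/-- The map is exact symplectic. -/
lemma hasFDerivAt_action {H : ℝ → ℝ → ℝ} (hH : IsTwistGenerating H) (n : ℕ) (z : ℝ × ℝ) :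
    HasFDerivAt (action H n)
      (((map H)^[n] z).2 • fderiv ℝ (fun z => ((map H)^[n] z).1) z -
        z.2 • ContinuousLinearMap.fst ℝ ℝ ℝ) z := by
  have hd : ∀ n, HasFDerivAt (fun z => ((map H)^[n] z).1)
      (fderiv ℝ (fun z => ((map H)^[n] z).1) z) z := fun n =>
    (hH.differentiable_iterate_fst n z).hasFDerivAt
  induction n with
  | zero =>
    have h0 : fderiv ℝ (fun z : ℝ × ℝ => ((map H)^[0] z).1) z = ContinuousLinearMap.fst ℝ ℝ ℝ :=
      hasFDerivAt_fst.fderiv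
    rw [h0]
    have : action H 0 = fun _ => 0 := funext fun z => by simp [action]
    rw [this]
    refine (hasFDerivAt_const _ _).congr_fderiv ?_
    simp
  | succ n ih =>
    have e : action H (n + 1) =
        fun z => action H n z + H ((map H)^[n] z).1 ((map H)^[n + 1] z).1 :=
      funext fun z => by rw [action, Finset.sum_range_succ]; rfl
    rw [e]
    have hH1 : ContDiff ℝ 1 (fun p : ℝ × ℝ => H p.1 p.2) := hH.contDiff.of_le (by norm_num)
    have h2 := HasFDerivAt.comp z (f := fun z => (((map H)^[n] z).1, ((map H)^[n + 1] z).1))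
      (hasFDerivAt_of_contDiff hH1 ((map H)^[n] z).1 ((map H)^[n + 1] z).1)
      ((hd n).prodMk (hd (n + 1)))
    refine (ih.add h2).congr_fderiv ?_
    have h3 := hH.map_spec ((map H)^[n] z)
    rw [← Function.iterate_succ_apply' (map H)] at h3
    ext <;> simp [-Function.iterate_succ, h3.1, h3.2]
    ring

end TwistMap

namespace TwistMap

/-! ### Regions without conjugate points -/

/-- Two ordered invariant graphs enclosing a region without conjugate points. -/
structure IsDisconjugate (H : ℝ → ℝ → ℝ) (g₁ g₂ : ℝ → ℝ) : Prop where
  inv₁ : IsInvGraph H g₁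
  inv₂ : IsInvGraph H g₂
  lt : ∀ x, g₁ x < g₂ x
  deriv_ne : ∀ (n : ℕ) (x r : ℝ), 0 < n → g₁ x ≤ r → r ≤ g₂ x →
    deriv (fun r => ((map H)^[n] (x, r)).1) r ≠ 0

/-- The vertical coordinate at `x`, between the two graphs, of the orbit segment of length `n` from
`x` to `x'`. -/
noncomputable def connect (H : ℝ → ℝ → ℝ) (g₁ g₂ : ℝ → ℝ) (n : ℕ) (w : ℝ × ℝ) : ℝ :=
  Function.invFunOn (fun r => ((map H)^[n] (w.1, r)).1) (Icc (g₁ w.1) (g₂ w.1)) w.2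

/-- The pairs of points which are connected by an orbit segment of length `n` in the interior of
the region. -/
def connectDomain (H : ℝ → ℝ → ℝ) (g₁ g₂ : ℝ → ℝ) (n : ℕ) : Set (ℝ × ℝ) :=
  {w | (graphMap H g₁)^[n] w.1 < w.2 ∧ w.2 < (graphMap H g₂)^[n] w.1}

/-- The action of the orbit segment of length `n` connecting two points. -/
noncomputable def connectAction (H : ℝ → ℝ → ℝ) (g₁ g₂ : ℝ → ℝ) (n : ℕ) (w : ℝ × ℝ) : ℝ :=
  action H n (w.1, connect H g₁ g₂ n w)

namespace IsDisconjugate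

variable {H : ℝ → ℝ → ℝ} {g₁ g₂ : ℝ → ℝ}

/-- By Darboux a nowhere vanishing derivative has constant sign on the vertical segment, and on the
lower boundary graph the sign is positive. No continuity of the derivative is needed. -/
lemma deriv_pos (h : IsDisconjugate H g₁ g₂) (hH : IsTwistGenerating H) {n : ℕ} (hn : 0 < n)
    {x r : ℝ} (h1 : g₁ x ≤ r) (h2 : r ≤ g₂ x) :
    0 < deriv (fun r => ((map H)^[n] (x, r)).1) r := by
  have hd := hH.differentiable_iterate_fst_snd n x
  rcases hasDerivWithinAt_forall_lt_or_forall_gt_of_forall_ne (convex_Icc (g₁ x) (g₂ x))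
    (fun s _ => (hd s).hasDerivAt.hasDerivWithinAt)
    (fun s hs => h.deriv_ne n x s hn hs.1 hs.2) with h3 | h3
  · obtain ⟨k, rfl⟩ : ∃ k, n = k + 1 := ⟨n - 1, by omega⟩
    have := h3 (g₁ x) ⟨le_rfl, (h.lt x).le⟩
    exact absurd (h.inv₁.deriv_iterate_pos hH k x) this.not_gt
  · exact h3 r ⟨h1, h2⟩

lemma strictMonoOn (h : IsDisconjugate H g₁ g₂) (hH : IsTwistGenerating H) {n : ℕ} (hn : 0 < n)
    (x : ℝ) : StrictMonoOn (fun r => ((map H)^[n] (x, r)).1) (Icc (g₁ x) (g₂ x)) := by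
  refine strictMonoOn_of_deriv_pos (convex_Icc _ _)
    (hH.differentiable_iterate_fst_snd n x).continuous.continuousOn fun r hr => ?_
  rw [interior_Icc] at hr
  exact h.deriv_pos hH hn hr.1.le hr.2.le

lemma isOpen_connectDomain (h : IsDisconjugate H g₁ g₂) (hH : IsTwistGenerating H) (n : ℕ) :
    IsOpen (connectDomain H g₁ g₂ n) := by
  have c1 := ((h.inv₁.isCircleLift hH).iterate n).cont
  have c2 := ((h.inv₂.isCircleLift hH).iterate n).cont
  exact (isOpen_lt (c1.comp continuous_fst) continuous_snd).inter
    (isOpen_lt continuous_snd (c2.comp continuous_fst))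

lemma connect_spec (h : IsDisconjugate H g₁ g₂) (hH : IsTwistGenerating H) {n : ℕ} {w : ℝ × ℝ}
    (hw : w ∈ connectDomain H g₁ g₂ n) :
    g₁ w.1 < connect H g₁ g₂ n w ∧ connect H g₁ g₂ n w < g₂ w.1 ∧
      ((map H)^[n] (w.1, connect H g₁ g₂ n w)).1 = w.2 := by
  have e1 := congrArg Prod.fst (h.inv₁.iterate_eq n w.1)
  have e2 := congrArg Prod.fst (h.inv₂.iterate_eq n w.1)
  have hex : w.2 ∈ (fun r => ((map H)^[n] (w.1, r)).1) '' Icc (g₁ w.1) (g₂ w.1) :=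
    intermediate_value_Icc (h.lt w.1).le
      (hH.differentiable_iterate_fst_snd n w.1).continuous.continuousOn
      ⟨by simp only [e1]; exact hw.1.le, by simp only [e2]; exact hw.2.le⟩
  have hm : connect H g₁ g₂ n w ∈ Icc (g₁ w.1) (g₂ w.1) := Function.invFunOn_mem hex
  have he : ((map H)^[n] (w.1, connect H g₁ g₂ n w)).1 = w.2 := Function.invFunOn_eq hex
  refine ⟨lt_of_le_of_ne hm.1 fun h0 => ?_, lt_of_le_of_ne hm.2 fun h0 => ?_, he⟩
  · rw [← h0, e1] at he
    exact hw.1.ne he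
  · rw [h0, e2] at he
    exact hw.2.ne he.symm

lemma connect_unique (h : IsDisconjugate H g₁ g₂) (hH : IsTwistGenerating H) {n : ℕ} (hn : 0 < n)
    {w : ℝ × ℝ} (hw : w ∈ connectDomain H g₁ g₂ n) {r : ℝ} (h1 : g₁ w.1 ≤ r) (h2 : r ≤ g₂ w.1)
    (he : ((map H)^[n] (w.1, r)).1 = w.2) : connect H g₁ g₂ n w = r := by
  have hs := h.connect_spec hH hw
  exact (h.strictMonoOn hH hn w.1).injOn ⟨hs.1.le, hs.2.1.le⟩ ⟨h1, h2⟩ (hs.2.2.trans he.symm)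

lemma mem_connectDomain (h : IsDisconjugate H g₁ g₂) (hH : IsTwistGenerating H) {n : ℕ}
    (hn : 0 < n) {z : ℝ × ℝ} (h1 : g₁ z.1 < z.2) (h2 : z.2 < g₂ z.1) :
    (z.1, ((map H)^[n] z).1) ∈ connectDomain H g₁ g₂ n :=
  ⟨(h.inv₁.iterate_gt hH h1 n).2.2 hn, (h.inv₂.iterate_lt hH h2 n).2.2 hn⟩

lemma connect_iterate (h : IsDisconjugate H g₁ g₂) (hH : IsTwistGenerating H) {n : ℕ}
    (hn : 0 < n) {z : ℝ × ℝ} (h1 : g₁ z.1 < z.2) (h2 : z.2 < g₂ z.1) :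
    connect H g₁ g₂ n (z.1, ((map H)^[n] z).1) = z.2 :=
  h.connect_unique hH hn (h.mem_connectDomain hH hn h1 h2) h1.le h2.le rfl

lemma connect_add_int (h : IsDisconjugate H g₁ g₂) (hH : IsTwistGenerating H) {n : ℕ}
    (hn : 0 < n) {x x' : ℝ} (hw : (x, x') ∈ connectDomain H g₁ g₂ n) (k : ℤ) :
    (x + k, x' + k) ∈ connectDomain H g₁ g₂ n ∧
      connect H g₁ g₂ n (x + k, x' + k) = connect H g₁ g₂ n (x, x') := by
  have hs := h.connect_spec hH hw
  have hmem : (x + k, x' + k) ∈ connectDomain H g₁ g₂ n := by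
    constructor
    · rw [((h.inv₁.isCircleLift hH).iterate n).add_int]
      exact add_lt_add_left hw.1 _
    · rw [((h.inv₂.isCircleLift hH).iterate n).add_int]
      exact add_lt_add_left hw.2 _
  refine ⟨hmem, h.connect_unique hH hn hmem ?_ ?_ ?_⟩
  · rw [h.inv₁.add_int]; exact hs.1.le
  · rw [h.inv₂.add_int]; exact hs.2.1.le
  · rw [hH.iterate_add_int, hs.2.2]

lemma connectAction_add_int (h : IsDisconjugate H g₁ g₂) (hH : IsTwistGenerating H) {n : ℕ}
    (hn : 0 < n) {x x' : ℝ} (hw : (x, x') ∈ connectDomain H g₁ g₂ n) (k : ℤ) :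
    connectAction H g₁ g₂ n (x + k, x' + k) = connectAction H g₁ g₂ n (x, x') := by
  rw [connectAction, (h.connect_add_int hH hn hw k).2, action_add_int hH]
  rfl

/-- For a momentum slightly below or above the connecting one, the inequality between its endpoint
and the target persists nearby; strict monotonicity turns it back into an inequality for the
connecting momentum. -/
lemma continuousAt_connect (h : IsDisconjugate H g₁ g₂) (hH : IsTwistGenerating H) {n : ℕ}
    (hn : 0 < n) {w : ℝ × ℝ} (hw : w ∈ connectDomain H g₁ g₂ n) :
    ContinuousAt (connect H g₁ g₂ n) w := by
  have hs := h.connect_spec hH hw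
  have hcont : ∀ r, Continuous (fun v : ℝ × ℝ => ((map H)^[n] (v.1, r)).1) := fun r =>
    (hH.differentiable_iterate_fst n).continuous.comp (continuous_fst.prodMk continuous_const)
  have hD := (h.isOpen_connectDomain hH n).mem_nhds hw
  have hnear : ∀ r, g₁ w.1 < r → r < g₂ w.1 → ∀ᶠ v in 𝓝 w, g₁ v.1 < r ∧ r < g₂ v.1 := by
    intro r h1 h2
    exact (((h.inv₁.cont.comp continuous_fst).continuousAt.eventually_lt
      continuousAt_const h1)).and
      (continuousAt_const.eventually_lt (h.inv₂.cont.comp continuous_fst).continuousAt h2)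
  refine tendsto_order.2 ⟨fun a ha => ?_, fun a ha => ?_⟩
  · obtain ⟨r, hr1, hr2⟩ := exists_between (max_lt ha hs.1)
    rw [max_lt_iff] at hr1
    have hlt : ((map H)^[n] (w.1, r)).1 < w.2 := by
      have := h.strictMonoOn hH hn w.1 ⟨hr1.2.le, (hr2.trans hs.2.1).le⟩ ⟨hs.1.le, hs.2.1.le⟩ hr2
      simpa only [hs.2.2] using this
    filter_upwards [hD, hnear r hr1.2 (hr2.trans hs.2.1),
      (hcont r).continuousAt.eventually_lt continuousAt_snd hlt] with v hv1 hv2 hv3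
    have hsv := h.connect_spec hH hv1
    rw [← hsv.2.2] at hv3
    exact hr1.1.trans (((h.strictMonoOn hH hn v.1).lt_iff_lt ⟨hv2.1.le, hv2.2.le⟩
      ⟨hsv.1.le, hsv.2.1.le⟩).1 hv3)
  · obtain ⟨r, hr1, hr2⟩ := exists_between (lt_min ha hs.2.1)
    rw [lt_min_iff] at hr2
    have hlt : w.2 < ((map H)^[n] (w.1, r)).1 := by
      have := h.strictMonoOn hH hn w.1 ⟨hs.1.le, hs.2.1.le⟩ ⟨(hs.1.trans hr1).le, hr2.2.le⟩ hr1
      simpa only [hs.2.2] using this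
    filter_upwards [hD, hnear r (hs.1.trans hr1) hr2.2,
      continuousAt_snd.eventually_lt (hcont r).continuousAt hlt] with v hv1 hv2 hv3
    have hsv := h.connect_spec hH hv1
    rw [← hsv.2.2] at hv3
    exact (((h.strictMonoOn hH hn v.1).lt_iff_lt ⟨hsv.1.le, hsv.2.1.le⟩
      ⟨hv2.1.le, hv2.2.le⟩).1 hv3).trans hr2.1

/-- On this domain the connecting action is a generating function of the iterate: its partial
derivatives are minus the initial momentum and the final momentum. -/
lemma hasFDerivAt_connectAction (h : IsDisconjugate H g₁ g₂) (hH : IsTwistGenerating H) {n : ℕ}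
    (hn : 0 < n) {w : ℝ × ℝ} (hw : w ∈ connectDomain H g₁ g₂ n) :
    HasFDerivAt (connectAction H g₁ g₂ n)
      (((map H)^[n] (w.1, connect H g₁ g₂ n w)).2 • ContinuousLinearMap.snd ℝ ℝ ℝ -
        connect H g₁ g₂ n w • ContinuousLinearMap.fst ℝ ℝ ℝ) w := by
  have hs := h.connect_spec hH hw
  set r := connect H g₁ g₂ n w
  set P : ℝ × ℝ → ℝ := fun z => ((map H)^[n] z).1 with hP
  have hPd : HasFDerivAt P (fderiv ℝ P (w.1, r)) (w.1, r) :=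
    (hH.differentiable_iterate_fst n _).hasFDerivAt
  have hb : deriv (fun r => ((map H)^[n] (w.1, r)).1) r = fderiv ℝ P (w.1, r) (0, 1) := by
    have h2 : HasDerivAt (fun t : ℝ => (w.1, t)) ((0 : ℝ), (1 : ℝ)) r :=
      (hasDerivAt_const r w.1).prodMk (hasDerivAt_id r)
    have h3 := hPd.comp_hasDerivAt r h2
    exact h3.deriv
  have hpos : fderiv ℝ P (w.1, r) (0, 1) ≠ 0 := by
    rw [← hb]
    exact (h.deriv_pos hH hn hs.1.le hs.2.1.le).ne'
  have hPd' : HasFDerivAt P (fderiv ℝ P (w.1, r) (1, 0) • ContinuousLinearMap.fst ℝ ℝ ℝ +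
      fderiv ℝ P (w.1, r) (0, 1) • ContinuousLinearMap.snd ℝ ℝ ℝ) (w.1, r) := by
    refine hPd.congr_fderiv ?_
    ext <;> simp
  have hev : ∀ᶠ v in 𝓝 w, P (v.1, connect H g₁ g₂ n v) = v.2 :=
    ((h.isOpen_connectDomain hH n).eventually_mem hw).mono fun v hv =>
      (h.connect_spec hH hv).2.2
  have hR := hasFDerivAt_implicit (h.continuousAt_connect hH hn hw) hPd' hpos hev
  have hpair : HasFDerivAt (fun v : ℝ × ℝ => (v.1, connect H g₁ g₂ n v)) _ w :=
    (hasFDerivAt_fst (𝕜 := ℝ) (p := w)).prodMk hR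
  have hcomp := HasFDerivAt.comp w (f := fun v : ℝ × ℝ => (v.1, connect H g₁ g₂ n v)) hPd hpair
  -- The connecting segment ends at `w.2` by construction, so the endpoint term of the chain rule is
  -- the second projection and the derivative of `connect` drops out.
  have hsnd := hcomp.unique ((hasFDerivAt_snd (𝕜 := ℝ) (p := w)).congr_of_eventuallyEq hev)
  have hA := HasFDerivAt.comp w (f := fun v : ℝ × ℝ => (v.1, connect H g₁ g₂ n v))
    (hasFDerivAt_action hH n (w.1, r)) hpair
  refine hA.congr_fderiv ?_
  rw [ContinuousLinearMap.sub_comp, ContinuousLinearMap.smul_comp, ContinuousLinearMap.smul_comp,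
    hsnd, ContinuousLinearMap.fst_comp_prod]

/-- The action of connecting orbit segments satisfies the triangle inequality. -/
lemma connectAction_add_le (h : IsDisconjugate H g₁ g₂) (hH : IsTwistGenerating H) {n m : ℕ}
    (hn : 0 < n) (hm : 0 < m) {x y z : ℝ} (hxy : (x, y) ∈ connectDomain H g₁ g₂ n)
    (hyz : (y, z) ∈ connectDomain H g₁ g₂ m) :
    (x, z) ∈ connectDomain H g₁ g₂ (n + m) ∧
      connectAction H g₁ g₂ (n + m) (x, z) ≤
        connectAction H g₁ g₂ n (x, y) + connectAction H g₁ g₂ m (y, z) := by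
  have l₁ := h.inv₁.isCircleLift hH
  have l₂ := h.inv₂.isCircleLift hH
  have hxz : (x, z) ∈ connectDomain H g₁ g₂ (n + m) := by
    rw [add_comm]
    constructor
    · rw [Function.iterate_add_apply]
      exact ((l₁.iterate m).mono hxy.1).trans hyz.1
    · rw [Function.iterate_add_apply]
      exact hyz.2.trans ((l₂.iterate m).mono hxy.2)
  refine ⟨hxz, ?_⟩
  have hs := h.connect_spec hH hxz
  have hs3 : ((map H)^[m] ((map H)^[n] (x, connect H g₁ g₂ (n + m) (x, z)))).1 = z := by
    rw [← Function.iterate_add_apply, add_comm m n]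
    exact hs.2.2
  have hS : connectAction H g₁ g₂ (n + m) (x, z) = action H n (x, connect H g₁ g₂ (n + m) (x, z)) +
      action H m ((map H)^[n] (x, connect H g₁ g₂ (n + m) (x, z))) := action_add _ _ _ _
  have hy0 := h.mem_connectDomain hH hn (z := (x, connect H g₁ g₂ (n + m) (x, z))) hs.1 hs.2.1
  have hr0 := h.connect_iterate hH hn (z := (x, connect H g₁ g₂ (n + m) (x, z))) hs.1 hs.2.1
  set r₀ := connect H g₁ g₂ (n + m) (x, z)
  set w₀ := (map H)^[n] (x, r₀)
  set y₀ := w₀.1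
  have hw1 := (h.inv₁.iterate_gt hH (z := (x, r₀)) hs.1 n).2.1
  have hw2 := (h.inv₂.iterate_lt hH (z := (x, r₀)) hs.2.1 n).2.1
  have hy1 := h.mem_connectDomain hH hm hw1 hw2
  have hr1 := h.connect_iterate hH hm hw1 hw2
  simp only at hy0 hr0 hy1 hr1
  change (y₀, ((map H)^[m] w₀).1) ∈ _ at hy1
  change connect H g₁ g₂ m (y₀, ((map H)^[m] w₀).1) = w₀.2 at hr1
  rw [hs3] at hy1 hr1
  -- `T y` is the action of the path broken at `y`. Its derivative is the incoming minus the
  -- outgoing momentum, and the true orbit passes through `y₀`, which turns out to be the minimum on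
  -- the interval `I` of admissible breaking points.
  set T : ℝ → ℝ := fun y => connectAction H g₁ g₂ n (x, y) + connectAction H g₁ g₂ m (y, z) with hT
  have hT0 : T y₀ = connectAction H g₁ g₂ (n + m) (x, z) := by
    rw [hS]
    simp only [hT, connectAction]
    rw [hr0, hr1]
  set I : Set ℝ := {y | (x, y) ∈ connectDomain H g₁ g₂ n ∧ (y, z) ∈ connectDomain H g₁ g₂ m}
  have hI : I.OrdConnected := by
    refine ⟨fun a ha b hb c hc => ⟨⟨ha.1.1.trans_le hc.1, hc.2.trans_lt hb.1.2⟩,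
      ((l₁.iterate m).mono.monotone hc.2).trans_lt hb.2.1,
      ha.2.2.trans_le ((l₂.iterate m).mono.monotone hc.1)⟩⟩
  have hTd : ∀ y ∈ I, HasDerivAt T (((map H)^[n] (x, connect H g₁ g₂ n (x, y))).2 -
      connect H g₁ g₂ m (y, z)) y := by
    intro y hy
    have d1 := (h.hasFDerivAt_connectAction hH hn hy.1).comp_hasDerivAt y
      ((hasDerivAt_const y x).prodMk (hasDerivAt_id y))
    have d2 := (h.hasFDerivAt_connectAction hH hm hy.2).comp_hasDerivAt y
      ((hasDerivAt_id y).prodMk (hasDerivAt_const y z))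
    refine (d1.add d2).congr_deriv ?_
    simp [sub_eq_add_neg]
  -- the sign of the derivative of `T`
  have hsign : ∀ y ∈ I, (y ≤ y₀ → ((map H)^[n] (x, connect H g₁ g₂ n (x, y))).2 ≤
      connect H g₁ g₂ m (y, z)) ∧ (y₀ ≤ y → connect H g₁ g₂ m (y, z) ≤
      ((map H)^[n] (x, connect H g₁ g₂ n (x, y))).2) := by
    intro y hy
    have hsy := h.connect_spec hH hy.1
    have hsz := h.connect_spec hH hy.2
    simp only at hsy hsz
    set r := connect H g₁ g₂ n (x, y)
    have hv1 := (h.inv₁.iterate_gt hH (z := (x, r)) hsy.1 n).2.1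
    have hv2 := (h.inv₂.iterate_lt hH (z := (x, r)) hsy.2.1 n).2.1
    rw [hsy.2.2] at hv1 hv2
    have hpair : (map H)^[n] (x, r) = (y, ((map H)^[n] (x, r)).2) := Prod.ext hsy.2.2 rfl
    have hmono := h.strictMonoOn hH hn x
    have hmono' := h.strictMonoOn hH (Nat.add_pos_left hn m) x
    have hmonoy := h.strictMonoOn hH hm y
    have hPm : ((map H)^[n + m] (x, r)).1 = ((map H)^[m] (y, ((map H)^[n] (x, r)).2)).1 := by
      rw [add_comm, Function.iterate_add_apply, ← hpair]
    have hr : r ∈ Icc (g₁ x) (g₂ x) := ⟨hsy.1.le, hsy.2.1.le⟩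
    have hr₀ : r₀ ∈ Icc (g₁ x) (g₂ x) := ⟨hs.1.le, hs.2.1.le⟩
    -- For `y ≤ y₀` the first segment starts with a momentum at most `r₀`, so its unbroken
    -- continuation ends at or before `z`. Monotonicity in the momentum at `y` then puts the
    -- incoming momentum at or below the outgoing one; the other case is symmetric.
    constructor
    · intro hle
      have h1 : r ≤ r₀ := by
        rw [← hmono.le_iff_le hr hr₀]
        exact hsy.2.2.le.trans hle
      have h2 := hmono'.monotoneOn hr hr₀ h1
      simp only [hPm, hs.2.2] at h2
      rw [← hmonoy.le_iff_le ⟨hv1.le, hv2.le⟩ ⟨hsz.1.le, hsz.2.1.le⟩]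
      exact h2.trans hsz.2.2.ge
    · intro hle
      have h1 : r₀ ≤ r := by
        rw [← hmono.le_iff_le hr₀ hr]
        exact hle.trans hsy.2.2.ge
      have h2 := hmono'.monotoneOn hr₀ hr h1
      simp only [hPm, hs.2.2] at h2
      rw [← hmonoy.le_iff_le ⟨hsz.1.le, hsz.2.1.le⟩ ⟨hv1.le, hv2.le⟩]
      exact hsz.2.2.le.trans h2
  have hyI : y ∈ I := ⟨hxy, hyz⟩
  have hy₀I : y₀ ∈ I := ⟨hy0, hy1⟩
  rw [← hT0]
  change T y₀ ≤ T y
  rcases le_total y y₀ with hle | hle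
  · have hsub : Icc y y₀ ⊆ I := hI.out hyI hy₀I
    refine antitoneOn_of_deriv_nonpos (convex_Icc y y₀)
      (fun t ht => (hTd t (hsub ht)).continuousAt.continuousWithinAt)
      (fun t ht => (hTd t (hsub (interior_subset ht))).differentiableAt.differentiableWithinAt)
      (fun t ht => ?_) (left_mem_Icc.2 hle) (right_mem_Icc.2 hle) hle
    have ht' := interior_subset ht
    rw [(hTd t (hsub ht')).deriv]
    exact sub_nonpos.2 ((hsign t (hsub ht')).1 ht'.2)
  · have hsub : Icc y₀ y ⊆ I := hI.out hy₀I hyI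
    refine monotoneOn_of_deriv_nonneg (convex_Icc y₀ y)
      (fun t ht => (hTd t (hsub ht)).continuousAt.continuousWithinAt)
      (fun t ht => (hTd t (hsub (interior_subset ht))).differentiableAt.differentiableWithinAt)
      (fun t ht => ?_) (left_mem_Icc.2 hle) (right_mem_Icc.2 hle) hle
    have ht' := interior_subset ht
    rw [(hTd t (hsub ht')).deriv]
    exact sub_nonneg.2 ((hsign t (hsub ht')).2 ht'.1)

end IsDisconjugate

end TwistMap

namespace TwistMap

/-! ### Constancy of the periodic action -/

namespace IsDisconjugate

variable {H : ℝ → ℝ → ℝ} {g₁ g₂ : ℝ → ℝ}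

lemma mem_connectDomain_of_rot {ω₁ ω₂ : ℝ} (hr₁ : HasRot (graphMap H g₁) ω₁)
    (hr₂ : HasRot (graphMap H g₂) ω₂) {n : ℕ} {m : ℤ} (h1 : n * ω₁ < m) (h2 : m < n * ω₂)
    (x : ℝ) : (x, x + m) ∈ connectDomain H g₁ g₂ n :=
  ⟨(hr₁ n m).2 h1 x, (hr₂ n m).1 h2 x⟩

/-- The action of the periodic orbits of a given type is constant. -/
lemma connectAction_const (h : IsDisconjugate H g₁ g₂) (hH : IsTwistGenerating H) {ω₁ ω₂ : ℝ}
    (hr₁ : HasRot (graphMap H g₁) ω₁) (hr₂ : HasRot (graphMap H g₂) ω₂) {q : ℕ} {p : ℤ}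
    (hq : 0 < q) (h1 : q * ω₁ < p) (h2 : p < q * ω₂) (x y : ℝ) :
    connectAction H g₁ g₂ q (x, x + p) = connectAction H g₁ g₂ q (y, y + p) := by
  set W : ℝ → ℝ := fun x => connectAction H g₁ g₂ q (x, x + p) with hW
  have hD : ∀ (k : ℕ) x, 0 < k → (x, x + ((k * p : ℤ) : ℝ)) ∈ connectDomain H g₁ g₂ (k * q) := by
    intro k x hk
    have hk' : (0 : ℝ) < k := by exact_mod_cast hk
    refine mem_connectDomain_of_rot hr₁ hr₂ ?_ ?_ x
    · push_cast; nlinarith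
    · push_cast; nlinarith
  have hD1 : ∀ x, (x, x + (p : ℝ)) ∈ connectDomain H g₁ g₂ q := fun x =>
    mem_connectDomain_of_rot hr₁ hr₂ h1 h2 x
  -- The derivative is the final minus the initial momentum, so critical points are exactly the
  -- points where the connecting segment closes up to a periodic orbit.
  have hWd : ∀ x, HasDerivAt W (((map H)^[q] (x, connect H g₁ g₂ q (x, x + p))).2 -
      connect H g₁ g₂ q (x, x + p)) x := by
    intro x
    have d := (h.hasFDerivAt_connectAction hH hq (hD1 x)).comp_hasDerivAt x
      ((hasDerivAt_id x).prodMk ((hasDerivAt_id x).add_const (p : ℝ)))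
    refine d.congr_deriv ?_
    simp
  have hWc : Continuous W := continuous_iff_continuousAt.2 fun x => (hWd x).continuousAt
  have hW1 : ∀ (x : ℝ) (k : ℤ), W (x + k) = W x := fun x k => by
    have := h.connectAction_add_int hH hq (hD1 x) k
    simp only [hW]
    rw [← this]
    congr 2
    ring
  have hfract : ∀ x, W x = W (Int.fract x) := fun x => by
    conv_lhs => rw [← Int.fract_add_floor x]
    exact hW1 _ _
  have hmemI : ∀ x : ℝ, Int.fract x ∈ Icc (0 : ℝ) 1 := fun x =>
    ⟨Int.fract_nonneg x, (Int.fract_lt_one x).le⟩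
  obtain ⟨a, -, ha⟩ := isCompact_Icc.exists_isMaxOn (nonempty_Icc.2 zero_le_one) hWc.continuousOn
  obtain ⟨b, -, hb⟩ := isCompact_Icc.exists_isMinOn (nonempty_Icc.2 zero_le_one) hWc.continuousOn
  have ha' : ∀ x, W x ≤ W a := fun x => by rw [hfract]; exact ha (hmemI x)
  have hb' : ∀ x, W b ≤ W x := fun x => by rw [hfract x]; exact hb (hmemI x)
  suffices hab : W a ≤ W b from
    le_antisymm ((ha' x).trans (hab.trans (hb' y))) ((ha' y).trans (hab.trans (hb' x)))
  -- critical points of `W` give periodic orbits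
  have hcrit : ∀ x, deriv W x = 0 → ∀ k : ℕ, 0 < k →
      connectAction H g₁ g₂ (k * q) (x, x + ((k * p : ℤ) : ℝ)) = k * W x := by
    intro x hx k hk
    rw [(hWd x).deriv, sub_eq_zero] at hx
    have hs := h.connect_spec hH (hD1 x)
    simp only at hs
    set r := connect H g₁ g₂ q (x, x + p) with hr
    have hper : (map H)^[q] (x, r) = (x + p, r) := Prod.ext hs.2.2 hx
    have hperk : ∀ k : ℕ, (map H)^[k * q] (x, r) = (x + ((k * p : ℤ) : ℝ), r) ∧
        action H (k * q) (x, r) = k * W x := by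
      intro k
      induction k with
      | zero => simp [action]
      | succ k ih =>
        rw [Nat.succ_mul]
        refine ⟨?_, ?_⟩
        · rw [Function.iterate_add_apply, hper, hH.iterate_add_int, ih.1]
          refine Prod.ext ?_ rfl
          push_cast
          ring
        · rw [action_add, ih.1, ih.2, action_add_int hH]
          push_cast
          rw [add_mul, one_mul]
          rfl
    have hu := h.connect_unique hH (Nat.mul_pos hk hq) (hD k x hk) hs.1.le hs.2.1.le
      (congrArg Prod.fst (hperk k).1)
    rw [connectAction, hu]
    exact (hperk k).2
  have hca : deriv W a = 0 := IsLocalMax.deriv_eq_zero (Eventually.of_forall ha')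
  have hcb : deriv W b = 0 := IsLocalMin.deriv_eq_zero (Eventually.of_forall hb')
  -- transitions between the two periodic orbits
  obtain ⟨N, hN⟩ : ∃ N : ℕ, 0 < N ∧ 1 + |a - b| < N * (p - q * ω₁) ∧
      1 + |a - b| < N * (q * ω₂ - p) := by
    -- After `N` periods the boundary dynamics differ from the translation by `N * p` by more than
    -- `1 + |a - b|` on either side. The 1 absorbs the error in `HasRot.abs_sub_le`, and `|a - b|`
    -- leaves room to change from one orbit to the other.
    obtain ⟨N, hN⟩ := exists_nat_gt
      (max 0 (max ((1 + |a - b|) / (p - q * ω₁)) ((1 + |a - b|) / (q * ω₂ - p))))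
    rw [max_lt_iff, max_lt_iff, div_lt_iff₀ (sub_pos.2 h1), div_lt_iff₀ (sub_pos.2 h2)] at hN
    exact ⟨N, by exact_mod_cast hN.1, hN.2⟩
  have htrans : ∀ x y : ℝ, |x - y| ≤ |a - b| →
      (x, y + ((N * p : ℤ) : ℝ)) ∈ connectDomain H g₁ g₂ (N * q) := by
    intro x y hxy
    have e1 := (abs_le.1 (hr₁.abs_sub_le (N * q) x)).2
    have e2 := (abs_le.1 (hr₂.abs_sub_le (N * q) x)).1
    have e3 := abs_le.1 hxy
    push_cast at e1 e2
    constructor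
    · push_cast
      linarith [hN.2.1]
    · push_cast
      linarith [hN.2.2]
  have hNq : 0 < N * q := Nat.mul_pos hN.1 hq
  set C := connectAction H g₁ g₂ (N * q) (a, b + ((N * p : ℤ) : ℝ)) +
    connectAction H g₁ g₂ (N * q) (b, a + ((N * p : ℤ) : ℝ)) with hC
  -- The periodic orbit of `a` is compared with the path that goes from `a` to `b` in `N` periods,
  -- follows the orbit of `b` for `k` periods and returns in `N` periods. The two transitions cost
  -- `C` whatever `k` is, so `k → ∞` gives `W a ≤ W b`.
  have key : ∀ k : ℕ, 0 < k → (2 * N + k) * W a ≤ C + k * W b := by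
    intro k hk
    have hkq : 0 < k * q := Nat.mul_pos hk hq
    have t1 := htrans a b le_rfl
    have t2 := hD k b hk
    have t3 := htrans b a (abs_sub_comm _ _).le
    have t2' := h.connect_add_int hH hkq t2 (N * p)
    have s2' := h.connectAction_add_int hH hkq t2 (N * p)
    have t3' := h.connect_add_int hH hNq t3 ((N + k : ℤ) * p)
    have s3' := h.connectAction_add_int hH hNq t3 ((N + k : ℤ) * p)
    have e1 : b + ((N * p : ℤ) : ℝ) + ((k * p : ℤ) : ℝ) = b + (((N + k : ℤ) * p : ℤ) : ℝ) := by
      push_cast; ring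
    have e2 : b + ((k * p : ℤ) : ℝ) + ((N * p : ℤ) : ℝ) = b + (((N + k : ℤ) * p : ℤ) : ℝ) := by
      push_cast; ring
    have e3 : a + ((N * p : ℤ) : ℝ) + (((N + k : ℤ) * p : ℤ) : ℝ) =
        a + (((2 * N + k : ℕ) * p : ℤ) : ℝ) := by
      push_cast; ring
    rw [e2] at t2' s2'
    rw [e3] at t3' s3'
    have u1 := h.connectAction_add_le hH hNq hkq t1 t2'.1
    have u2 := h.connectAction_add_le hH (Nat.add_pos_left hNq _) hNq u1.1 t3'.1
    have e4 : N * q + k * q + N * q = (2 * N + k) * q := by ring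
    rw [e4, hcrit a hca (2 * N + k) (by omega), s3'] at u2
    have u3 := u1.2
    rw [s2', hcrit b hcb k hk] at u3
    have u4 := u2.2
    rw [Nat.cast_add, Nat.cast_mul, Nat.cast_two] at u4
    rw [hC]
    linarith
  rw [← sub_nonpos]
  refine nonpos_of_forall_nat_mul_le (b := C - 2 * N * W a - (W a - W b)) fun k => ?_
  have := key (k + 1) (Nat.succ_pos k)
  push_cast at this
  linarith

/-- A region without conjugate points contains periodic graphs of all intermediate rational
rotation numbers. -/
theorem exists_periodicGraph (h : IsDisconjugate H g₁ g₂) (hH : IsTwistGenerating H) {ω₁ ω₂ : ℝ}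
    (hr₁ : HasRot (graphMap H g₁) ω₁) (hr₂ : HasRot (graphMap H g₂) ω₂) {ρ : ℚ}
    (h1 : ω₁ < ρ) (h2 : ρ < ω₂) : ∃ η, IsPeriodicGraph H η ρ := by
  have hq : 0 < ρ.den := ρ.den_pos
  have hq' : (0 : ℝ) < ρ.den := by exact_mod_cast hq
  rw [Rat.cast_def] at h1 h2
  rw [lt_div_iff₀ hq', mul_comm] at h1
  rw [div_lt_iff₀ hq', mul_comm] at h2
  set q := ρ.den
  set p := ρ.num
  have hD1 : ∀ x, (x, x + (p : ℝ)) ∈ connectDomain H g₁ g₂ q := fun x =>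
    mem_connectDomain_of_rot hr₁ hr₂ h1 h2 x
  set η : ℝ → ℝ := fun x => connect H g₁ g₂ q (x, x + p) with hη
  have hs : ∀ x, g₁ x < η x ∧ η x < g₂ x ∧ ((map H)^[q] (x, η x)).1 = x + p := fun x =>
    h.connect_spec hH (hD1 x)
  have hper : ∀ x, (map H)^[q] (x, η x) = (x + p, η x) := by
    intro x
    have d := (h.hasFDerivAt_connectAction hH hq (hD1 x)).comp_hasDerivAt x
      ((hasDerivAt_id x).prodMk ((hasDerivAt_id x).add_const (p : ℝ)))
    have d2 := (hasDerivAt_const x (connectAction H g₁ g₂ q (0, 0 + p))).congr_of_eventuallyEq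
      (Eventually.of_forall fun y => h.connectAction_const hH hr₁ hr₂ hq h1 h2 y 0)
    -- Since the action is constant, every abscissa is critical, so every connecting segment closes
    -- up.
    have d3 : ((map H)^[q] (x, η x)).2 - η x = 0 :=
      (d.congr_deriv (by simp [hη])).unique d2
    exact Prod.ext (hs x).2.2 (sub_eq_zero.1 d3)
  have hη1 : ∀ x, η (x + 1) = η x := fun x => by
    have := (h.connect_add_int hH hq (hD1 x) 1).2
    simp only [hη]
    rw [← this, Int.cast_one, add_right_comm]
  have hinv : IsInvGraph H η := by
    refine ⟨?_, hη1, fun x => ?_⟩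
    · refine continuous_iff_continuousAt.2 fun x => ?_
      exact ContinuousAt.comp (f := fun x : ℝ => (x, x + (p : ℝ)))
        (h.continuousAt_connect hH hq (hD1 x)) (by fun_prop)
    · have h3 := (h.inv₁.lt_map hH (z := (x, η x)) (hs x).1).2
      have h4 := (h.inv₂.map_lt hH (z := (x, η x)) (hs x).2.1).2
      -- The image of a point of the graph is again periodic of the same type and inside the region;
      -- uniqueness of connecting segments puts it on the graph.
      refine (h.connect_unique hH hq (hD1 _) h3.le h4.le ?_).symm
      simp only [Prod.mk.eta]
      rw [← Function.iterate_succ_apply, Function.iterate_succ_apply', hper, map_add_int hH]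
  refine ⟨η, hinv, fun x => ?_⟩
  have e := congrArg Prod.fst (hinv.iterate_eq q x)
  rw [hper] at e
  exact e.symm

end IsDisconjugate

end TwistMap

namespace TwistMap

/-! ### Curves in the cylinder and their lifts -/

lemma coe_eq_coe_iff (x y : ℝ) : (x : UnitAddCircle) = y ↔ ∃ n : ℤ, x = y + n := by
  rw [← sub_eq_zero, ← AddCircle.coe_sub, AddCircle.coe_eq_zero_iff]
  refine exists_congr fun n => ?_
  rw [zsmul_eq_mul, mul_one]
  constructor <;> intro h <;> linarith

lemma coe_add_intCast (x : ℝ) (n : ℤ) : ((x + n : ℝ) : UnitAddCircle) = x :=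
  (coe_eq_coe_iff _ _).2 ⟨n, rfl⟩

lemma proj_add_int (x r : ℝ) (n : ℤ) : proj (x + n, r) = proj (x, r) :=
  Prod.ext (coe_add_intCast x n) rfl

lemma proj_eq_iff (z w : ℝ × ℝ) : proj z = proj w ↔ ∃ n : ℤ, z = (w.1 + n, w.2) := by
  rw [proj, proj, Prod.mk.injEq, coe_eq_coe_iff]
  constructor
  · rintro ⟨⟨n, h1⟩, h2⟩
    exact ⟨n, Prod.ext h1 h2⟩
  · rintro ⟨n, rfl⟩
    exact ⟨⟨n, rfl⟩, rfl⟩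

lemma proj_surjective : Function.Surjective proj := fun ⟨t, r⟩ => by
  obtain ⟨x, rfl⟩ := QuotientAddGroup.mk_surjective t
  exact ⟨(x, r), rfl⟩

lemma continuous_coe : Continuous (fun x : ℝ => (x : UnitAddCircle)) :=
  AddCircle.continuous_mk' 1

lemma continuous_proj : Continuous proj :=
  (continuous_coe.comp continuous_fst).prodMk continuous_snd

/-- The map of the circle induced by a periodic map of the line. -/
noncomputable def descend {B : Type*} [TopologicalSpace B] {f : ℝ → B} (hc : Continuous f)
    (hf : ∀ x, f (x + 1) = f x) : C(UnitAddCircle, B) where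
  toFun := Function.Periodic.lift (c := (1 : ℝ)) hf
  continuous_toFun := continuous_coinduced_dom.2 hc

/-- A map of the circle lifts to the line. -/
lemma exists_lift_circle (φ : C(UnitAddCircle, UnitAddCircle)) :
    ∃ a : ℝ → ℝ, Continuous a ∧ (∀ s : ℝ, (a s : UnitAddCircle) = φ s) ∧
      ∃ d : ℤ, ∀ s, a (s + 1) = a s + d := by
  have cov := AddCircle.isCoveringMap_coe (1 : ℝ)
  obtain ⟨e, he⟩ := QuotientAddGroup.mk_surjective (φ ((0 : ℝ) : UnitAddCircle))
  obtain ⟨a, ⟨-, ha⟩, -⟩ := cov.existsUnique_continuousMap_lifts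
    (φ.comp ⟨fun x : ℝ => (x : UnitAddCircle), continuous_coe⟩) (0 : ℝ) e he
  have ha' : ∀ s : ℝ, (a s : UnitAddCircle) = φ s := fun s => congrFun ha s
  obtain ⟨d, hd⟩ : ∃ d : ℤ, a (0 + 1) = a 0 + d := by
    rw [← coe_eq_coe_iff, ha', ha']
    congr 1
    simp
  refine ⟨a, a.continuous, ha', d, fun s => ?_⟩
  have h1 : Continuous (fun s : ℝ => a (s + 1)) := a.continuous.comp (continuous_id.add_const 1)
  have h2 : Continuous (fun s : ℝ => a s + d) := a.continuous.add_const _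
  refine congrFun (cov.eq_of_comp_eq h1 h2 (funext fun s => ?_) 0 hd) s
  change ((a (s + 1) : ℝ) : UnitAddCircle) = ((a s + d : ℝ) : UnitAddCircle)
  rw [coe_add_intCast, ha', ha']
  congr 1
  simp

/-- An essential curve is parametrized by a curve in the plane that makes a positive number of
turns around the cylinder. -/
lemma IsEssentialCurve.exists_lift {Γ : Set Cylinder} (hΓ : IsEssentialCurve Γ) :
    ∃ (c : ℝ → ℝ × ℝ) (d : ℤ), Continuous c ∧ 0 < d ∧
      (∀ s, c (s + 1) = ((c s).1 + d, (c s).2)) ∧ (∀ s, proj (c s) ∈ Γ) ∧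
      ∀ w ∈ Γ, ∃ s, proj (c s) = w := by
  obtain ⟨γ, -, hnull, rfl⟩ := hΓ
  obtain ⟨a, hac, ha, d, hd⟩ := exists_lift_circle (ContinuousMap.fst.comp γ)
  have hb : ∀ s : ℝ, (γ ((s + 1 : ℝ) : UnitAddCircle)) = γ (s : UnitAddCircle) := fun s => by
    congr 1
    simp
  have hbc : Continuous (fun s : ℝ => (γ (s : UnitAddCircle)).2) :=
    continuous_snd.comp (γ.continuous.comp continuous_coe)
  have hproj : ∀ s : ℝ, proj (a s, (γ (s : UnitAddCircle)).2) = γ (s : UnitAddCircle) := fun s =>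
    Prod.ext (ha s) rfl
  have hd0 : d ≠ 0 := by
    rintro rfl
    -- With zero winding the lift is itself periodic, so the curve factors through the contractible
    -- plane.
    refine hnull ?_
    have hper : ∀ s : ℝ, ((a (s + 1), (γ ((s + 1 : ℝ) : UnitAddCircle)).2) : ℝ × ℝ) =
        (a s, (γ (s : UnitAddCircle)).2) := fun s => by rw [hd, hb]; simp
    have hn := ((id_nullhomotopic (ℝ × ℝ)).comp_left
      (descend (hac.prodMk hbc) hper)).comp_right ⟨proj, continuous_proj⟩
    convert hn
    ext t
    · obtain ⟨s, rfl⟩ := QuotientAddGroup.mk_surjective t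
      exact (congrArg Prod.fst (hproj s)).symm
    · obtain ⟨s, rfl⟩ := QuotientAddGroup.mk_surjective t
      rfl
  have hsurj : ∀ w ∈ range γ, ∃ s : ℝ, proj (a s, (γ (s : UnitAddCircle)).2) = w := by
    rintro _ ⟨t, rfl⟩
    obtain ⟨s, rfl⟩ := QuotientAddGroup.mk_surjective t
    exact ⟨s, hproj s⟩
  rcases hd0.lt_or_gt with hneg | hpos
  · refine ⟨fun s => (a (-s), (γ ((-s : ℝ) : UnitAddCircle)).2), -d,
      (hac.prodMk hbc).comp continuous_neg, by omega, fun s => ?_, fun s => ?_, fun w hw => ?_⟩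
    · have e : -s = -(s + 1) + 1 := by ring
      refine Prod.ext ?_ ?_
      · simp only
        rw [e, hd]
        push_cast
        ring
      · simp only
        rw [e, hb]
    · rw [hproj]
      exact ⟨_, rfl⟩
    · obtain ⟨s, hs⟩ := hsurj w hw
      exact ⟨-s, by simpa using hs⟩
  · refine ⟨fun s => (a s, (γ (s : UnitAddCircle)).2), d, hac.prodMk hbc, hpos, fun s => ?_,
      fun s => ?_, hsurj⟩
    · simp only [hd, hb]
    · rw [hproj]
      exact ⟨_, rfl⟩

/-- Lifting a contraction, run from the constant end, would give a continuous section of the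
covering of the circle by the line. Composed with the covering map it is a translation of the line,
contradicting periodicity. -/
lemma not_nullhomotopic_id : ¬ (ContinuousMap.id UnitAddCircle).Nullhomotopic := by
  rintro ⟨y, ⟨F⟩⟩
  have cov := AddCircle.isCoveringMap_coe (1 : ℝ)
  obtain ⟨e, rfl⟩ := QuotientAddGroup.mk_surjective y
  let G := cov.liftHomotopy F.symm.toContinuousMap (ContinuousMap.const _ e)
    (fun a => F.symm.map_zero_left a)
  have hG : ∀ t : UnitAddCircle, ((G (1, t) : ℝ) : UnitAddCircle) = t := fun t => by
    have h1 := congrFun (cov.liftHomotopy_lifts F.symm.toContinuousMap (ContinuousMap.const _ e)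
      (fun a => F.symm.map_zero_left a)) (1, t)
    exact h1.trans (F.symm.map_one_left t)
  have h1 : Continuous (fun x : ℝ => G (1, (x : UnitAddCircle))) :=
    G.continuous.comp (continuous_const.prodMk continuous_coe)
  have h2 : Continuous (fun x : ℝ => x + G (1, ((0 : ℝ) : UnitAddCircle))) :=
    continuous_id.add_const _
  have h3 := cov.eq_of_comp_eq h1 h2 (funext fun x => by
    change ((G (1, (x : UnitAddCircle)) : ℝ) : UnitAddCircle) =
      ((x + G (1, ((0 : ℝ) : UnitAddCircle)) : ℝ) : UnitAddCircle)
    rw [AddCircle.coe_add, hG, hG, AddCircle.coe_zero, add_zero]) 0 (by simp)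
  have h4 := congrFun h3 1
  have h5 : ((1 : ℝ) : UnitAddCircle) = ((0 : ℝ) : UnitAddCircle) := by
    simp
  simp only [h5] at h4
  linarith

/-! ### Graphs in the cylinder -/

lemma mem_graph_descend {g : ℝ → ℝ} (hc : Continuous g) (hp : ∀ x, g (x + 1) = g x) (x r : ℝ) :
    proj (x, r) ∈ graph (descend hc hp) ↔ r = g x := Iff.rfl

lemma isEssentialCurve_graph (g : C(UnitAddCircle, ℝ)) : IsEssentialCurve (graph g) := by
  refine ⟨(ContinuousMap.id _).prodMk g, fun s t h => congrArg Prod.fst h, fun hn => ?_, ?_⟩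
  · exact not_nullhomotopic_id (hn.comp_right ContinuousMap.fst)
  · ext w
    constructor
    · rintro ⟨t, rfl⟩
      rfl
    · intro hw
      exact ⟨w.1, Prod.ext rfl (Eq.symm hw)⟩

lemma IsInvGraph.isInvariant_graph {H : ℝ → ℝ → ℝ} (hH : IsTwistGenerating H) {g : ℝ → ℝ}
    (hg : IsInvGraph H g) : IsInvariant H (graph (descend hg.cont hg.per)) := by
  refine Subset.antisymm ?_ fun w hw => ?_
  · rintro _ ⟨w, hw, rfl⟩
    obtain ⟨⟨x, r⟩, rfl⟩ := proj_surjective w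
    rw [mem_graph_descend] at hw
    rw [cylMap_proj hH, hw, hg.map_eq]
    exact (mem_graph_descend hg.cont hg.per _ _).2 rfl
  · obtain ⟨⟨x, r⟩, rfl⟩ := proj_surjective w
    rw [mem_graph_descend] at hw
    obtain ⟨y, rfl⟩ := (hg.isCircleLift hH).surjective x
    refine ⟨proj (y, g y), (mem_graph_descend hg.cont hg.per _ _).2 rfl, ?_⟩
    rw [cylMap_proj hH, hg.map_eq, hw]

lemma isInvGraph_of_isInvariant {H : ℝ → ℝ → ℝ} (hH : IsTwistGenerating H)
    {g : C(UnitAddCircle, ℝ)} (hg : IsInvariant H (graph g)) :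
    IsInvGraph H (fun x : ℝ => g (x : UnitAddCircle)) := by
  refine ⟨g.continuous.comp continuous_coe, fun x => ?_, fun x => ?_⟩
  · congr 1
    simp
  · have h1 : proj (x, g (x : UnitAddCircle)) ∈ graph g := rfl
    have h2 : cylMap H (proj (x, g (x : UnitAddCircle))) ∈ graph g := hg ▸ mem_image_of_mem _ h1
    rw [cylMap_proj hH] at h2
    exact h2

/-! ### Periodic graphs carry rigid rotations -/

/-- The average of the first `q` points of the orbit of `x`. -/
noncomputable def orbitAverage (f : ℝ → ℝ) (q : ℕ) (x : ℝ) : ℝ :=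
  (∑ j ∈ Finset.range q, f^[j] x) / q

lemma IsCircleLift.orbitAverage {f : ℝ → ℝ} (hf : IsCircleLift f) {q : ℕ} (hq : 0 < q) :
    IsCircleLift (orbitAverage f q) := by
  have hq' : (0 : ℝ) < q := by exact_mod_cast hq
  refine ⟨?_, fun x y hxy => ?_, fun x => ?_⟩
  · exact (continuous_finsetSum _ fun j _ => (hf.iterate j).cont).div_const _
  · refine div_lt_div_of_pos_right (Finset.sum_lt_sum_of_nonempty
      (Finset.nonempty_range_iff.2 hq.ne') fun j _ => ?_) hq'
    exact (hf.iterate j).mono hxy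
  · have e : ∀ j, f^[j] (x + 1) = f^[j] x + 1 := fun j => (hf.iterate j).add_one x
    rw [TwistMap.orbitAverage, TwistMap.orbitAverage, Finset.sum_congr rfl fun j _ => e j,
      Finset.sum_add_distrib]
    simp only [Finset.sum_const, Finset.card_range, nsmul_eq_mul, mul_one]
    rw [add_div, div_self hq'.ne']

/-- Passing from `x` to `f x` replaces the summand `x` by `f^[q] x = x + p`, so the average advances
by `p / q`. -/
lemma orbitAverage_apply {f : ℝ → ℝ} {q : ℕ} {p : ℤ}
    (h : ∀ x, f^[q] x = x + p) (x : ℝ) :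
    orbitAverage f q (f x) = orbitAverage f q x + (p : ℝ) / q := by
  have h1 : ∑ j ∈ Finset.range q, f^[j] (f x) = ∑ j ∈ Finset.range q, f^[j] x + p := by
    have h2 := Finset.sum_range_succ' (fun j => f^[j] x) q
    rw [Finset.sum_range_succ, h] at h2
    simp only [Function.iterate_succ_apply, Function.iterate_zero_apply] at h2
    linarith
  rw [orbitAverage, orbitAverage, h1, add_div]

/-- The orbit average is an increasing homeomorphism of the line that commutes with integer
translations and conjugates the graph dynamics to the translation by `ρ`. Its inverse parametrizes
the graph by the circle. -/
lemma IsPeriodicGraph.isRotationCurve {H : ℝ → ℝ → ℝ} (hH : IsTwistGenerating H) {g : ℝ → ℝ}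
    {ρ : ℚ} (h : IsPeriodicGraph H g ρ) :
    IsRotationCurve H (graph (descend h.inv.cont h.inv.per)) ρ := by
  have hg := h.inv
  refine ⟨isEssentialCurve_graph _, hg.isInvariant_graph hH, ?_, fun z hz => ?_⟩
  · have hf := hg.isCircleLift hH
    have hΦ := hf.orbitAverage ρ.den_pos
    set Φ := orbitAverage (graphMap H g) ρ.den
    have hΦf : ∀ x, Φ (graphMap H g x) = Φ x + ρ := fun x => by
      rw [Rat.cast_def ρ]
      exact orbitAverage_apply h.per x
    let e : ℝ ≃o ℝ := hΦ.mono.orderIsoOfSurjective Φ hΦ.surjective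
    have heΦ : ∀ x, e.symm (Φ x) = x := fun x => e.symm_apply_apply x
    have hΦe : ∀ s, Φ (e.symm s) = s := fun s => e.apply_symm_apply s
    have he1 : ∀ (s : ℝ) (k : ℤ), e.symm (s + k) = e.symm s + k := fun s k => by
      apply hΦ.mono.injective
      rw [hΦe, hΦ.add_int, hΦe]
    have hec : Continuous e.symm := e.symm.continuous
    have hcurve : Continuous (fun s => proj (e.symm s, g (e.symm s))) :=
      continuous_proj.comp (hec.prodMk (hg.cont.comp hec))
    have hcurve1 : ∀ s : ℝ, proj (e.symm (s + 1), g (e.symm (s + 1))) =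
        proj (e.symm s, g (e.symm s)) := fun s => by
      have e1 : e.symm (s + 1) = e.symm s + (1 : ℤ) := by simpa using he1 s 1
      rw [e1, hg.add_int, proj_add_int]
    let k₀ : C(UnitAddCircle, Cylinder) := descend hcurve hcurve1
    have hk₀ : ∀ s : ℝ, k₀ (s : UnitAddCircle) = proj (e.symm s, g (e.symm s)) := fun s => rfl
    have hmem : ∀ t, k₀ t ∈ graph (descend hg.cont hg.per) := fun t => by
      obtain ⟨s, rfl⟩ := QuotientAddGroup.mk_surjective t
      exact (mem_graph_descend hg.cont hg.per _ _).2 rfl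
    let k : UnitAddCircle → graph (descend hg.cont hg.per) := fun t => ⟨k₀ t, hmem t⟩
    have hkc : Continuous k := k₀.continuous.subtype_mk hmem
    have hkb : Function.Bijective k := by
      constructor
      · intro t t' htt
        obtain ⟨s, rfl⟩ := QuotientAddGroup.mk_surjective t
        obtain ⟨s', rfl⟩ := QuotientAddGroup.mk_surjective t'
        have h1 : k₀ (s : UnitAddCircle) = k₀ (s' : UnitAddCircle) := congrArg Subtype.val htt
        rw [hk₀, hk₀, proj_eq_iff] at h1
        obtain ⟨n, hn⟩ := h1
        have h2 := congrArg Prod.fst hn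
        simp only at h2
        rw [← he1] at h2
        exact (coe_eq_coe_iff s s').2 ⟨n, e.symm.injective h2⟩
      · rintro ⟨w, hw⟩
        obtain ⟨⟨x, r⟩, rfl⟩ := proj_surjective w
        refine ⟨((Φ x : ℝ) : UnitAddCircle), Subtype.ext ?_⟩
        rw [mem_graph_descend] at hw
        change k₀ _ = proj (x, r)
        rw [hk₀, heΦ, hw]
    refine ⟨Continuous.homeoOfEquivCompactToT2 (f := Equiv.ofBijective k hkb) hkc, fun t => ?_⟩
    obtain ⟨s, rfl⟩ := QuotientAddGroup.mk_surjective t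
    change cylMap H (k₀ (s : UnitAddCircle)) = k₀ ((s : UnitAddCircle) + ((ρ : ℝ) : UnitAddCircle))
    rw [← AddCircle.coe_add, hk₀, hk₀, cylMap_proj hH, hg.map_eq]
    have e1 : e.symm (s + ρ) = graphMap H g (e.symm s) := by
      apply hΦ.mono.injective
      rw [hΦe, hΦf, hΦe]
    rw [e1]
  · have hz' : z = (z.1, g z.1) := Prod.ext rfl ((mem_graph_descend hg.cont hg.per z.1 z.2).1 hz)
    have h1 := (h.hasRot hH).tendsto z.1
    refine h1.congr fun n => ?_
    have h2 := congrArg Prod.fst (hg.iterate_eq n z.1)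
    rw [← hz'] at h2
    rw [h2]

end TwistMap

namespace TwistMap

/-! ### Curves of periodic orbits are graphs -/

/-- The `q`-th iterate of the twist map translates `z` by `(p, 0)`. -/
def IsPeriodicPoint (H : ℝ → ℝ → ℝ) (q : ℕ) (p : ℤ) (z : ℝ × ℝ) : Prop :=
  (map H)^[q] z = (z.1 + p, z.2)

lemma cylMap_iterate_proj {H : ℝ → ℝ → ℝ} (hH : IsTwistGenerating H) (n : ℕ) (z : ℝ × ℝ) :
    (cylMap H)^[n] (proj z) = proj ((map H)^[n] z) := by
  have h : Function.Semiconj proj (map H) (cylMap H) := fun z => (cylMap_proj hH z).symm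
  exact ((h.iterate_right n) z).symm

lemma iterate_mul_of_eq_add_int {H : ℝ → ℝ → ℝ} (hH : IsTwistGenerating H) {q : ℕ} {p : ℤ}
    {z : ℝ × ℝ} (h : IsPeriodicPoint H q p z) (n : ℕ) :
    (map H)^[q * n] z = (z.1 + n * p, z.2) := by
  induction n with
  | zero => simp
  | succ n ih =>
    have h' : (map H)^[q] (z.1, z.2) = (z.1 + p, z.2) := h
    have e : z.1 + (n : ℝ) * p = z.1 + ((n * p : ℤ) : ℝ) := by push_cast; ring
    rw [Nat.mul_succ, Nat.add_comm, Function.iterate_add_apply, ih, e, hH.iterate_add_int, h']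
    refine Prod.ext ?_ rfl
    simp only
    push_cast
    ring

/-- The conjugacy makes the iterate of order `ρ.den` the identity on the curve, so its lift
translates `z` by an integer; the rotation number of the lifted orbit identifies this integer. -/
lemma IsRotationCurve.isPeriodicPoint {H : ℝ → ℝ → ℝ} (hH : IsTwistGenerating H)
    {Γ : Set Cylinder} {ρ : ℚ} (hΓ : IsRotationCurve H Γ ρ) {z : ℝ × ℝ} (hz : proj z ∈ Γ) :
    IsPeriodicPoint H ρ.den ρ.num z := by
  obtain ⟨⟨h, hh⟩, hrot⟩ := hΓ.conj
  have hq : (ρ.den : ℝ) ≠ 0 := by exact_mod_cast ρ.den_nz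
  have hit : ∀ (n : ℕ) (t : UnitAddCircle),
      (cylMap H)^[n] (h t : Cylinder) = h (t + ((n * ρ : ℝ) : UnitAddCircle)) := fun n t => by
    induction n with
    | zero => simp
    | succ n ih =>
      rw [Function.iterate_succ_apply', ih, hh, add_assoc, ← AddCircle.coe_add]
      congr 3
      push_cast
      ring_nf
  have hfix : proj ((map H)^[ρ.den] z) = proj z := by
    obtain ⟨t, ht⟩ := h.surjective ⟨proj z, hz⟩
    have ht' : (h t : Cylinder) = proj z := congrArg Subtype.val ht
    have e : (ρ.den : ℝ) * (ρ : ℝ) = 0 + (ρ.num : ℝ) := by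
      have := Rat.cast_def (K := ℝ) ρ
      rw [this]
      field_simp
      ring
    rw [← cylMap_iterate_proj hH, ← ht', hit, e, coe_add_intCast, AddCircle.coe_zero, add_zero]
  obtain ⟨k, hk⟩ := (proj_eq_iff _ _).1 hfix
  have h1 := (hrot z hz).comp
    ((tendsto_id (α := ℕ) (x := atTop)).const_mul_atTop' ρ.den_pos)
  have h2 : Tendsto (fun n : ℕ => (((map H)^[ρ.den * n] z).1 - z.1) / ((ρ.den * n : ℕ) : ℝ)) atTop
      (𝓝 ((k : ℝ) / ρ.den)) := by
    refine tendsto_const_nhds.congr' ?_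
    filter_upwards [eventually_gt_atTop 0] with n hn
    have hn' : (n : ℝ) ≠ 0 := by exact_mod_cast hn.ne'
    rw [iterate_mul_of_eq_add_int hH hk]
    push_cast
    field_simp
    ring
  have h3 := tendsto_nhds_unique h1 h2
  have h4 : k = ρ.num := by
    rw [Rat.cast_def ρ, div_left_inj' hq] at h3
    exact_mod_cast h3.symm
  rwa [h4] at hk

namespace IsPeriodicPoint

variable {H : ℝ → ℝ → ℝ} {q : ℕ} {p : ℤ} {z w : ℝ × ℝ}

lemma iterate_add_mul (hH : IsTwistGenerating H) (hz : IsPeriodicPoint H q p z) (i n : ℕ) :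
    ((map H)^[i + q * n] z).1 = ((map H)^[i] z).1 + n * p := by
  have e : z.1 + (n : ℝ) * p = z.1 + ((n * p : ℤ) : ℝ) := by push_cast; ring
  rw [Function.iterate_add_apply, iterate_mul_of_eq_add_int hH hz, e, hH.iterate_add_int]
  push_cast
  rfl

lemma iterate_eq_mod (hH : IsTwistGenerating H) (hz : IsPeriodicPoint H q p z) (i : ℕ) :
    ((map H)^[i] z).1 = ((map H)^[i % q] z).1 + (i / q : ℕ) * p := by
  rw [← hz.iterate_add_mul hH, Nat.mod_add_div]

/-- Two ordered periodic orbits that touch coincide. -/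
lemma eq_of_touch (hH : IsTwistGenerating H) (hq : 0 < q) (hz : IsPeriodicPoint H q p z)
    (hw : IsPeriodicPoint H q p w) (hle : ∀ i, ((map H)^[i] z).1 ≤ ((map H)^[i] w).1) {j : ℕ}
    (hj : ((map H)^[j] z).1 = ((map H)^[j] w).1) : z = w := by
  -- Adding a period moves the contact to a positive time, so that it has a predecessor.
  obtain ⟨m, hm⟩ : ∃ m, j + q * 1 = m + 1 := ⟨j + q - 1, by omega⟩
  have e1 := hz.iterate_add_mul hH j 1
  have e2 := hw.iterate_add_mul hH j 1
  rw [hm] at e1 e2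
  have h0 := hle m
  have h2 := hle (m + 2)
  have z1 := hH.euler_lagrange ((map H)^[m] z)
  have w1 := hH.euler_lagrange ((map H)^[m] w)
  simp only [← Function.iterate_succ_apply' (map H)] at z1 w1
  have hb : ((map H)^[m + 1] z).1 = ((map H)^[m + 1] w).1 := by rw [e1, e2, hj]
  rw [Nat.succ_eq_add_one, hb] at z1
  -- At the contact both neighbours are ordered the same way, and both terms of the Euler–Lagrange
  -- equation are strictly decreasing in them; as the sums are equal, so are the neighbours.
  have h3 := (hH.pd₂_strictAnti ((map H)^[m + 1] w).1).antitone h0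
  have h4 := (hH.pd₁_strictAnti ((map H)^[m + 1] w).1).antitone h2
  have h5 : pd₂ H ((map H)^[m] z).1 ((map H)^[m + 1] w).1 =
      pd₂ H ((map H)^[m] w).1 ((map H)^[m + 1] w).1 := by
    simp only [Nat.succ_eq_add_one, add_assoc, Nat.reduceAdd] at z1 w1
    linarith
  have h6 : ((map H)^[m] z).1 = ((map H)^[m] w).1 :=
    (hH.pd₂_strictAnti ((map H)^[m + 1] w).1).injective h5
  refine hH.map_injective.iterate m (Prod.ext h6 ?_)
  have s1 := (hH.map_spec ((map H)^[m] z)).1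
  have s2 := (hH.map_spec ((map H)^[m] w)).1
  rw [← Function.iterate_succ_apply' (map H)] at s1 s2
  rw [s1, s2, Nat.succ_eq_add_one, hb, h6]

end IsPeriodicPoint

lemma tendsto_of_add_one_eq {φ : ℝ → ℝ} {d : ℝ} (hφ : Continuous φ) (hd : 0 < d)
    (h : ∀ s, φ (s + 1) = φ s + d) : Tendsto φ atTop atTop ∧ Tendsto φ atBot atBot := by
  have hper : Function.Periodic (fun s => φ s - s * d) 1 := fun s => by
    simp only [h]
    ring
  obtain ⟨C, hC⟩ := (hper.isBounded_of_continuous one_ne_zero (by fun_prop)).exists_norm_le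
  have hC' : ∀ s, |φ s - s * d| ≤ C := fun s => hC _ ⟨s, rfl⟩
  constructor
  · refine tendsto_atTop_mono (fun s => ?_)
      (tendsto_atTop_add_const_right _ (-C) (tendsto_id.atTop_mul_const hd))
    have := (abs_le.1 (hC' s)).1
    simp only [id]
    linarith
  · refine tendsto_atBot_mono (fun s => ?_)
      (tendsto_atBot_add_const_right _ C (tendsto_id.atBot_mul_const hd))
    have := (abs_le.1 (hC' s)).2
    simp only [id]
    linarith

/-- A curve of periodic points around the cylinder sweeps through every periodic point. -/
lemma IsPeriodicPoint.exists_sweep {H : ℝ → ℝ → ℝ} (hH : IsTwistGenerating H) {q : ℕ} {p : ℤ}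
    (hq : 0 < q) {c : ℝ → ℝ × ℝ} {d : ℤ} (hc : Continuous c) (hd : 0 < d)
    (hc1 : ∀ s, c (s + 1) = ((c s).1 + d, (c s).2)) (hper : ∀ s, IsPeriodicPoint H q p (c s))
    {w : ℝ × ℝ} (hw : IsPeriodicPoint H q p w) :
    ∃ s₀, c s₀ = w ∧ ∀ s < s₀, ∀ i, ((map H)^[i] (c s)).1 < ((map H)^[i] w).1 := by
  have hX : ∀ i, Continuous fun s => ((map H)^[i] (c s)).1 := fun i =>
    continuous_fst.comp ((hH.continuous_map.iterate i).comp hc)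
  have hlim : ∀ i, Tendsto (fun s => ((map H)^[i] (c s)).1) atTop atTop ∧
      Tendsto (fun s => ((map H)^[i] (c s)).1) atBot atBot := fun i =>
    tendsto_of_add_one_eq (d := d) (hX i) (by exact_mod_cast hd) fun s => by
      rw [hc1, hH.iterate_add_int]
  -- `P s` says that the orbit of `c s` is strictly to the left of that of `w`; by periodicity `q`
  -- times suffice, which makes it an open condition. It holds far to the left, and the supremum of
  -- `A` is the first parameter at which it fails.
  set P : ℝ → Prop := fun s => ∀ i < q, ((map H)^[i] (c s)).1 < ((map H)^[i] w).1 with hP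
  have hPbot : ∀ᶠ s in atBot, P s :=
    (eventually_all_finite (finite_lt_nat q)).2 fun i _ => (hlim i).2.eventually_lt_atBot _
  have hPopen : ∀ s, P s → ∀ᶠ t in 𝓝 s, P t := fun s hs =>
    (eventually_all_finite (finite_lt_nat q)).2 fun i hi =>
      (hX i).continuousAt.eventually_lt_const (hs i hi)
  set A : Set ℝ := {s | ∀ t ≤ s, P t} with hA
  have hAne : A.Nonempty := by
    obtain ⟨a, ha⟩ := eventually_atBot.1 hPbot
    exact ⟨a, ha⟩
  have hAbdd : BddAbove A := by
    obtain ⟨b, hb⟩ := ((hlim 0).1.eventually_ge_atTop ((map H)^[0] w).1).exists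
    refine ⟨b, fun s hs => ?_⟩
    by_contra! hlt
    exact absurd (hs b hlt.le 0 hq) (not_lt.2 hb)
  have hlt : ∀ s < sSup A, P s := fun s hs => by
    obtain ⟨a, ha, hsa⟩ := exists_lt_of_lt_csSup hAne hs
    exact ha s hsa.le
  have hmod : ∀ s, P s → ∀ i, ((map H)^[i] (c s)).1 < ((map H)^[i] w).1 := fun s hs i => by
    rw [(hper s).iterate_eq_mod hH, hw.iterate_eq_mod hH i]
    linarith [hs _ (Nat.mod_lt i hq)]
  have hle : ∀ i, ((map H)^[i] (c (sSup A))).1 ≤ ((map H)^[i] w).1 := fun i => by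
    refine le_of_tendsto ((hX i).continuousWithinAt (s := Iio (sSup A))) ?_
    filter_upwards [self_mem_nhdsWithin] with s hs
    exact (hmod s (hlt s hs) i).le
  have hnot : ¬ P (sSup A) := fun hs => by
    obtain ⟨ε, hε, hball⟩ := Metric.eventually_nhds_iff.1 (hPopen _ hs)
    have hmem : sSup A + ε / 2 ∈ A := fun t ht => by
      rcases lt_or_ge t (sSup A) with h | h
      · exact hlt t h
      · refine hball ?_
        rw [Real.dist_eq, abs_of_nonneg (by linarith)]
        linarith
    linarith [le_csSup hAbdd hmem]
  obtain ⟨j, -, hj⟩ : ∃ j < q, ((map H)^[j] w).1 ≤ ((map H)^[j] (c (sSup A))).1 := by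
    simpa [hP] using hnot
  exact ⟨sSup A, (hper _).eq_of_touch hH hq hw hle (le_antisymm (hle j) hj),
    fun s hs => hmod s (hlt s hs)⟩

/-- By `IsPeriodicPoint.exists_sweep` every periodic point of this type lies on the curve, and the
parameter of first contact orders their orbits totally. Hence there is exactly one such point over
each abscissa, and the ordering of images and preimages gives the Lipschitz bound as for invariant
graphs. -/
lemma IsRotationCurve.exists_periodicGraph {H : ℝ → ℝ → ℝ} (hH : IsTwistGenerating H)
    {Γ : Set Cylinder} {ρ : ℚ} (hΓ : IsRotationCurve H Γ ρ) :
    ∃ (g : ℝ → ℝ) (h : IsPeriodicGraph H g ρ), Γ = graph (descend h.inv.cont h.inv.per) := by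
  obtain ⟨c, d, hc, hd, hc1, hcΓ, -⟩ := hΓ.essential.exists_lift
  have hq := ρ.den_pos
  have hper : ∀ s, IsPeriodicPoint H ρ.den ρ.num (c s) := fun s =>
    hΓ.isPeriodicPoint hH (hcΓ s)
  have hord : ∀ {z w}, IsPeriodicPoint H ρ.den ρ.num z → IsPeriodicPoint H ρ.den ρ.num w →
      z.1 ≤ w.1 → z = w ∨ ∀ i, ((map H)^[i] z).1 < ((map H)^[i] w).1 := by
    intro z w hz hw hzw
    obtain ⟨s, rfl, hs⟩ := IsPeriodicPoint.exists_sweep hH hq hc hd hc1 hper hz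
    obtain ⟨t, rfl, ht⟩ := IsPeriodicPoint.exists_sweep hH hq hc hd hc1 hper hw
    rcases lt_trichotomy s t with h | h | h
    · exact Or.inr (ht s h)
    · exact Or.inl (by rw [h])
    · exact absurd (hs t h 0) (not_lt.2 hzw)
  have hcont1 : Continuous fun s => (c s).1 := continuous_fst.comp hc
  have hlim := tendsto_of_add_one_eq (d := d) hcont1 (by exact_mod_cast hd)
    fun s => congrArg Prod.fst (hc1 s)
  choose σ hσ using hcont1.surjective hlim.1 hlim.2
  set g : ℝ → ℝ := fun x => (c (σ x)).2 with hg
  have hcσ : ∀ x, c (σ x) = (x, g x) := fun x => Prod.ext (hσ x) rfl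
  have hmem : ∀ x r, proj (x, r) ∈ Γ ↔ r = g x := fun x r => by
    constructor
    · intro h
      rcases hord (hΓ.isPeriodicPoint hH h) (hper (σ x)) (hσ x).ge with h1 | h1
      · rw [hcσ] at h1
        exact congrArg Prod.snd h1
      · have h2 := h1 0
        rw [hcσ] at h2
        exact absurd h2 (lt_irrefl _)
    · rintro rfl
      rw [← hcσ]
      exact hcΓ _
  have hgper : ∀ x, IsPeriodicPoint H ρ.den ρ.num (x, g x) := fun x => hcσ x ▸ hper (σ x)
  have hle : ∀ {x y}, x ≤ y → ∀ i, ((map H)^[i] (x, g x)).1 ≤ ((map H)^[i] (y, g y)).1 := by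
    intro x y hxy i
    rcases hord (hgper x) (hgper y) hxy with h | h
    · rw [h]
    · exact (h i).le
  obtain ⟨M, hM, hlip⟩ := hH.exists_lipschitz
  have hfwd : ∀ x, g x = -pd₁ H x ((map H)^[1] (x, g x)).1 := fun x => (hH.map_spec (x, g x)).1
  -- By periodicity the iterate of order `ρ.den - 1` serves as the preimage, up to the translation
  -- by `ρ.num`.
  have hbwd : ∀ x, g x = pd₂ H ((map H)^[ρ.den - 1] (x, g x)).1 (x + ρ.num) := fun x => by
    have h1 : map H ((map H)^[ρ.den - 1] (x, g x)) = (x + ρ.num, g x) := by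
      rw [← Function.iterate_succ_apply' (map H), Nat.succ_eq_add_one, Nat.sub_add_cancel hq]
      exact hgper x
    have h2 := (hH.map_spec ((map H)^[ρ.den - 1] (x, g x))).2
    rwa [h1] at h2
  have hbound : ∀ x y, x ≤ y → |g y - g x| ≤ M * |y - x| := fun x y hxy => by
    have h1 := (hH.pd₁_strictAnti y).antitone (hle hxy 1)
    have h2 := (abs_le.1 (hlip.1 ((map H)^[1] (x, g x)).1 y x)).2
    have h3 := (hH.pd₂_strictAnti (y + ρ.num)).antitone (hle hxy (ρ.den - 1))
    have h4 := (abs_le.1 (hlip.2 ((map H)^[ρ.den - 1] (x, g x)).1 (y + ρ.num) (x + ρ.num))).2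
    rw [add_sub_add_right_eq_sub] at h4
    rw [abs_le]
    constructor
    · rw [hfwd x, hfwd y]
      linarith
    · rw [hbwd x, hbwd y]
      linarith
  have hcont : Continuous g := by
    refine (LipschitzWith.of_dist_le_mul (K := M.toNNReal) fun x y => ?_).continuous
    rw [Real.dist_eq, Real.dist_eq, Real.coe_toNNReal M hM.le]
    rcases le_total x y with h | h
    · rw [abs_sub_comm, abs_sub_comm x]
      exact hbound x y h
    · exact hbound y x h
  have hgp : ∀ x, g (x + 1) = g x := fun x => by
    have h1 : proj (x + (1 : ℤ), g x) ∈ Γ := by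
      rw [proj_add_int]
      exact (hmem x _).2 rfl
    have h2 := (hmem _ _).1 h1
    push_cast at h2
    exact h2.symm
  have hinv : IsInvGraph H g := ⟨hcont, hgp, fun x => by
    have h1 : cylMap H (proj (x, g x)) ∈ Γ :=
      hΓ.invariant ▸ mem_image_of_mem _ ((hmem x _).2 rfl)
    rw [cylMap_proj hH] at h1
    exact (hmem _ _).1 h1⟩
  refine ⟨g, ⟨hinv, fun x => ?_⟩, ?_⟩
  · exact (congrArg Prod.fst (hinv.iterate_eq ρ.den x)).symm.trans
      (congrArg Prod.fst (hgper x))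
  · ext w
    obtain ⟨⟨x, r⟩, rfl⟩ := proj_surjective w
    rw [hmem, mem_graph_descend]

/-! ### The region between two graphs -/

/-- A point below both graphs or above both lies on a vertical half-line that misses them, so its
component is unbounded. The open set between the graphs is bounded and separated from the outer open
set, which traps the remaining components. -/
lemma regionBetween_graph {G₁ G₂ : C(UnitAddCircle, ℝ)} (hlt : ∀ t, G₁ t < G₂ t) :
    regionBetween (graph G₁) (graph G₂) = {w | G₁ w.1 ≤ w.2 ∧ w.2 ≤ G₂ w.1} := by
  have hc₁ : Continuous fun w : Cylinder => G₁ w.1 := G₁.continuous.comp continuous_fst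
  have hc₂ : Continuous fun w : Cylinder => G₂ w.1 := G₂.continuous.comp continuous_fst
  have hunb : ∀ (t : UnitAddCircle) (r : ℝ) (S : Set ℝ), IsPreconnected S → r ∈ S →
      (∀ s ∈ S, s ≠ G₁ t ∧ s ≠ G₂ t) →
      Bornology.IsBounded (connectedComponentIn (graph G₁ ∪ graph G₂)ᶜ (t, r)) →
      Bornology.IsBounded S := by
    intro t r S hS hr hSG hb
    have h1 : IsPreconnected ({t} ×ˢ S : Set Cylinder) := isPreconnected_singleton.prod hS
    have h2 := h1.subset_connectedComponentIn (x := (t, r)) ⟨rfl, hr⟩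
      (F := (graph G₁ ∪ graph G₂)ᶜ) (by
        rintro ⟨t', s⟩ ⟨rfl, hs⟩ (h | h)
        · exact (hSG s hs).1 h
        · exact (hSG s hs).2 h)
    have h3 := LipschitzWith.prod_snd.isBounded_image (hb.subset h2)
    rwa [snd_image_prod (singleton_nonempty t)] at h3
  ext ⟨t, r⟩
  constructor
  · rintro ((h | h) | h)
    · have h' : r = G₁ t := h
      exact ⟨h'.ge, h'.le.trans (hlt t).le⟩
    · have h' : r = G₂ t := h
      exact ⟨(hlt t).le.trans h'.ge, h'.le⟩
    · constructor
      · by_contra! hr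
        simp only at hr
        refine not_bddBelow_Iic r (hunb t r (Iic r) isPreconnected_Iic self_mem_Iic
          (fun s hs => ⟨?_, ?_⟩) h).bddBelow
        · exact (lt_of_le_of_lt hs hr).ne
        · exact ((lt_of_le_of_lt hs hr).trans (hlt t)).ne
      · by_contra! hr
        simp only at hr
        refine not_bddAbove_Ici r (hunb t r (Ici r) isPreconnected_Ici self_mem_Ici
          (fun s hs => ⟨?_, ?_⟩) h).bddAbove
        · exact ((hlt t).trans (lt_of_lt_of_le hr hs)).ne'
        · exact (lt_of_lt_of_le hr hs).ne'
  · rintro ⟨h1, h2⟩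
    simp only at h1 h2
    rcases h1.eq_or_lt with h1 | h1
    · exact Or.inl (Or.inl h1.symm)
    rcases h2.eq_or_lt with h2 | h2
    · exact Or.inl (Or.inr h2)
    right
    set V : Set Cylinder := {w | G₁ w.1 < w.2} ∩ {w | w.2 < G₂ w.1} with hV
    set V' : Set Cylinder := {w | w.2 < G₁ w.1} ∪ {w | G₂ w.1 < w.2} with hV'
    have hVo : IsOpen V :=
      (isOpen_lt hc₁ continuous_snd).inter (isOpen_lt continuous_snd hc₂)
    have hVo' : IsOpen V' :=
      (isOpen_lt continuous_snd hc₁).union (isOpen_lt hc₂ continuous_snd)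
    have hdisj : Disjoint V V' := by
      rw [Set.disjoint_left]
      rintro w ⟨ha, hb⟩ (h | h)
      · exact lt_asymm (show G₁ w.1 < w.2 from ha) h
      · exact lt_asymm (show w.2 < G₂ w.1 from hb) h
    have hcov : (graph G₁ ∪ graph G₂)ᶜ ⊆ V ∪ V' := by
      intro w hw
      have e1 : w.2 ≠ G₁ w.1 := fun h => hw (Or.inl h)
      have e2 : w.2 ≠ G₂ w.1 := fun h => hw (Or.inr h)
      rcases e1.lt_or_gt with h | h
      · exact Or.inr (Or.inl h)
      rcases e2.lt_or_gt with h' | h'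
      · exact Or.inl ⟨h, h'⟩
      · exact Or.inr (Or.inr h')
    have hmem : ((t, r) : Cylinder) ∈ (graph G₁ ∪ graph G₂)ᶜ := by
      rintro (h | h)
      · exact h1.ne' h
      · exact h2.ne h
    have hsub := isPreconnected_connectedComponentIn.subset_left_of_subset_union hVo hVo' hdisj
      ((connectedComponentIn_subset _ _).trans hcov)
      ⟨(t, r), mem_connectedComponentIn hmem, h1, h2⟩
    refine (isCompact_univ.prod (isCompact_Icc (a := -‖G₁‖) (b := ‖G₂‖))).isBounded.subset
      (hsub.trans ?_)
    rintro w ⟨ha, hb⟩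
    refine ⟨mem_univ _, ?_, ?_⟩
    · exact (neg_le_of_abs_le (G₁.norm_coe_le_norm w.1)).trans (le_of_lt ha)
    · exact (le_of_lt hb).trans (le_of_abs_le (G₂.norm_coe_le_norm w.1))

end TwistMap

namespace TwistMap

/-! ### The three implications -/

variable {H : ℝ → ℝ → ℝ} {g₁ g₂ : ℝ → ℝ} {ρ₁ ρ₂ : ℚ}

/-- The region between two periodic graphs, described in the plane. -/
lemma proj_mem_regionBetween (h₁ : IsInvGraph H g₁) (h₂ : IsInvGraph H g₂)
    (hlt : ∀ x, g₁ x < g₂ x) (x r : ℝ) :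
    proj (x, r) ∈ regionBetween (graph (descend h₁.cont h₁.per)) (graph (descend h₂.cont h₂.per)) ↔
      g₁ x ≤ r ∧ r ≤ g₂ x := by
  rw [regionBetween_graph fun t => ?_]
  · rfl
  · obtain ⟨x, rfl⟩ := QuotientAddGroup.mk_surjective t
    exact hlt x

lemma c0IntegrableOn_of_rationallyIntegrableOn (hH : IsTwistGenerating H) (hρ : ρ₁ < ρ₂)
    (h₁ : IsPeriodicGraph H g₁ ρ₁) (h₂ : IsPeriodicGraph H g₂ ρ₂) (hlt : ∀ x, g₁ x < g₂ x)
    (h : RationallyIntegrableOn H ρ₁ ρ₂) :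
    C0IntegrableOn H (regionBetween (graph (descend h₁.inv.cont h₁.inv.per))
      (graph (descend h₂.inv.cont h₂.inv.per))) := by
  -- The family is prescribed to be `g₁` and `g₂` at the endpoints, so that the foliation fills
  -- exactly the region between these graphs. Outside the interval the value is arbitrary.
  have hex : ∀ ρ : ℚ, ∃ g : ℝ → ℝ, (ρ₁ ≤ ρ ∧ ρ ≤ ρ₂ → IsPeriodicGraph H g ρ) ∧
      (ρ = ρ₁ → g = g₁) ∧ (ρ = ρ₂ → g = g₂) := fun ρ => by
    by_cases e₁ : ρ = ρ₁
    · subst e₁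
      exact ⟨g₁, fun _ => h₁, fun _ => rfl, fun e => absurd e hρ.ne⟩
    by_cases e₂ : ρ = ρ₂
    · subst e₂
      exact ⟨g₂, fun _ => h₂, fun e => absurd e e₁, fun _ => rfl⟩
    by_cases hr : ρ₁ ≤ ρ ∧ ρ ≤ ρ₂
    · obtain ⟨Γ, hΓ⟩ := h ρ hr.1 hr.2
      obtain ⟨g, hg, -⟩ := hΓ.exists_periodicGraph hH
      exact ⟨g, fun _ => hg, fun e => absurd e e₁, fun e => absurd e e₂⟩
    · exact ⟨g₁, fun e => absurd e hr, fun e => absurd e e₁, fun e => absurd e e₂⟩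
  choose γ hγ hγ₁ hγ₂ using hex
  obtain ⟨L, hL, hdisj, hbd, hcov⟩ := exists_foliation hH hρ.le hγ
  rw [hγ₁ ρ₁ rfl, hγ₂ ρ₂ rfl] at hbd hcov
  refine ⟨{G | (fun x : ℝ => G (x : UnitAddCircle)) ∈ L}, fun G hG => ?_, ?_, ?_⟩
  · convert (hL _ hG).isInvariant_graph hH
    ext t
    obtain ⟨x, rfl⟩ := QuotientAddGroup.mk_surjective t
    rfl
  · intro G hG G' hG' hne
    refine Set.disjoint_left.2 fun w hw hw' => hne ?_
    obtain ⟨⟨x, r⟩, rfl⟩ := proj_surjective w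
    have e := hdisj _ hG _ hG' x (Eq.trans (Eq.symm hw) hw')
    ext t
    obtain ⟨y, rfl⟩ := QuotientAddGroup.mk_surjective t
    exact congrFun e y
  · ext w
    obtain ⟨⟨x, r⟩, rfl⟩ := proj_surjective w
    rw [proj_mem_regionBetween h₁.inv h₂.inv hlt, mem_iUnion₂]
    constructor
    · rintro ⟨G, hG, hw⟩
      have hw' : r = G (x : UnitAddCircle) := hw
      exact hw' ▸ hbd _ hG x
    · rintro ⟨ha, hb⟩
      obtain ⟨g, hg, rfl⟩ := hcov x r ha hb
      exact ⟨descend (hL g hg).cont (hL g hg).per, hg, rfl⟩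

/-- The point of the orbit at time `j` lies on some leaf, and along an invariant graph vertical
Jacobi fields stay positive. -/
lemma noConjugatePointsOn_of_c0IntegrableOn (hH : IsTwistGenerating H) {U : Set Cylinder}
    (h : C0IntegrableOn H U) : NoConjugatePointsOn H U := by
  obtain ⟨L, hL, -, rfl⟩ := h
  intro z _ hz j k hjk
  obtain ⟨G, hG, hw⟩ := mem_iUnion₂.1 (hz j)
  have hw' : (z j).2 = G ((z j).1 : UnitAddCircle) := hw
  obtain ⟨n, hn⟩ : ∃ n, (k - j).toNat = n + 1 := ⟨(k - j).toNat - 1, by omega⟩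
  rw [hn, hw']
  exact ((isInvGraph_of_isInvariant hH (hL G hG)).deriv_iterate_pos hH n (z j).1).ne'

/-- Every point lies on a full orbit, which stays in every set that is invariant in both time
directions. -/
lemma IsTwistGenerating.exists_orbit (hH : IsTwistGenerating H) (z₀ : ℝ × ℝ) {S : Set (ℝ × ℝ)}
    (hz₀ : z₀ ∈ S) (hS : ∀ z, map H z ∈ S ↔ z ∈ S) :
    ∃ z : ℤ → ℝ × ℝ, IsOrbit H z ∧ z 0 = z₀ ∧ ∀ k, z k ∈ S := by
  let e : Equiv.Perm (ℝ × ℝ) := Equiv.ofBijective (map H) ⟨hH.map_injective, hH.map_surjective⟩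
  have hz : ∀ k : ℤ, (e ^ (k + 1)) z₀ = map H ((e ^ k) z₀) := fun k => by
    rw [add_comm, zpow_add, zpow_one]
    rfl
  refine ⟨fun k => (e ^ k) z₀, hz, rfl, fun k => ?_⟩
  induction k using Int.induction_on with
  | zero => exact hz₀
  | succ n ih =>
    change (e ^ ((n : ℤ) + 1)) z₀ ∈ S
    rw [hz]
    exact (hS _).2 ih
  | pred n ih =>
    have h := hz (-n - 1)
    rw [sub_add_cancel] at h
    exact (hS _).1 (h ▸ ih)

/-- The hypothesis concerns full orbits in the region; since each boundary graph separates points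
invariantly in both time directions, every point of the region lies on such an orbit. -/
lemma isDisconjugate_of_noConjugatePointsOn (hH : IsTwistGenerating H)
    (h₁ : IsInvGraph H g₁) (h₂ : IsInvGraph H g₂) (hlt : ∀ x, g₁ x < g₂ x)
    (h : NoConjugatePointsOn H (regionBetween (graph (descend h₁.cont h₁.per))
      (graph (descend h₂.cont h₂.per)))) : IsDisconjugate H g₁ g₂ := by
  refine ⟨h₁, h₂, hlt, fun n x r hn ha hb => ?_⟩
  obtain ⟨z, hz, hz0, hzS⟩ := hH.exists_orbit (x, r)
    (S := {z | g₁ z.1 ≤ z.2 ∧ z.2 ≤ g₂ z.1}) ⟨ha, hb⟩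
    fun z => and_congr (h₁.le_map_iff hH z) (h₂.map_le_iff hH z)
  have h1 := h z hz (fun k => (proj_mem_regionBetween h₁ h₂ hlt _ _).2 (hzS k)) 0 n (by omega)
  rw [hz0] at h1
  simpa using h1

lemma rationallyIntegrableOn_of_isDisconjugate (hH : IsTwistGenerating H)
    (h₁ : IsPeriodicGraph H g₁ ρ₁) (h₂ : IsPeriodicGraph H g₂ ρ₂) (h : IsDisconjugate H g₁ g₂) :
    RationallyIntegrableOn H ρ₁ ρ₂ := by
  intro ρ ha hb
  rcases ha.eq_or_lt with rfl | ha
  · exact ⟨_, h₁.isRotationCurve hH⟩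
  rcases hb.eq_or_lt with rfl | hb
  · exact ⟨_, h₂.isRotationCurve hH⟩
  obtain ⟨η, hη⟩ := h.exists_periodicGraph hH (h₁.hasRot hH) (h₂.hasRot hH) (ρ := ρ)
    (by exact_mod_cast ha) (by exact_mod_cast hb)
  exact ⟨_, hη.isRotationCurve hH⟩

end TwistMap

theorem mainTheorem2 (H : ℝ → ℝ → ℝ) (hH : TwistMap.IsTwistGenerating H)
    (ρ₁ ρ₂ : ℚ) (hρ : ρ₁ < ρ₂) (Γ₁ Γ₂ : Set TwistMap.Cylinder)
    (h₁ : TwistMap.IsRotationCurve H Γ₁ (ρ₁ : ℝ))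
    (h₂ : TwistMap.IsRotationCurve H Γ₂ (ρ₂ : ℝ)) :
    List.TFAE
      [TwistMap.RationallyIntegrableOn H ρ₁ ρ₂,
       TwistMap.NoConjugatePointsOn H (TwistMap.regionBetween Γ₁ Γ₂),
       TwistMap.C0IntegrableOn H (TwistMap.regionBetween Γ₁ Γ₂)] := by
  obtain ⟨g₁, hg₁, rfl⟩ := h₁.exists_periodicGraph hH
  obtain ⟨g₂, hg₂, rfl⟩ := h₂.exists_periodicGraph hH
  have hlt : ∀ x, g₁ x < g₂ x := hg₁.inv.lt_of_rot_lt hH hg₂.inv (hg₁.hasRot hH) (hg₂.hasRot hH)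
    (by exact_mod_cast hρ)
  tfae_have 1 → 3 :=
    TwistMap.c0IntegrableOn_of_rationallyIntegrableOn hH hρ hg₁ hg₂ hlt
  tfae_have 3 → 2 := TwistMap.noConjugatePointsOn_of_c0IntegrableOn hH
  tfae_have 2 → 1 := fun h =>
    TwistMap.rationallyIntegrableOn_of_isDisconjugate hH hg₁ hg₂
      (TwistMap.isDisconjugate_of_noConjugatePointsOn hH hg₁.inv hg₂.inv hlt h)
  tfae_finish
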